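/- Let $q,p,\rho$ be (measurable) everywhere positive probability densities on $\mathbb{R}^d$, with $\rho$ differentiable, and let $w=\rho/p$. For a differentiable positive density $f$ write $s_f=\nabla\log f$. Let $k$ be a positive definite kernel on $\mathbb{R}^d$ of class $C^2$, and put $$\kappa_\rho(x,y)=s_\rho(x)^\top k(x,y)s_\rho(y)+s_\rho(x)^\top\nabla_y k(x,y)+s_\rho(y)^\top\nabla_x k(x,y)+\nabla_x\cdot\nabla_y k(x,y),\qquad h(x,y)=w(x)\,\kappa_\rho(x,y)\,w(y).$$ Assume the moment conditions $$\mathbb{E}_{x,y\sim q}[h(x,y)^2]<\infty,\qquad \mathbb{E}_{x\sim q}\big[w(x)\sqrt{k(x,x)}\big]<\infty,\qquad \mathbb{E}_{x\sim p}\big[w(x)\sqrt{k(x,x)}\big]<\infty .$$ Let $x_1,x_2,\dots$ be i.i.d. from $q$, let $$\mathbb{S}(q,p)=\mathbb{E}_{x,y\sim q}[h(x,y)],\qquad \hat{\mathbb{S}}_n=\frac{1}{n(n-1)}\sum_{1\le i\ne j\le n}h(x_i,x_j),\qquad \sigma_u^2=\operatorname{var}_{x\sim q}\big(\mathbb{E}_{y\sim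 q}[h(x,y)]\big).$$ 1. If $q\neq p$, then $\sqrt n\,(\hat{\mathbb{S}}_n-\mathbb{S}(q,p))\to\mathcal N(0,4\sigma_u^2)$ in distribution. Moreover $\sigma_u^2\neq 0$ provided that $p,q$ are differentiable, that the field $g=w\,q\,(s_q-s_p)$ satisfies $\int\|g\|_2^2\,dx<\infty$ and $\iint\|g(x)\|\,|k(x,y)|\,\|g(y)\|\,dx\,dy<\infty$, and that $k$ is integrally strictly positive definite, i.e. $\iint f(x)k(x,y)f(y)\,dx\,dy>0$ for every real $f$ with $0<\|f\|_{L^2}<\infty$ for which this integral converges absolutely. 2. If $q=p$, then $\sigma_u^2=0$. Moreover the nonzero eigenvalues, counted with multiplicity, of the integral operator $f\mapsto\int h(\cdot,y)f(y)p(y)\,dy$ on $L^2(p)$ have finite multiplicities and can be listed in a real sequence $(c_j)_{j\ge1}$ (padded with zeros); and for every such listing and i.i.d. standard Gaussian $Z_1,Z_2,\dots$, the series $\sum_{j=1}^\infty c_j(Z_j^2-1)$ converges almost surely and $$n\,\hat{\mathbb{S}}_n\to\sum_{j=1}^\infty c_j(Z_j^2-1)\quad\text{in distribution.}$$ -/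

import Mathlib

open MeasureTheory ProbabilityTheory Filter Topology
open scoped InnerProductSpace

noncomputable section

namespace GFKSD

/-- `ℝ^d` with its Euclidean structure. -/
abbrev E (d : ℕ) := EuclideanSpace ℝ (Fin d)

variable {d : ℕ}

/-- A positive probability density on `ℝ^d` with respect to Lebesgue measure. -/
structure IsPosDensity (f : E d → ℝ) : Prop where
  measurable : Measurable f
  pos : ∀ x, 0 < f x
  integral_eq_one : ∫ x, f x = 1

/-- The distribution on `ℝ^d` with density `f`. -/
def law (f : E d → ℝ) : Measure (E d) := volume.withDensity fun x => ENNReal.ofReal (f x)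

/-- A positive definite kernel, in the sense of reproducing kernels: symmetric, and every
Gram matrix is positive semidefinite. -/
def IsPosDefKernel (k : E d → E d → ℝ) : Prop :=
  ∀ (n : ℕ) (x : Fin n → E d), (Matrix.of fun i j => k (x i) (x j)).PosSemidef

/-- Integrally strictly positive definite kernel: `∫∫ g(x) k(x,y) g(y) dx dy > 0` for every
`g` with `0 < ‖g‖_{L²} < ∞` for which this double integral converges absolutely. -/
def IsIntegrallyStrictlyPosDef (k : E d → E d → ℝ) : Prop :=
  ∀ g : E d → ℝ, MemLp g 2 volume → ¬ g =ᵐ[volume] 0 →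
    Integrable (fun z : E d × E d => g z.1 * k z.1 z.2 * g z.2) (volume.prod volume) →
    0 < ∫ z : E d × E d, g z.1 * k z.1 z.2 * g z.2 ∂(volume.prod volume)

/-- The score function `s_f = ∇ log f`. -/
def score (f : E d → ℝ) (x : E d) : E d := gradient (fun z => Real.log (f z)) x

/-- The divergence `∇ · F` of a vector field. -/
def divergence (F : E d → E d) (x : E d) : ℝ :=
  ∑ i : Fin d, fderiv ℝ (fun z => F z i) x (EuclideanSpace.single i 1)

/-- The Stein kernel
`κ_ρ(x,y) = s_ρ(x)ᵀ k(x,y) s_ρ(y) + s_ρ(x)ᵀ ∇_y k(x,y) + s_ρ(y)ᵀ ∇_x k(x,y) + ∇_x · (∇_y k(x,y))`. -/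
def steinKernel (ρ : E d → ℝ) (k : E d → E d → ℝ) (x y : E d) : ℝ :=
  k x y * ⟪score ρ x, score ρ y⟫_ℝ
    + ⟪score ρ x, gradient (fun y' => k x y') y⟫_ℝ
    + ⟪score ρ y, gradient (fun x' => k x' y) x⟫_ℝ
    + divergence (fun x' => gradient (fun y' => k x' y') y) x

/-- The importance weight `w = ρ / p`. -/
def weight (p ρ : E d → ℝ) (x : E d) : ℝ := ρ x / p x

/-- The weighted Stein kernel `w(x) κ_ρ(x,y) w(y)`. -/
def weightedSteinKernel (p ρ : E d → ℝ) (k : E d → E d → ℝ) (x y : E d) : ℝ :=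
  weight p ρ x * steinKernel ρ k x y * weight p ρ y

/-- The squared gradient-free KSD `E_{x,y∼q}[w(x) κ_ρ(x,y) w(y)]`. -/
def gfKSD (q p ρ : E d → ℝ) (k : E d → E d → ℝ) : ℝ :=
  ∫ z : E d × E d, weightedSteinKernel p ρ k z.1 z.2 ∂((law q).prod (law q))

/-- The U-statistic `(n(n-1))⁻¹ ∑_{i ≠ j} w(x_i) κ_ρ(x_i,x_j) w(x_j)` of `x_0, …, x_{n-1}`. -/
def uStat (p ρ : E d → ℝ) (k : E d → E d → ℝ) (n : ℕ) (x : ℕ → E d) : ℝ :=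
  (((n : ℝ) - 1) * n)⁻¹ *
    ∑ i ∈ Finset.range n, ∑ j ∈ (Finset.range n).erase i, weightedSteinKernel p ρ k (x i) (x j)

/-- `σ_u² = var_{x∼q}(E_{y∼q}[w(x) κ_ρ(x,y) w(y)])`. -/
def sigmaSq (q p ρ : E d → ℝ) (k : E d → E d → ℝ) : ℝ :=
  variance (fun x => ∫ y, weightedSteinKernel p ρ k x y ∂(law q)) (law q)

/-- The field `w q (s_q - s_p)`. -/
def scoreGap (q p ρ : E d → ℝ) (x : E d) : E d :=
  (weight p ρ x * q x) • (score q x - score p x)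

/-- The eigenspace, in `L²(μ)`, of the integral operator `f ↦ ∫ h(·,y) f(y) μ(dy)` for the
number `lam`. -/
def kernelEigenspace (h : E d → E d → ℝ) (μ : Measure (E d)) (lam : ℝ) :
    Submodule ℝ (Lp ℝ 2 μ) where
  carrier := {f | ∀ᵐ x ∂μ, Integrable (fun y => h x y * f y) μ ∧
    ∫ y, h x y * f y ∂μ = lam * f x}
  zero_mem' := by
    have h0 := Lp.coeFn_zero ℝ 2 μ
    filter_upwards [h0] with x hx
    have he : (fun y => h x y * (0 : Lp ℝ 2 μ) y) =ᵐ[μ] fun _ => (0 : ℝ) := by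
      filter_upwards [h0] with y hy
      rw [hy]
      simp
    refine ⟨(integrable_zero _ _ _).congr he.symm, ?_⟩
    rw [integral_congr_ae he, hx]
    simp
  add_mem' := by
    intro f g hf hg
    have ha := Lp.coeFn_add f g
    filter_upwards [hf, hg, ha] with x hfx hgx hax
    have he : (fun y => h x y * (f + g : Lp ℝ 2 μ) y) =ᵐ[μ]
        fun y => h x y * f y + h x y * g y := by
      filter_upwards [ha] with y hy
      rw [hy, Pi.add_apply, mul_add]
    refine ⟨(hfx.1.add hgx.1).congr he.symm, ?_⟩
    rw [integral_congr_ae he, integral_add hfx.1 hgx.1, hfx.2, hgx.2, hax]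
    simp [mul_add]
  smul_mem' := by
    intro c f hf
    have ha := Lp.coeFn_smul c f
    filter_upwards [hf, ha] with x hfx hax
    have he : (fun y => h x y * (c • f : Lp ℝ 2 μ) y) =ᵐ[μ] fun y => c * (h x y * f y) := by
      filter_upwards [ha] with y hy
      rw [hy, Pi.smul_apply, smul_eq_mul]
      ring
    refine ⟨(hfx.1.const_mul c).congr he.symm, ?_⟩
    rw [integral_congr_ae he, integral_const_mul, hfx.2, hax]
    simp
    ring

/-- `c` lists the eigenvalues of the integral operator of `h` on `L²(μ)`: every nonzero real
number occurs in `c` exactly as often as its multiplicity (the dimension of its eigenspace);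
the remaining entries of `c` are zero. -/
def IsEigenvalueSeq (h : E d → E d → ℝ) (μ : Measure (E d)) (c : ℕ → ℝ) : Prop :=
  ∀ lam : ℝ, lam ≠ 0 →
    Cardinal.mk {j : ℕ // c j = lam} = Module.rank ℝ (kernelEigenspace h μ lam)

end GFKSD

end

/-! A positive definite kernel factors as `k x y = ⟪Φ x, Φ y⟫` through a Hilbert space, and `Φ` is
differentiable because `k` is `C²` (`differentiable_featureMap`). The weighted Stein kernel is then
itself a Gram function, `h(x,y) = ⟪V x, V y⟫` with `V = w (s_ρ Φ + ∇Φ)` taking values in `d` copies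
of that space. Square integrability of `h` does not make `V` Bochner integrable, but it does give
`V` a weak mean `F` under `q` (`memLp_inner_of_memLp_gram`, `exists_weak_mean`), and `E_y h(x,y) =
⟪V x, F⟫`. So `σ_u²` is the variance of `⟪V, F⟫`.

The second ingredient is Stein's identity: `p ⟪V, u⟫` is the divergence of the field with
coordinates `ρ ⟪u_i, Φ⟫`, which is integrable by the moment condition under `p`, so `E_p ⟪V, u⟫ = 0`
whenever this expectation converges absolutely (`integral_inner_steinFeature_eq_zero`). If `q = p`,
the choice `u = F` gives `‖F‖² = 0`, so `h` is degenerate. If `σ_u² = 0` in general, then `⟪V, F⟫`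
is almost everywhere a constant; its mean is `‖F‖²` under `q` and `0` under `p`, so again `F = 0`.
Integration by parts against `q` then shows that `k` annihilates each coordinate of `w q (s_q -
s_p)`. Strict positive definiteness makes this field vanish, the scores agree, and normalization
forces `q = p`.

Both limit theorems rest on one bound: the off-diagonal sum of a degenerate kernel over `n` points
has second moment at most `2 n² E r²` (`integral_sq_degenerate_sum_le`). It makes the Hoeffding
remainder negligible in the first limit. In the second, it controls, uniformly in `n`, the error of
truncating the eigenfunction expansion of `h` (`hasSum_eigenvector_tensorLp`, from the spectral
theorem for compact symmetric operators). A finite-rank truncation is handled by the vector central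
limit theorem, the law of large numbers for the diagonal and Slutsky's theorem; characteristic
functions then remove the truncation. -/

namespace GFKSD

universe u

/-! ### Feature maps of positive definite kernels and their differentiability -/

section FeatureMap

/-- The space is the reproducing kernel Hilbert space of `k`, treated as an operator-valued kernel
with values in the operators on `ℝ`; the feature of `x` is the kernel section at `x`. -/
theorem exists_featureMap {X : Type u} (k : X → X → ℝ)
    (hk : ∀ (n : ℕ) (x : Fin n → X), (Matrix.of fun i j => k (x i) (x j)).PosSemidef) :
    ∃ (H : Type u) (_ : NormedAddCommGroup H) (_ : InnerProductSpace ℝ H) (_ : CompleteSpace H)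
      (Φ : X → H), ∀ x y, k x y = ⟪Φ x, Φ y⟫_ℝ := by
  have hsymm : ∀ x y, k x y = k y x := fun x y => by
    have h := (hk 2 ![x, y]).1.apply 1 0
    simpa using h
  let K : Matrix X X (ℝ →L[ℝ] ℝ) := fun x y => k x y • ContinuousLinearMap.id ℝ ℝ
  have hK : K.PosSemidef := by
    have htfae := (RKHS.posSemidef_tfae (K := K)).out 0 2
    refine htfae.2 ⟨?_, fun f => ?_⟩
    · ext x y
      rw [Matrix.conjTranspose_apply, ContinuousLinearMap.star_eq_adjoint]
      have : ContinuousLinearMap.adjoint (ContinuousLinearMap.id ℝ ℝ) =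
          ContinuousLinearMap.id ℝ ℝ :=
        ContinuousLinearMap.adjoint_id
      simp [K, hsymm x y, this]
    · classical
      -- Positivity against a finitely supported `f` is the Gram condition at the points of its
      -- support, enumerated by some `Fin n`.
      let e := f.support.equivFin
      have h := (hk _ (fun i => (e.symm i : X))).2
        (Finsupp.equivFunOnFinite.symm fun i => f (e.symm i))
      rw [Finsupp.sum_fintype _ _ (by simp)] at h
      simp only [Finsupp.equivFunOnFinite_symm_apply_apply, Matrix.of_apply, star_trivial] at h
      have h2 : ∀ i, ((Finsupp.equivFunOnFinite.symm fun i => f (e.symm i)).sum fun j xj =>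
          f (e.symm i) * k (e.symm i) (e.symm j) * xj) =
          ∑ y ∈ f.support, f (e.symm i) * k (e.symm i) y * f y := fun i => by
        rw [Finsupp.sum_fintype _ _ (by simp), ← Finset.sum_coe_sort f.support]
        exact e.symm.sum_comp fun y => f (e.symm i) * k (e.symm i) y * f y
      simp only [h2] at h
      rw [e.symm.sum_comp fun x => ∑ y ∈ f.support, f x * k x y * f y,
        Finset.sum_coe_sort f.support fun x => ∑ y ∈ f.support, f x * k x y * f y] at h
      refine h.trans_eq ?_
      simp only [Finsupp.sum, K]
      simp only [RCLike.re_to_real]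
      refine Finset.sum_congr rfl fun x _ => Finset.sum_congr rfl fun y _ => ?_
      simp [hsymm y x]
      ring
  have : Fact K.PosSemidef := ⟨hK⟩
  refine ⟨RKHS.OfKernel K, inferInstance, inferInstance, inferInstance,
    fun x => RKHS.kerFun (RKHS.OfKernel K) x 1, fun x y => ?_⟩
  rw [← RKHS.kernel_inner, RKHS.OfKernel.kernel_ofKernel]
  simp [K, hsymm x y]

variable {E : Type*} [NormedAddCommGroup E] [NormedSpace ℝ E]

set_option maxSynthPendingDepth 3 in
/-- The double increments of a `C²` function of two variables are governed by its mixed second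
derivative. -/
theorem exists_mixedDeriv_bound {k : E → E → ℝ} (hk : ContDiff ℝ 2 (Function.uncurry k)) (x₀ : E) :
    ∃ M : E →L[ℝ] E →L[ℝ] ℝ, ∀ ε > 0, ∃ δ > 0, ∀ v w : E, ‖v‖ < δ → ‖w‖ < δ →
      |k (x₀ + v) (x₀ + w) - k (x₀ + v) x₀ - k x₀ (x₀ + w) + k x₀ x₀ - M w v| ≤ ε * ‖v‖ * ‖w‖ := by
  let K := Function.uncurry k
  let K1 : E × E → E →L[ℝ] ℝ := fun z => (fderiv ℝ K z).comp (.inl ℝ E E)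
  have hK1 : ContDiff ℝ 1 K1 := by
    have : ContDiff ℝ 1 (fderiv ℝ K) := hk.fderiv_right (by norm_num)
    exact this.clm_comp contDiff_const
  let M : E × E → E →L[ℝ] E →L[ℝ] ℝ := fun z => (fderiv ℝ K1 z).comp (.inr ℝ E E)
  have hM : Continuous M := (hK1.continuous_fderiv (by norm_num)).clm_comp continuous_const
  have hd1 : ∀ x y, HasFDerivAt (fun x => k x y) (K1 (x, y)) x := fun x y => by
    have h1 : HasFDerivAt K (fderiv ℝ K (x, y)) (x, y) :=
      (hk.differentiable (by norm_num) _).hasFDerivAt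
    exact HasFDerivAt.comp (f := fun x => (x, y)) x h1 (hasFDerivAt_prodMk_left x y)
  have hd2 : ∀ x y, HasFDerivAt (fun y => K1 (x, y)) (M (x, y)) y := fun x y => by
    have h1 : HasFDerivAt K1 (fderiv ℝ K1 (x, y)) (x, y) :=
      (hK1.differentiable (by norm_num) _).hasFDerivAt
    exact HasFDerivAt.comp (f := fun y => (x, y)) y h1 (hasFDerivAt_prodMk_right x y)
  refine ⟨M (x₀, x₀), fun ε hε => ?_⟩
  have hMn : Tendsto (fun z => ‖M z - M (x₀, x₀)‖) (𝓝 (x₀, x₀)) (𝓝 0) :=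
    tendsto_iff_norm_sub_tendsto_zero.1 (hM.tendsto _)
  obtain ⟨δ, hδ, hMδ⟩ := Metric.eventually_nhds_iff.1 (hMn.eventually_lt_const hε)
  refine ⟨δ, hδ, fun v w hv hw => ?_⟩
  -- The mean value inequality is applied twice: here in the second variable, where the derivative
  -- `M (x, y)` stays within `ε` of `M (x₀, x₀)`, and then in the first variable to the resulting
  -- difference.
  have hstep : ∀ x ∈ Metric.ball x₀ δ,
      ‖K1 (x, x₀ + w) - K1 (x, x₀) - M (x₀, x₀) w‖ ≤ ε * ‖w‖ := fun x hx => by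
    have := (convex_ball x₀ δ).norm_image_sub_le_of_norm_hasFDerivWithin_le
      (f := fun y => K1 (x, y) - M (x₀, x₀) y) (f' := fun y => M (x, y) - M (x₀, x₀)) (C := ε)
      (fun y _ => ((hd2 x y).sub (M (x₀, x₀)).hasFDerivAt).hasFDerivWithinAt)
      (fun y hy => ?_) (Metric.mem_ball_self hδ)
      (show x₀ + w ∈ Metric.ball x₀ δ by simpa using hw)
    · simp only [map_add, add_sub_cancel_left] at this
      refine le_of_eq_of_le ?_ this
      congr 1
      abel
    · refine (hMδ ?_).le
      rw [Prod.dist_eq]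
      exact max_lt hx hy
  have := (convex_ball x₀ δ).norm_image_sub_le_of_norm_hasFDerivWithin_le
    (f := fun x => k x (x₀ + w) - k x x₀ - M (x₀, x₀) w x)
    (f' := fun x => K1 (x, x₀ + w) - K1 (x, x₀) - M (x₀, x₀) w) (C := ε * ‖w‖)
    (fun x _ => (((hd1 x _).sub (hd1 x _)).sub (M (x₀, x₀) w).hasFDerivAt).hasFDerivWithinAt)
    hstep (Metric.mem_ball_self hδ) (show x₀ + v ∈ Metric.ball x₀ δ by simpa using hv)
  simp only [map_add, add_sub_cancel_left] at this
  rw [Real.norm_eq_abs] at this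
  calc _ = |k (x₀ + v) (x₀ + w) - k (x₀ + v) x₀ - (M (x₀, x₀) w x₀ + M (x₀, x₀) w v) -
        (k x₀ (x₀ + w) - k x₀ x₀ - M (x₀, x₀) w x₀)| := by congr 1; ring
    _ ≤ _ := this
    _ = _ := by ring

/-- A feature map of a `C²` kernel is differentiable. -/
theorem differentiable_featureMap [FiniteDimensional ℝ E] {H : Type*} [NormedAddCommGroup H]
    [InnerProductSpace ℝ H] [CompleteSpace H] {k : E → E → ℝ}
    (hk : ContDiff ℝ 2 (Function.uncurry k)) {Φ : E → H} (hΦ : ∀ x y, k x y = ⟪Φ x, Φ y⟫_ℝ) :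
    Differentiable ℝ Φ := by
  intro x
  obtain ⟨M, hM⟩ := exists_mixedDeriv_bound hk x
  have hM' : ∀ ε > 0, ∃ δ > 0, ∀ v w : E, ‖v‖ < δ → ‖w‖ < δ →
      |⟪Φ (x + v) - Φ x, Φ (x + w) - Φ x⟫_ℝ - M w v| ≤ ε * ‖v‖ * ‖w‖ := fun ε hε => by
    obtain ⟨δ, hδ, h⟩ := hM ε hε
    refine ⟨δ, hδ, fun v w hv hw => le_of_eq_of_le ?_ (h v w hv hw)⟩
    simp only [inner_sub_left, inner_sub_right, hΦ]
    congr 1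
    ring
  let Q : E → ℝ → H := fun v t => t⁻¹ • (Φ (x + t • v) - Φ x)
  -- The two step sizes tend to zero independently; this is what makes the difference quotients
  -- Cauchy and not merely bounded.
  have hQ : ∀ v w : E, Tendsto (fun p : ℝ × ℝ => ⟪Q v p.1, Q w p.2⟫_ℝ)
      ((𝓝[≠] 0) ×ˢ (𝓝[≠] 0)) (𝓝 (M w v)) := fun v w => by
    rw [Metric.tendsto_nhds]
    intro ε hε
    obtain ⟨δ, hδ, h⟩ := hM' (ε / (2 * (1 + ‖v‖ * ‖w‖))) (by positivity)
    have hsmall : ∀ u : E, ∀ᶠ t : ℝ in 𝓝[≠] 0, t ≠ 0 ∧ ‖t • u‖ < δ := fun u => by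
      refine (eventually_mem_nhdsWithin).and (nhdsWithin_le_nhds ?_)
      have : Tendsto (fun t : ℝ => ‖t • u‖) (𝓝 0) (𝓝 ‖(0 : ℝ) • u‖) :=
        (continuous_id.smul continuous_const).norm.tendsto 0
      exact this.eventually_lt_const (by simpa using hδ)
    filter_upwards [(hsmall v).prod_mk (hsmall w)] with p ⟨⟨h1, h1'⟩, ⟨h2, h2'⟩⟩
    have h3 := h _ _ h1' h2'
    have h4 : ⟪Q v p.1, Q w p.2⟫_ℝ - M w v = (p.1 * p.2)⁻¹ *
        (⟪Φ (x + p.1 • v) - Φ x, Φ (x + p.2 • w) - Φ x⟫_ℝ - M (p.2 • w) (p.1 • v)) := by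
      simp only [Q, real_inner_smul_left, real_inner_smul_right, map_smul, smul_apply,
        smul_eq_mul]
      field_simp
    rw [Real.dist_eq, h4, abs_mul, abs_inv, abs_mul]
    simp only [norm_smul, Real.norm_eq_abs] at h3
    have hp : 0 < |p.1| * |p.2| := mul_pos (abs_pos.2 h1) (abs_pos.2 h2)
    calc _ ≤ (|p.1| * |p.2|)⁻¹ * (ε / (2 * (1 + ‖v‖ * ‖w‖)) * (|p.1| * ‖v‖) * (|p.2| * ‖w‖)) := by
          gcongr
      _ = ε * (‖v‖ * ‖w‖ / (2 * (1 + ‖v‖ * ‖w‖))) := by field_simp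
      _ < ε * 1 := by
          gcongr
          rw [div_lt_one (by positivity)]
          nlinarith [mul_nonneg (norm_nonneg v) (norm_nonneg w)]
      _ = ε := mul_one ε
  have hlim : ∀ v, ∃ D, Tendsto (Q v) (𝓝[≠] 0) (𝓝 D) := fun v => by
    refine cauchy_map_iff_exists_tendsto.1 ?_
    rw [cauchy_map_iff]
    refine ⟨inferInstance, Metric.uniformity_basis_dist.tendsto_right_iff.2 fun ε hε => ?_⟩
    have h0 : Tendsto (fun p : ℝ × ℝ => ‖Q v p.1 - Q v p.2‖ ^ 2) ((𝓝[≠] 0) ×ˢ (𝓝[≠] 0))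
        (𝓝 0) := by
      have hd1 : Tendsto (fun p : ℝ × ℝ => ((p.1, p.1) : ℝ × ℝ)) ((𝓝[≠] 0) ×ˢ (𝓝[≠] 0))
          ((𝓝[≠] 0) ×ˢ (𝓝[≠] 0)) := tendsto_fst.prodMk tendsto_fst
      have hd2 : Tendsto (fun p : ℝ × ℝ => ((p.2, p.2) : ℝ × ℝ)) ((𝓝[≠] 0) ×ˢ (𝓝[≠] 0))
          ((𝓝[≠] 0) ×ˢ (𝓝[≠] 0)) := tendsto_snd.prodMk tendsto_snd
      have := (((hQ v v).comp hd1).sub ((hQ v v).const_mul 2)).add ((hQ v v).comp hd2)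
      rw [show M v v - 2 * M v v + M v v = 0 by ring] at this
      refine this.congr fun p => ?_
      simp only [Function.comp_apply]
      rw [norm_sub_sq_real, real_inner_self_eq_norm_sq, real_inner_self_eq_norm_sq]
    filter_upwards [h0.eventually_lt_const (show (0 : ℝ) < ε ^ 2 by positivity)] with p hp
    rw [dist_eq_norm]
    exact lt_of_pow_lt_pow_left₀ 2 hε.le hp
  choose D hD using hlim
  have hDD : ∀ v w, ⟪D v, D w⟫_ℝ = M w v := fun v w =>
    tendsto_nhds_unique (((hD v).comp tendsto_fst).inner ((hD w).comp tendsto_snd)) (hQ v w)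
  -- Linearity follows from `hDD`: the squared norm of the defect expands into values of the
  -- bilinear form `M`, which cancel.
  let L : E →ₗ[ℝ] H :=
    { toFun := D
      map_add' := fun v w => by
        rw [← sub_eq_zero, ← inner_self_eq_zero (𝕜 := ℝ)]
        simp only [inner_sub_left, inner_sub_right, inner_add_left, inner_add_right, hDD, map_add,
          add_apply]
        ring
      map_smul' := fun c v => by
        rw [← sub_eq_zero, ← inner_self_eq_zero (𝕜 := ℝ)]
        simp only [inner_sub_left, inner_sub_right, real_inner_smul_left, real_inner_smul_right,
          hDD, map_smul, smul_apply, smul_eq_mul, RingHom.id_apply]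
        ring }
  refine HasFDerivAt.differentiableAt (f' := LinearMap.toContinuousLinearMap L) ?_
  rw [hasFDerivAt_iff_isLittleO_nhds_zero, Asymptotics.isLittleO_iff]
  intro c hc
  -- Expanding `‖Φ (x + v) - Φ x - L v‖²` uses the estimate once for the square and twice for the
  -- cross term, hence the third.
  obtain ⟨δ, hδ, h⟩ := hM' (c ^ 2 / 3) (by positivity)
  filter_upwards [Metric.ball_mem_nhds (0 : E) hδ] with v hv
  rw [mem_ball_zero_iff] at hv
  have hcross : |⟪Φ (x + v) - Φ x, D v⟫_ℝ - M v v| ≤ c ^ 2 / 3 * ‖v‖ ^ 2 := by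
    refine le_of_tendsto ((tendsto_const_nhds.inner (hD v)).sub_const _).abs ?_
    have : Tendsto (fun t : ℝ => ‖t • v‖) (𝓝 0) (𝓝 ‖(0 : ℝ) • v‖) :=
      (continuous_id.smul continuous_const).norm.tendsto 0
    filter_upwards [eventually_mem_nhdsWithin,
      nhdsWithin_le_nhds (this.eventually_lt_const (by simpa using hδ))] with t ht ht'
    have h3 := h _ _ hv ht'
    have ht0 : t ≠ 0 := ht
    have h4 : ⟪Φ (x + v) - Φ x, Q v t⟫_ℝ - M v v = t⁻¹ *
        (⟪Φ (x + v) - Φ x, Φ (x + t • v) - Φ x⟫_ℝ - M (t • v) v) := by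
      simp only [Q, real_inner_smul_right, map_smul, smul_apply, smul_eq_mul]
      field_simp
    rw [h4, abs_mul, abs_inv]
    rw [norm_smul, Real.norm_eq_abs] at h3
    have hp : 0 < |t| := abs_pos.2 ht0
    calc _ ≤ |t|⁻¹ * (c ^ 2 / 3 * ‖v‖ * (|t| * ‖v‖)) := by gcongr
      _ = _ := by field_simp
  have hself := h v v hv hv
  have hsq : ‖Φ (x + v) - Φ x - L v‖ ^ 2 ≤ (c * ‖v‖) ^ 2 := by
    rw [norm_sub_sq_real, ← real_inner_self_eq_norm_sq, ← real_inner_self_eq_norm_sq]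
    have e1 : ⟪L v, L v⟫_ℝ = M v v := hDD v v
    have e2 : ⟪Φ (x + v) - Φ x, L v⟫_ℝ = ⟪Φ (x + v) - Φ x, D v⟫_ℝ := rfl
    rw [e1, e2]
    have a1 := (abs_le.1 hcross).1
    have a2 := (abs_le.1 hself).2
    nlinarith
  exact le_of_sq_le_sq hsq (by positivity)

end FeatureMap

/-! ### Divergence theorems on the whole space -/

section Divergence

variable {d : ℕ}

theorem divergence_eq_zero_of_eventuallyEq {F : E d → E d} {x : E d} (h : F =ᶠ[𝓝 x] 0) :
    divergence F x = 0 := by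
  refine Finset.sum_eq_zero fun i _ => ?_
  have : (fun z => F z i) =ᶠ[𝓝 x] fun _ => (0 : ℝ) := h.mono fun z hz => by simp [hz]
  rw [this.fderiv_eq]
  simp

theorem differentiable_coord {F : E d → E d} (hF : Differentiable ℝ F) (i : Fin d) :
    Differentiable ℝ fun z => F z i :=
  (EuclideanSpace.proj (𝕜 := ℝ) i).differentiable.comp hF

/-- The divergence theorem for a field that vanishes outside a ball. -/
theorem integral_divergence_eq_zero_of_vanish {F : E d → E d} (hF : Differentiable ℝ F) {R : ℝ}
    (hR : 0 < R) (hFR : ∀ x, R ≤ ‖x‖ → F x = 0) (hdiv : Integrable (divergence F)) :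
    ∫ x, divergence F x = 0 := by
  rcases d with _ | n
  · simp [divergence]
  let e := PiLp.continuousLinearEquiv 2 ℝ (fun _ : Fin (n + 1) => ℝ)
  have hvol : MeasurePreserving (e.symm : (Fin (n + 1) → ℝ) → E (n + 1)) volume volume :=
    PiLp.volume_preserving_toLp (Fin (n + 1))
  have hemb : MeasurableEmbedding (e.symm : (Fin (n + 1) → ℝ) → E (n + 1)) :=
    e.symm.toHomeomorph.measurableEmbedding
  have hnorm : ∀ (y : Fin (n + 1) → ℝ) i, |y i| ≤ ‖e.symm y‖ := fun y i =>
    PiLp.norm_apply_le (e.symm y) i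
  let a : Fin (n + 1) → ℝ := fun _ => -(R + 1)
  let b : Fin (n + 1) → ℝ := fun _ => R + 1
  have hab : a ≤ b := fun i => by simp only [a, b]; linarith
  let f : Fin (n + 1) → (Fin (n + 1) → ℝ) → ℝ := fun i y => F (e.symm y) i
  let f' : Fin (n + 1) → (Fin (n + 1) → ℝ) → (Fin (n + 1) → ℝ) →L[ℝ] ℝ := fun i y =>
    (fderiv ℝ (fun z => F z i) (e.symm y)).comp (e.symm : (Fin (n + 1) → ℝ) →L[ℝ] E (n + 1))
  have hf : ∀ i y, HasFDerivAt (f i) (f' i y) y := fun i y =>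
    ((differentiable_coord hF i _).hasFDerivAt).comp y e.symm.hasFDerivAt
  have hsum : ∀ y, ∑ i, f' i y (Pi.single i 1) = divergence F (e.symm y) := fun y => rfl
  have hint : Integrable (fun y => ∑ i, f' i y (Pi.single i 1)) :=
    hvol.integrable_comp_of_integrable hdiv
  -- This form of the divergence theorem on a box asks for differentiability and an integrable
  -- divergence, not for continuous partial derivatives.
  have key := integral_divergence_of_hasFDerivAt_off_countable' a b hab f f' ∅ Set.countable_empty
    (fun i => fun y _ => (hf i y).continuousAt.continuousWithinAt) (fun y _ i => hf i y)
    hint.integrableOn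
  have hb : ∀ i (y : Fin (n + 1) → ℝ), R ≤ |y i| → ∀ j, f j y = 0 := fun i y hy j => by
    simp only [f]
    rw [hFR _ (hy.trans (hnorm y i))]
    rfl
  have hzero : ∑ i : Fin (n + 1),
      ((∫ x in Set.Icc (a ∘ i.succAbove) (b ∘ i.succAbove), f i (i.insertNth (b i) x)) -
        ∫ x in Set.Icc (a ∘ i.succAbove) (b ∘ i.succAbove), f i (i.insertNth (a i) x)) = 0 := by
    refine Finset.sum_eq_zero fun i _ => ?_
    have h1 : ∀ x, f i (i.insertNth (b i) x) = 0 := fun x =>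
      hb i _ (by simp only [Fin.insertNth_apply_same, b]; rw [abs_of_pos] <;> linarith) i
    have h2 : ∀ x, f i (i.insertNth (a i) x) = 0 := fun x =>
      hb i _ (by simp only [Fin.insertNth_apply_same, a]; rw [abs_of_neg] <;> linarith) i
    simp [h1, h2]
  rw [← hvol.integral_comp hemb]
  simp_rw [← hsum]
  rw [← setIntegral_eq_integral_of_forall_compl_eq_zero (s := Set.Icc a b), key]
  · exact hzero
  · intro y hy
    rw [hsum]
    -- Outside the box the norm exceeds `R` strictly, so the field vanishes on a whole neighbourhood
    -- and its derivatives vanish too.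
    apply divergence_eq_zero_of_eventuallyEq
    have hlt : R < ‖e.symm y‖ := by
      by_contra! hle
      refine hy ⟨fun i => ?_, fun i => ?_⟩
      · have := (abs_le.1 ((hnorm y i).trans hle)).1
        simp only [a]; linarith
      · have := (abs_le.1 ((hnorm y i).trans hle)).2
        simp only [b]; linarith
    filter_upwards [continuous_norm.continuousAt.eventually_const_lt hlt] with z hz
    exact hFR z hz.le

theorem divergence_smul {φ : E d → ℝ} {F : E d → E d} (hφ : Differentiable ℝ φ)
    (hF : Differentiable ℝ F) (x : E d) :
    divergence (fun z => φ z • F z) x = φ x * divergence F x + fderiv ℝ φ x (F x) := by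
  have h : ∀ i : Fin d, fderiv ℝ (fun z => (φ z • F z) i) x (EuclideanSpace.single i 1) =
      φ x * fderiv ℝ (fun z => F z i) x (EuclideanSpace.single i 1) +
        F x i * fderiv ℝ φ x (EuclideanSpace.single i 1) := fun i => by
    have h1 : (fun z => (φ z • F z) i) = fun z => φ z * F z i := rfl
    rw [h1, fderiv_fun_mul (hφ x) (differentiable_coord hF i x)]
    simp
  simp only [divergence, h, Finset.sum_add_distrib, ← Finset.mul_sum]
  congr 1
  have hx : F x = ∑ i, F x i • EuclideanSpace.single i (1 : ℝ) := by
    ext j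
    simp [Finset.sum_apply, Pi.single_apply]
  conv_rhs => rw [hx, map_sum]
  simp

/-- An integrable differentiable vector field with integrable divergence has total divergence
zero. -/
theorem integral_divergence_eq_zero {F : E d → E d} (hF : Differentiable ℝ F)
    (hFi : Integrable F) (hdiv : Integrable (divergence F)) :
    ∫ x, divergence F x = 0 := by
  let φ : ContDiffBump (0 : E d) := ⟨1, 2, one_pos, one_lt_two⟩
  have hφ : ContDiff ℝ 1 φ := φ.contDiff
  have hφd : Differentiable ℝ φ := hφ.differentiable (by norm_num)
  obtain ⟨C, hC⟩ : ∃ C, ∀ x, ‖fderiv ℝ φ x‖ ≤ C :=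
    (hφ.continuous_fderiv (by norm_num)).bounded_above_of_compact_support
      (φ.hasCompactSupport.fderiv (𝕜 := ℝ))
  let c : ℕ → ℝ := fun n => ((n : ℝ) + 1)⁻¹
  have hc0 : ∀ n, 0 < c n := fun n => by positivity
  have hc : Tendsto c atTop (𝓝 0) :=
    tendsto_inv_atTop_zero.comp (tendsto_atTop_add_const_right _ _ tendsto_natCast_atTop_atTop)
  -- The cutoffs increase their scale like `n + 1`, so their gradients are `O(1 / (n + 1))`. Then `∫
  -- ψ div F = -∫ ∇ψ · F` tends to `0`, while the left side tends to `∫ div F`.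
  let ψ : ℕ → E d → ℝ := fun n x => φ (c n • x)
  have hψ' : ∀ n x, HasFDerivAt (ψ n) (c n • fderiv ℝ φ (c n • x)) x := fun n x => by
    have h1 : HasFDerivAt (fun x : E d => c n • x) (c n • ContinuousLinearMap.id ℝ (E d)) x :=
      (hasFDerivAt_id x).const_smul (c n)
    have h2 := (hφd (c n • x)).hasFDerivAt.comp x h1
    refine h2.congr_fderiv ?_
    ext v
    simp
  have hψd : ∀ n, Differentiable ℝ (ψ n) := fun n x => (hψ' n x).differentiableAt
  have hψ1 : ∀ n x, ‖ψ n x‖ ≤ 1 := fun n x => by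
    rw [Real.norm_eq_abs, abs_of_nonneg φ.nonneg]
    exact φ.le_one
  have hψm : ∀ n, AEStronglyMeasurable (ψ n) volume := fun n =>
    (hψd n).continuous.aestronglyMeasurable
  have hmul : ∀ n, Integrable fun x => ψ n x * divergence F x := fun n =>
    hdiv.bdd_mul (hψm n) (Eventually.of_forall (hψ1 n))
  have hbound : ∀ n x, ‖fderiv ℝ (ψ n) x (F x)‖ ≤ c n * C * ‖F x‖ := fun n x => by
    rw [(hψ' n x).fderiv]
    refine (ContinuousLinearMap.le_opNorm _ _).trans ?_
    gcongr
    rw [norm_smul, Real.norm_of_nonneg (hc0 n).le]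
    gcongr
    exact hC _
  have hgm : ∀ n, AEStronglyMeasurable (fun x => fderiv ℝ (ψ n) x (F x)) volume := fun n => by
    have : Continuous fun x => fderiv ℝ (ψ n) x (F x) := by
      simp_rw [(hψ' n _).fderiv]
      have := (hφ.continuous_fderiv (by norm_num)).comp (continuous_const_smul (c n))
      exact (this.const_smul (c n)).clm_apply hF.continuous
    exact this.aestronglyMeasurable
  have hgi : ∀ n, Integrable fun x => fderiv ℝ (ψ n) x (F x) := fun n =>
    (hFi.norm.const_mul (c n * C)).mono' (hgm n) (Eventually.of_forall (hbound n))
  have heq : ∀ n, ∫ x, ψ n x * divergence F x = -∫ x, fderiv ℝ (ψ n) x (F x) := fun n => by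
    have hd := divergence_smul (hψd n) hF
    have h0 := integral_divergence_eq_zero_of_vanish (F := fun z => ψ n z • F z)
      ((hψd n).smul hF) (R := 2 * ((n : ℝ) + 1)) (by positivity) (fun x hx => ?_)
      (((hmul n).add (hgi n)).congr (Eventually.of_forall fun x => (hd x).symm))
    · simp_rw [hd] at h0
      rw [integral_add (hmul n) (hgi n)] at h0
      linarith
    · have : ψ n x = 0 := by
        refine φ.zero_of_le_dist ?_
        rw [dist_zero_right, norm_smul, Real.norm_of_nonneg (hc0 n).le]
        calc (2 : ℝ) = c n * (2 * ((n : ℝ) + 1)) := by simp only [c]; field_simp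
          _ ≤ _ := by gcongr
      simp [this]
  have h1 : Tendsto (fun n => ∫ x, ψ n x * divergence F x) atTop (𝓝 (∫ x, divergence F x)) := by
    refine tendsto_integral_of_dominated_convergence (fun x => ‖divergence F x‖)
      (fun n => (hmul n).aestronglyMeasurable) hdiv.norm
      (fun n => Eventually.of_forall fun x => ?_) (Eventually.of_forall fun x => ?_)
    · rw [norm_mul]
      exact mul_le_of_le_one_left (norm_nonneg _) (hψ1 n x)
    · have h2 : Tendsto (fun n => ψ n x) atTop (𝓝 (φ ((0 : ℝ) • x))) :=
        (hφd.continuous.tendsto _).comp (hc.smul_const x)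
      rw [zero_smul, φ.one_of_mem_closedBall (by simp [φ])] at h2
      simpa using h2.mul_const (divergence F x)
  have h2 : Tendsto (fun n => ∫ x, ψ n x * divergence F x) atTop (𝓝 0) := by
    refine squeeze_zero_norm (a := fun n => c n * C * ∫ x, ‖F x‖) (fun n => ?_) ?_
    · rw [heq, norm_neg, ← integral_const_mul]
      exact norm_integral_le_of_norm_le (hFi.norm.const_mul _) (Eventually.of_forall (hbound n))
    · simpa using (hc.mul_const C).mul_const (∫ x, ‖F x‖)
  exact tendsto_nhds_unique h1 h2

/-- A partial derivative of an integrable function integrates to zero. -/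
theorem integral_fderiv_apply_eq_zero {f : E d → ℝ} (hf : Differentiable ℝ f)
    (hfi : Integrable f) (v : E d) (hd : Integrable fun x => fderiv ℝ f x v) :
    ∫ x, fderiv ℝ f x v = 0 := by
  have := integral_mul_fderiv_eq_neg_fderiv_mul_of_integrable (μ := volume) (𝕜 := ℝ) (f := f)
    (g := fun _ => (1 : ℝ)) (v := v)
    (by simpa using hd) (by simp) (by simpa using hfi) (fun x _ => hf x) (by simp)
  simpa using this

/-- A differentiable function whose derivative vanishes almost everywhere is constant. -/
theorem eq_of_ae_fderiv_eq_zero {u : E d → ℝ} (hu : Differentiable ℝ u)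
    (h : ∀ᵐ x, fderiv ℝ u x = 0) (x y : E d) : u x = u y := by
  have hstep : ∀ v x : E d, u (x + v) = u x := fun v => by
    have hmeas : MeasurableSet {p : ℝ × E d | fderiv ℝ u (p.2 + p.1 • v) = 0} := by
      have : Measurable fun p : ℝ × E d => fderiv ℝ u (p.2 + p.1 • v) :=
        (measurable_fderiv ℝ u).comp (by fun_prop)
      exact this (measurableSet_singleton 0)
    have h1 : ∀ᵐ t : ℝ, ∀ᵐ x : E d, fderiv ℝ u (x + t • v) = 0 := Eventually.of_forall fun t =>
      (measurePreserving_add_right volume (t • v)).quasiMeasurePreserving.ae h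
    -- By Fubini, almost every line in direction `v` meets the exceptional set in a null set of
    -- parameters.
    have h2 : ∀ᵐ x : E d, ∀ᵐ t : ℝ, fderiv ℝ u (x + t • v) = 0 :=
      (Measure.ae_ae_comm hmeas).1 h1
    have h3 : (fun x => u (x + v)) =ᵐ[volume] u := by
      filter_upwards [h2] with x hx
      have hder : ∀ t ∈ Set.uIcc (0 : ℝ) 1,
          HasDerivAt (fun t : ℝ => u (x + t • v)) (fderiv ℝ u (x + t • v) v) t := fun t _ => by
        have h4 : HasDerivAt (fun t : ℝ => x + t • v) v t := by
          simpa using ((hasDerivAt_id t).smul_const v).const_add x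
        exact (hu _).hasFDerivAt.comp_hasDerivAt t h4
      have hae : (fun t : ℝ => fderiv ℝ u (x + t • v) v) =ᵐ[volume] fun _ => 0 := by
        filter_upwards [hx] with t ht
        simp [ht]
      have hii : IntervalIntegrable (fun t : ℝ => fderiv ℝ u (x + t • v) v) volume 0 1 :=
        (intervalIntegrable_const (c := (0 : ℝ))).congr_ae (ae_restrict_of_ae hae.symm)
      -- The fundamental theorem applies since the derivative along the line exists everywhere and
      -- is integrable, being zero almost everywhere.
      have h5 := intervalIntegral.integral_eq_sub_of_hasDerivAt hder hii
      rw [intervalIntegral.integral_congr_ae (g := fun _ => 0) (hae.mono fun t ht _ => ht)] at h5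
      simp only [intervalIntegral.integral_zero, one_smul, zero_smul, add_zero] at h5
      linarith
    have h4 := Continuous.ae_eq_iff_eq (μ := volume)
      (hu.continuous.comp (continuous_id.add continuous_const)) hu.continuous |>.1 h3
    exact congrFun h4
  have := hstep (x - y) y
  rwa [add_sub_cancel] at this

end Divergence

/-! ### Second moments of degenerate U-statistics -/

section UStatistic

variable {𝓧 Ω : Type*} [MeasurableSpace 𝓧] [MeasurableSpace Ω] {μ : Measure 𝓧}
  {P : Measure Ω} {X : ℕ → Ω → 𝓧}

theorem hasLaw_prodMk [IsProbabilityMeasure P] (hX : ∀ i, HasLaw (X i) μ P)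
    (hind : iIndepFun X P) {i j : ℕ} (hij : i ≠ j) :
    HasLaw (fun ω => (X i ω, X j ω)) (μ.prod μ) P where
  aemeasurable := (hX i).aemeasurable.prodMk (hX j).aemeasurable
  map_eq := by
    rw [(hind.indepFun hij).map_prod_eq_prod_map_map (hX i).aemeasurable (hX j).aemeasurable,
      (hX i).map_eq, (hX j).map_eq]

theorem _root_.ProbabilityTheory.HasLaw.memLp_comp {α : Type*} [MeasurableSpace α]
    {ν : Measure α} {Y : Ω → α}
    (hY : HasLaw Y ν P) {f : α → ℝ} {p : ENNReal} (hf : MemLp f p ν) :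
    MemLp (fun ω => f (Y ω)) p P := by
  rw [← hY.map_eq] at hf
  exact hf.comp_of_map hY.aemeasurable

theorem _root_.ProbabilityTheory.HasLaw.integral_fun_comp {α : Type*} [MeasurableSpace α]
    {ν : Measure α} {Y : Ω → α}
    (hY : HasLaw Y ν P) {f : α → ℝ} (hf : AEStronglyMeasurable f ν) :
    ∫ ω, f (Y ω) ∂P = ∫ x, f x ∂ν := by
  have h := hY.map_eq
  subst h
  exact (integral_map hY.aemeasurable hf).symm

theorem _root_.ProbabilityTheory.HasLaw.ae_comp {α : Type*} [MeasurableSpace α]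
    {ν : Measure α} {Y : Ω → α}
    (hY : HasLaw Y ν P) {p : α → Prop} (hp : ∀ᵐ x ∂ν, p x) : ∀ᵐ ω ∂P, p (Y ω) := by
  rw [← hY.map_eq] at hp
  exact ae_of_ae_map hY.aemeasurable hp

variable [IsProbabilityMeasure μ] [IsProbabilityMeasure P]

/-- The index `l` differs from `i`, `j` and `k`, so `X l` is independent of the other three
variables jointly, and integrating over it first gives zero by degeneracy. The index `k` may
coincide with `i` or `j`. -/
theorem integral_degenerate_mul_aux (hX : ∀ i, HasLaw (X i) μ P) (hind : iIndepFun X P)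
    {r : 𝓧 × 𝓧 → ℝ} (hrm : StronglyMeasurable r) (hr : MemLp r 2 (μ.prod μ))
    (hdeg : ∀ᵐ x ∂μ, ∫ y, r (x, y) ∂μ = 0) {i j k l : ℕ} (hij : i ≠ j)
    (hil : i ≠ l) (hjl : j ≠ l) (hkl : k ≠ l) :
    ∫ ω, r (X i ω, X j ω) * r (X k ω, X l ω) ∂P = 0 := by
  have hXm : ∀ i, AEMeasurable (X i) P := fun i => (hX i).aemeasurable
  let W : Ω → 𝓧 × 𝓧 × 𝓧 := fun ω => (X i ω, X j ω, X k ω)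
  have hW : AEMeasurable W P := (hXm i).prodMk ((hXm j).prodMk (hXm k))
  have hdisj : Disjoint ({i, j, k} : Finset ℕ) {l} := by
    simp [hil.symm, hjl.symm, hkl.symm]
  have hindep : IndepFun W (X l) P := by
    have h0 := hind.indepFun_finset₀ {i, j, k} {l} hdisj hXm
    have hi : i ∈ ({i, j, k} : Finset ℕ) := by simp
    have hj : j ∈ ({i, j, k} : Finset ℕ) := by simp
    have hk : k ∈ ({i, j, k} : Finset ℕ) := by simp
    have hl : l ∈ ({l} : Finset ℕ) := by simp
    have hlm : Measurable fun f : ({l} : Finset ℕ) → 𝓧 => f ⟨l, hl⟩ :=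
      measurable_pi_apply (X := fun _ => 𝓧) (⟨l, hl⟩ : ({l} : Finset ℕ))
    exact h0.comp (φ := fun f => (f ⟨i, hi⟩, f ⟨j, hj⟩, f ⟨k, hk⟩)) (ψ := fun f => f ⟨l, hl⟩)
      (by fun_prop) hlm
  have hmap : P.map (fun ω => (W ω, X l ω)) = (P.map W).prod μ := by
    rw [hindep.map_prod_eq_prod_map_map hW (hXm l), (hX l).map_eq]
  have : IsProbabilityMeasure (P.map W) := Measure.isProbabilityMeasure_map hW
  let G : (𝓧 × 𝓧 × 𝓧) × 𝓧 → ℝ := fun z => r (z.1.1, z.1.2.1) * r (z.1.2.2, z.2)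
  have hG : StronglyMeasurable G :=
    (hrm.comp_measurable (by fun_prop)).mul (hrm.comp_measurable (by fun_prop))
  have hint : Integrable (fun ω => G (W ω, X l ω)) P :=
    ((hasLaw_prodMk hX hind hkl).memLp_comp hr).integrable_mul
      ((hasLaw_prodMk hX hind hij).memLp_comp hr) |>.congr
      (Eventually.of_forall fun ω => by simp [G, W, mul_comm])
  have hGint : Integrable G ((P.map W).prod μ) := by
    rw [← hmap, integrable_map_measure hG.aestronglyMeasurable (hW.prodMk (hXm l))]
    exact hint
  calc ∫ ω, r (X i ω, X j ω) * r (X k ω, X l ω) ∂P = ∫ ω, G (W ω, X l ω) ∂P := rfl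
    _ = ∫ z, G z ∂((P.map W).prod μ) := by
        rw [← hmap, integral_map (hW.prodMk (hXm l)) hG.aestronglyMeasurable]
    _ = ∫ w, ∫ y, G (w, y) ∂μ ∂(P.map W) := integral_prod _ hGint
    _ = ∫ w, 0 ∂(P.map W) := by
        refine integral_congr_ae ?_
        have h3 : ∀ᵐ w ∂(P.map W), ∫ y, r (w.2.2, y) ∂μ = 0 := by
          have hmeas : MeasurableSet {x | ∫ y, r (x, y) ∂μ = 0} :=
            hrm.integral_prod_right'.measurable (measurableSet_singleton 0)
          have hmeas' : MeasurableSet {w : 𝓧 × 𝓧 × 𝓧 | ∫ y, r (w.2.2, y) ∂μ = 0} :=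
            hmeas.preimage (f := fun w : 𝓧 × 𝓧 × 𝓧 => w.2.2) (by fun_prop)
          rw [ae_map_iff hW hmeas']
          exact (hX k).ae_comp hdeg
        filter_upwards [h3] with w hw
        simp only [G]
        rw [integral_const_mul, hw, mul_zero]
    _ = 0 := by simp

/-- Products of a degenerate kernel at index pairs that differ are uncorrelated. -/
theorem integral_degenerate_mul (hX : ∀ i, HasLaw (X i) μ P) (hind : iIndepFun X P)
    {r : 𝓧 → 𝓧 → ℝ} (hr : MemLp (fun z : 𝓧 × 𝓧 => r z.1 z.2) 2 (μ.prod μ))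
    (hdeg : ∀ᵐ x ∂μ, ∫ y, r x y ∂μ = 0) {i j k l : ℕ} (hij : i ≠ j)
    (hil : i ≠ l) (hjl : j ≠ l) (hkl : k ≠ l) :
    ∫ ω, r (X i ω) (X j ω) * r (X k ω) (X l ω) ∂P = 0 := by
  -- A strongly measurable representative may replace `r`, because a pair of sample points with
  -- distinct indices has law `μ.prod μ` and does not see null sets.
  obtain ⟨r', hr'm, hr'⟩ := hr.1
  have hdeg' : ∀ᵐ x ∂μ, ∫ y, r' (x, y) ∂μ = 0 := by
    filter_upwards [hdeg, Measure.ae_ae_of_ae_prod hr'] with x hx hx'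
    rw [← hx]
    exact integral_congr_ae (hx'.mono fun y hy => hy.symm)
  rw [← integral_degenerate_mul_aux hX hind hr'm (hr.ae_eq hr') hdeg' hij hil hjl hkl]
  refine integral_congr_ae ?_
  filter_upwards [(hasLaw_prodMk hX hind hij).ae_comp hr', (hasLaw_prodMk hX hind hkl).ae_comp hr']
    with ω h1 h2
  simp only [← h1, ← h2]

/-- The second moment of the sum over pairs of a degenerate symmetric kernel. -/
theorem integral_sq_degenerate_sum_le (hX : ∀ i, HasLaw (X i) μ P) (hind : iIndepFun X P)
    {r : 𝓧 → 𝓧 → ℝ} (hr : MemLp (fun z : 𝓧 × 𝓧 => r z.1 z.2) 2 (μ.prod μ))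
    (hsymm : ∀ x y, r x y = r y x) (hdeg : ∀ᵐ x ∂μ, ∫ y, r x y ∂μ = 0) (n : ℕ) :
    MemLp (fun ω => ∑ i ∈ Finset.range n, ∑ j ∈ (Finset.range n).erase i, r (X i ω) (X j ω)) 2 P ∧
    ∫ ω, (∑ i ∈ Finset.range n, ∑ j ∈ (Finset.range n).erase i, r (X i ω) (X j ω)) ^ 2 ∂P ≤
      2 * n ^ 2 * ∫ z : 𝓧 × 𝓧, r z.1 z.2 ^ 2 ∂(μ.prod μ) := by
  set B := ∫ z : 𝓧 × 𝓧, r z.1 z.2 ^ 2 ∂(μ.prod μ) with hB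
  have hB0 : 0 ≤ B := integral_nonneg fun z => sq_nonneg _
  let S : Finset (Σ _ : ℕ, ℕ) := (Finset.range n).sigma fun i => (Finset.range n).erase i
  let a : (Σ _ : ℕ, ℕ) → Ω → ℝ := fun p ω => r (X p.1 ω) (X p.2 ω)
  have hS : ∀ p ∈ S, p.1 ≠ p.2 := fun p hp => by
    simp only [S, Finset.mem_sigma, Finset.mem_erase] at hp
    exact hp.2.1.symm
  have hsum : ∀ ω, (∑ i ∈ Finset.range n, ∑ j ∈ (Finset.range n).erase i, r (X i ω) (X j ω)) =
      ∑ p ∈ S, a p ω := fun ω => Finset.sum_sigma' _ _ _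
  simp_rw [hsum]
  have ha : ∀ p ∈ S, MemLp (a p) 2 P := fun p hp =>
    (hasLaw_prodMk hX hind (hS p hp)).memLp_comp hr
  have hasq : ∀ p ∈ S, ∫ ω, a p ω ^ 2 ∂P = B := fun p hp =>
    (hasLaw_prodMk hX hind (hS p hp)).integral_fun_comp (f := fun z => r z.1 z.2 ^ 2)
      (hr.1.pow 2)
  have hprod : ∀ p ∈ S, ∀ p' ∈ S, Integrable (fun ω => a p ω * a p' ω) P := fun p hp p' hp' =>
    (ha p hp).integrable_mul (ha p' hp')
  have hle : ∀ p ∈ S, ∀ p' ∈ S, ∫ ω, a p ω * a p' ω ∂P ≤ B := fun p hp p' hp' => by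
    have h1 : ∫ ω, a p ω * a p' ω ∂P ≤ ∫ ω, (a p ω ^ 2 + a p' ω ^ 2) / 2 ∂P := by
      refine integral_mono (hprod p hp p' hp')
        (((ha p hp).integrable_sq.add (ha p' hp').integrable_sq).div_const 2) fun ω => ?_
      simp only
      nlinarith [sq_nonneg (a p ω - a p' ω)]
    rw [integral_div, integral_add (ha p hp).integrable_sq (ha p' hp').integrable_sq,
      hasq p hp, hasq p' hp'] at h1
    linarith
  have hzero : ∀ p ∈ S, ∀ p' ∈ S, p' ∉ ({p, ⟨p.2, p.1⟩} : Finset (Σ _ : ℕ, ℕ)) →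
      ∫ ω, a p ω * a p' ω ∂P = 0 := fun p hp p' hp' hne => by
    obtain ⟨i, j⟩ := p
    obtain ⟨k, l⟩ := p'
    have hij : i ≠ j := hS _ hp
    have hkl : k ≠ l := hS _ hp'
    simp only [Finset.mem_insert, Finset.mem_singleton, not_or, Sigma.mk.injEq, heq_eq_eq,
      not_and] at hne
    -- Two index pairs that differ as unordered pairs leave `k` or `l` outside `{i, j}`; in the
    -- second case the symmetry of `r` moves that index to the last slot.
    by_cases h1 : i ≠ l ∧ j ≠ l
    · exact integral_degenerate_mul hX hind hr hdeg hij h1.1 h1.2 hkl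
    · have h2 : i ≠ k ∧ j ≠ k := by
        refine ⟨fun h => ?_, fun h => ?_⟩
        · subst h
          exact h1 ⟨hkl, fun hjl => hne.1 rfl hjl.symm⟩
        · subst h
          exact h1 ⟨fun hil => hne.2 rfl hil.symm, hkl⟩
      simp only [a]
      simp_rw [hsymm (X k _) (X l _)]
      exact integral_degenerate_mul hX hind hr hdeg hij h2.1 h2.2 hkl.symm
  refine ⟨memLp_finsetSum _ ha, ?_⟩
  have hexp : ∀ ω, (∑ p ∈ S, a p ω) ^ 2 = ∑ p ∈ S, ∑ p' ∈ S, a p ω * a p' ω := fun ω => by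
    rw [sq, Finset.sum_mul_sum]
  simp_rw [hexp]
  rw [integral_finsetSum _ fun p hp => integrable_finsetSum _ fun p' hp' => hprod p hp p' hp']
  -- Only the pair itself and its reversal correlate with a given pair, and each contributes at most
  -- `B`.
  have hrow : ∀ p ∈ S, ∫ ω, ∑ p' ∈ S, a p ω * a p' ω ∂P ≤ 2 * B := fun p hp => by
    rw [integral_finsetSum _ fun p' hp' => hprod p hp p' hp']
    rw [← Finset.sum_filter_add_sum_filter_not S
      (· ∈ ({p, ⟨p.2, p.1⟩} : Finset (Σ _ : ℕ, ℕ)))]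
    rw [Finset.sum_eq_zero (s := S.filter fun x => ¬ _) fun p' hp' =>
      hzero p hp p' (Finset.mem_filter.1 hp').1 (Finset.mem_filter.1 hp').2, add_zero]
    refine (Finset.sum_le_card_nsmul _ _ B fun p' hp' =>
      hle p hp p' (Finset.mem_filter.1 hp').1).trans ?_
    rw [nsmul_eq_mul]
    gcongr
    have : (S.filter (· ∈ ({p, ⟨p.2, p.1⟩} : Finset (Σ _ : ℕ, ℕ)))).card ≤ 2 :=
      (Finset.card_le_card fun x hx => (Finset.mem_filter.1 hx).2).trans Finset.card_le_two
    exact_mod_cast this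
  refine (Finset.sum_le_card_nsmul _ _ _ hrow).trans ?_
  have hcard : S.card ≤ n ^ 2 := by
    simp only [S, Finset.card_sigma]
    refine (Finset.sum_le_card_nsmul _ _ n fun i _ => ?_).trans (by simp [sq])
    exact (Finset.card_le_card (Finset.erase_subset _ _)).trans (by simp)
  rw [nsmul_eq_mul]
  have : (S.card : ℝ) ≤ (n : ℝ) ^ 2 := by exact_mod_cast hcard
  nlinarith

end UStatistic

/-! ### The non-degenerate central limit theorem -/

section UStatisticCLT

variable {𝓧 Ω : Type*} [MeasurableSpace 𝓧] [MeasurableSpace Ω] {μ : Measure 𝓧}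
  {P : Measure Ω} {X : ℕ → Ω → 𝓧}

theorem sq_integral_le [IsProbabilityMeasure μ] {f : 𝓧 → ℝ} (hf : MemLp f 2 μ) :
    (∫ x, f x ∂μ) ^ 2 ≤ ∫ x, f x ^ 2 ∂μ := by
  have h := variance_nonneg f μ
  rw [variance_eq_sub hf] at h
  simpa using h

theorem ae_memLp_section [SFinite μ] {h : 𝓧 → 𝓧 → ℝ}
    (hh : MemLp (fun z : 𝓧 × 𝓧 => h z.1 z.2) 2 (μ.prod μ)) : ∀ᵐ x ∂μ, MemLp (h x) 2 μ := by
  filter_upwards [hh.1.prodMk_left, hh.integrable_sq.prod_right_ae] with x h1 h2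
  exact (memLp_two_iff_integrable_sq h1).2 h2

theorem memLp_integral_section [IsProbabilityMeasure μ] {h : 𝓧 → 𝓧 → ℝ}
    (hh : MemLp (fun z : 𝓧 × 𝓧 => h z.1 z.2) 2 (μ.prod μ)) :
    MemLp (fun x => ∫ y, h x y ∂μ) 2 μ := by
  rw [memLp_two_iff_integrable_sq hh.1.integral_prod_right']
  refine hh.integrable_sq.integral_prod_left.mono' (hh.1.integral_prod_right'.pow 2) ?_
  filter_upwards [ae_memLp_section hh] with x hx
  rw [Real.norm_of_nonneg (sq_nonneg _)]
  exact sq_integral_le hx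

theorem tendstoInMeasure_zero_of_integral_sq_le {D : ℕ → Ω → ℝ} {b : ℕ → ℝ}
    (hDm : ∀ n, AEStronglyMeasurable (D n) P)
    (hD : ∀ᶠ n in atTop, MemLp (D n) 2 P ∧ ∫ ω, D n ω ^ 2 ∂P ≤ b n)
    (hb : Tendsto b atTop (𝓝 0)) : TendstoInMeasure P D atTop 0 := by
  refine tendstoInMeasure_of_tendsto_eLpNorm (p := 2) two_ne_zero hDm
    aestronglyMeasurable_const ?_
  have h0 : Tendsto (fun n => ENNReal.ofReal (b n ^ (2 : ℝ)⁻¹)) atTop (𝓝 0) := by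
    have := ENNReal.tendsto_ofReal (hb.rpow_const (p := (2 : ℝ)⁻¹) (Or.inr (by norm_num)))
    simpa using this
  refine tendsto_of_tendsto_of_tendsto_of_le_of_le' tendsto_const_nhds h0
    (Eventually.of_forall fun n => zero_le) ?_
  filter_upwards [hD] with n hn
  rw [sub_zero, hn.1.eLpNorm_eq_integral_rpow_norm two_ne_zero (by simp)]
  refine ENNReal.ofReal_le_ofReal ?_
  simp only [ENNReal.toReal_ofNat, Real.rpow_two, Real.norm_eq_abs, sq_abs]
  exact Real.rpow_le_rpow (integral_nonneg fun ω => sq_nonneg _) hn.2 (by norm_num)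

variable [IsProbabilityMeasure P]

/-- The limit may be any variable with the right Gaussian law, on its own probability space; this
allows linear combinations of the prescribed Gaussians `Z` as limits later on. -/
theorem tendstoInDistribution_sum_comp {Ω' : Type*} [MeasurableSpace Ω'] {P' : Measure Ω'}
    [IsProbabilityMeasure P'] {Y : Ω' → ℝ}
    (hX : ∀ i, HasLaw (X i) μ P) (hind : iIndepFun X P) {g : 𝓧 → ℝ} (hg : MemLp g 2 μ)
    (hY : HasLaw Y (gaussianReal 0 Var[g; μ].toNNReal) P') :
    TendstoInDistribution
      (fun (n : ℕ) ω => (√(n : ℝ))⁻¹ * (∑ k ∈ Finset.range n, g (X k ω) - n * ∫ x, g x ∂μ))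
      atTop Y (fun _ => P) P' := by
  have hgm : ∀ i, AEMeasurable g (P.map (X i)) := fun i => by
    rw [(hX i).map_eq]; exact hg.1.aemeasurable
  have hid : ∀ i, IdentDistrib (g ∘ X i) (g ∘ X 0) P P := fun i =>
    ((hX i).identDistrib (hX 0)).comp_of_aemeasurable (hgm i)
  have hmean : ∫ ω, g (X 0 ω) ∂P = ∫ x, g x ∂μ := (hX 0).integral_fun_comp hg.1
  have hvar : Var[g ∘ X 0; P] = Var[g; μ] := by
    rw [← (hX 0).map_eq, variance_map (hgm 0) (hX 0).aemeasurable]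
  have := tendstoInDistribution_inv_sqrt_mul_sum_sub (X := fun i => g ∘ X i) (Y := Y) (P := P)
    (P' := P') (by rw [hvar]; exact hY) ((hX 0).memLp_comp hg)
    (hind.comp₀ (fun _ => g) (fun i => (hX i).aemeasurable) hgm) hid
  simpa only [Function.comp_apply, hmean] using this

variable [IsProbabilityMeasure μ]

/-- The Hoeffding central limit theorem for U-statistics of order two. -/
theorem tendstoInDistribution_uStatistic (hX : ∀ i, HasLaw (X i) μ P) (hind : iIndepFun X P)
    {h : 𝓧 → 𝓧 → ℝ} (hh : MemLp (fun z : 𝓧 × 𝓧 => h z.1 z.2) 2 (μ.prod μ))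
    (hsymm : ∀ x y, h x y = h y x) :
    TendstoInDistribution
      (fun (n : ℕ) ω => √(n : ℝ) * ((((n : ℝ) - 1) * n)⁻¹ *
        (∑ i ∈ Finset.range n, ∑ j ∈ (Finset.range n).erase i, h (X i ω) (X j ω)) -
          ∫ z : 𝓧 × 𝓧, h z.1 z.2 ∂(μ.prod μ)))
      atTop (id : ℝ → ℝ) (fun _ => P)
      (gaussianReal 0 (4 * Var[fun x => ∫ y, h x y ∂μ; μ]).toNNReal) := by
  set g : 𝓧 → ℝ := fun x => ∫ y, h x y ∂μ with hgdef
  set θ := ∫ z : 𝓧 × 𝓧, h z.1 z.2 ∂(μ.prod μ) with hθ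
  have hg : MemLp g 2 μ := memLp_integral_section hh
  have hhi : Integrable (fun z : 𝓧 × 𝓧 => h z.1 z.2) (μ.prod μ) := hh.integrable (by norm_num)
  have hgθ : ∫ x, g x ∂μ = θ := (integral_prod _ hhi).symm
  -- The Hoeffding remainder: subtracting both one-variable projections and restoring the mean
  -- leaves a degenerate kernel.
  let r : 𝓧 → 𝓧 → ℝ := fun x y => h x y - g x - g y + θ
  have hr : MemLp (fun z : 𝓧 × 𝓧 => r z.1 z.2) 2 (μ.prod μ) :=
    ((hh.sub (hg.comp_measurePreserving measurePreserving_fst)).sub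
      (hg.comp_measurePreserving measurePreserving_snd)).add (memLp_const θ)
  have hrsymm : ∀ x y, r x y = r y x := fun x y => by simp only [r, hsymm x y]; ring
  have hgi : Integrable g μ := hg.integrable (by norm_num)
  have hrdeg : ∀ᵐ x ∂μ, ∫ y, r x y ∂μ = 0 := by
    filter_upwards [ae_memLp_section hh] with x hx
    have hxi : Integrable (h x) μ := hx.integrable (by norm_num)
    simp only [r]
    have i1 : Integrable (fun y => h x y - g x) μ := hxi.sub (integrable_const _)
    have i2 : Integrable (fun y => h x y - g x - g y) μ := i1.sub hgi
    rw [integral_add i2 (integrable_const _), integral_sub i1 hgi,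
      integral_sub hxi (integrable_const _), hgθ]
    simp [g]
  -- Each sample point occurs in both slots of the kernel, so the linear part is `2 g` and its
  -- variance is `4 Var g`.
  have hclt := tendstoInDistribution_sum_comp hX hind (hg.const_mul 2) (Y := id)
    (P' := gaussianReal 0 Var[fun x => 2 * g x; μ].toNNReal) HasLaw.id
  have hv : Var[fun x => 2 * g x; μ] = 4 * Var[g; μ] := by
    rw [variance_const_mul]; norm_num
  rw [hv, integral_const_mul, hgθ] at hclt
  have hSm : ∀ n : ℕ, AEStronglyMeasurable (fun ω => ∑ i ∈ Finset.range n,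
      ∑ j ∈ (Finset.range n).erase i, h (X i ω) (X j ω)) P := fun n =>
    Finset.aestronglyMeasurable_fun_sum _ fun i _ => Finset.aestronglyMeasurable_fun_sum _
      fun j hj => ((hasLaw_prodMk hX hind (Finset.ne_of_mem_erase hj).symm).memLp_comp hh).1
  have hYm : ∀ n : ℕ, AEMeasurable (fun ω => √(n : ℝ) * ((((n : ℝ) - 1) * n)⁻¹ *
        (∑ i ∈ Finset.range n, ∑ j ∈ (Finset.range n).erase i, h (X i ω) (X j ω)) - θ)) P :=
    fun n => (((hSm n).aemeasurable.const_mul _).sub_const _).const_mul _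
  refine tendstoInDistribution_of_tendstoInMeasure_sub _ _ hclt ?_ hYm
  have hid : ∀ n : ℕ, 2 ≤ n → ∀ ω, √(n : ℝ) * ((((n : ℝ) - 1) * n)⁻¹ *
        (∑ i ∈ Finset.range n, ∑ j ∈ (Finset.range n).erase i, h (X i ω) (X j ω)) - θ) -
      (√(n : ℝ))⁻¹ * (∑ k ∈ Finset.range n, 2 * g (X k ω) - n * (2 * θ)) =
      √(n : ℝ) * (((n : ℝ) - 1) * n)⁻¹ *
        ∑ i ∈ Finset.range n, ∑ j ∈ (Finset.range n).erase i, r (X i ω) (X j ω) := by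
    intro n hn ω
    have hn1 : (0 : ℝ) < (n : ℝ) - 1 := by
      have : (2 : ℝ) ≤ n := by exact_mod_cast hn
      linarith
    have hn0 : (0 : ℝ) < n := by linarith
    have hsum : ∑ i ∈ Finset.range n, ∑ j ∈ (Finset.range n).erase i, r (X i ω) (X j ω) =
        (∑ i ∈ Finset.range n, ∑ j ∈ (Finset.range n).erase i, h (X i ω) (X j ω)) -
          2 * ((n : ℝ) - 1) * (∑ k ∈ Finset.range n, g (X k ω)) + n * ((n : ℝ) - 1) * θ := by
      have hcard : ∀ i ∈ Finset.range n, (((Finset.range n).erase i).card : ℝ) = (n : ℝ) - 1 :=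
        fun i hi => by
          rw [Finset.card_erase_of_mem hi, Finset.card_range, Nat.cast_sub (by omega)]
          simp
      have hrow : ∀ i ∈ Finset.range n, ∑ j ∈ (Finset.range n).erase i, r (X i ω) (X j ω) =
          (∑ j ∈ (Finset.range n).erase i, h (X i ω) (X j ω)) - ((n : ℝ) - 1) * g (X i ω) -
            ((∑ k ∈ Finset.range n, g (X k ω)) - g (X i ω)) + ((n : ℝ) - 1) * θ := fun i hi => by
        simp only [r, Finset.sum_add_distrib, Finset.sum_sub_distrib, Finset.sum_const,
          nsmul_eq_mul, hcard i hi]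
        rw [Finset.sum_erase_eq_sub (f := fun j => g (X j ω)) hi]
      rw [Finset.sum_congr rfl hrow]
      simp only [Finset.sum_add_distrib, Finset.sum_sub_distrib, Finset.sum_const,
          nsmul_eq_mul, Finset.card_range, ← Finset.mul_sum]
      ring
    rw [hsum, ← Finset.mul_sum]
    have hs : (√(n : ℝ))⁻¹ = √(n : ℝ) * (n : ℝ)⁻¹ := by
      have h1 := Real.mul_self_sqrt hn0.le
      have h2 : √(n : ℝ) ≠ 0 := (Real.sqrt_pos.2 hn0).ne'
      field_simp
      linarith
    rw [hs]
    field_simp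
    ring
  set B := ∫ z : 𝓧 × 𝓧, r z.1 z.2 ^ 2 ∂(μ.prod μ) with hB
  have hB0 : 0 ≤ B := integral_nonneg fun z => sq_nonneg _
  -- The normalized remainder has second moment at most `2 B n / (n - 1)²`, and `n - 1 ≥ n / 2` for
  -- `n ≥ 2` turns this into `8 B / n`.
  refine tendstoInMeasure_zero_of_integral_sq_le (b := fun n => 8 * B * (n : ℝ)⁻¹) (fun n => ?_) ?_
    (by simpa using (tendsto_inv_atTop_zero.comp tendsto_natCast_atTop_atTop).const_mul (8 * B))
  · exact ((hYm n).sub (hclt.forall_aemeasurable n)).aestronglyMeasurable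
  · filter_upwards [eventually_ge_atTop 2] with n hn
    have hfun : ((fun ω => √(n : ℝ) * ((((n : ℝ) - 1) * n)⁻¹ *
        (∑ i ∈ Finset.range n, ∑ j ∈ (Finset.range n).erase i, h (X i ω) (X j ω)) - θ)) -
      fun ω => (√(n : ℝ))⁻¹ * (∑ k ∈ Finset.range n, 2 * g (X k ω) - n * (2 * θ))) = fun ω =>
      √(n : ℝ) * (((n : ℝ) - 1) * n)⁻¹ *
        ∑ i ∈ Finset.range n, ∑ j ∈ (Finset.range n).erase i, r (X i ω) (X j ω) :=
      funext fun ω => hid n hn ω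
    rw [Pi.sub_apply, hfun]
    obtain ⟨hmem, hle⟩ := integral_sq_degenerate_sum_le hX hind hr hrsymm hrdeg n
    refine ⟨hmem.const_mul _, ?_⟩
    simp_rw [mul_pow _ (∑ i ∈ Finset.range n, _)]
    rw [integral_const_mul]
    have hn2 : (2 : ℝ) ≤ n := by exact_mod_cast hn
    have hn1 : (0 : ℝ) < (n : ℝ) - 1 := by linarith
    have hn0 : (0 : ℝ) < n := by linarith
    calc (√(n : ℝ) * (((n : ℝ) - 1) * n)⁻¹) ^ 2 * _
        ≤ (√(n : ℝ) * (((n : ℝ) - 1) * n)⁻¹) ^ 2 * (2 * n ^ 2 * B) := by gcongr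
      _ = 2 * B * n * (((n : ℝ) - 1) ^ 2)⁻¹ := by
          rw [mul_pow, Real.sq_sqrt hn0.le]
          field_simp
      _ ≤ 2 * B * n * (4 * ((n : ℝ) ^ 2)⁻¹) := by
          gcongr
          rw [inv_le_iff_one_le_mul₀ (by positivity)]
          field_simp
          nlinarith
      _ = 8 * B * (n : ℝ)⁻¹ := by
          field_simp
          ring

end UStatisticCLT

/-! ### Integral operators of square integrable kernels -/

section HilbertSchmidt

variable {𝓧 : Type*} [MeasurableSpace 𝓧] {μ : Measure 𝓧}

theorem Lp_inner_eq (F G : Lp ℝ 2 μ) : ⟪F, G⟫_ℝ = ∫ x, F x * G x ∂μ := by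
  rw [L2.inner_def]
  exact integral_congr_ae (Eventually.of_forall fun x => by simp [mul_comm])

theorem Lp_inner_toLp {f g : 𝓧 → ℝ} (hf : MemLp f 2 μ) (hg : MemLp g 2 μ) :
    ⟪hf.toLp f, hg.toLp g⟫_ℝ = ∫ x, f x * g x ∂μ := by
  rw [Lp_inner_eq]
  refine integral_congr_ae ?_
  filter_upwards [hf.coeFn_toLp, hg.coeFn_toLp] with x h1 h2
  rw [h1, h2]

theorem Lp_norm_sq_toLp {f : 𝓧 → ℝ} (hf : MemLp f 2 μ) : ‖hf.toLp f‖ ^ 2 = ∫ x, f x ^ 2 ∂μ := by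
  rw [← real_inner_self_eq_norm_sq, Lp_inner_toLp]
  simp_rw [sq]

theorem Lp_norm_sq (F : Lp ℝ 2 μ) : ‖F‖ ^ 2 = ∫ x, F x ^ 2 ∂μ := by
  rw [← real_inner_self_eq_norm_sq, Lp_inner_eq]
  simp_rw [sq]

theorem sq_integral_mul_le {f g : 𝓧 → ℝ} (hf : MemLp f 2 μ) (hg : MemLp g 2 μ) :
    (∫ x, f x * g x ∂μ) ^ 2 ≤ (∫ x, f x ^ 2 ∂μ) * ∫ x, g x ^ 2 ∂μ := by
  rw [← Lp_inner_toLp hf hg, ← Lp_norm_sq_toLp hf, ← Lp_norm_sq_toLp hg, ← mul_pow]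
  exact sq_le_sq' (by linarith [(abs_le.1 (abs_real_inner_le_norm (hf.toLp f) (hg.toLp g))).1])
    (real_inner_le_norm _ _)

theorem memLp_tensor [SFinite μ] {f g : 𝓧 → ℝ} (hf : MemLp f 2 μ) (hg : MemLp g 2 μ) :
    MemLp (fun z : 𝓧 × 𝓧 => f z.1 * g z.2) 2 (μ.prod μ) := by
  have hm : AEStronglyMeasurable (fun z : 𝓧 × 𝓧 => f z.1 * g z.2) (μ.prod μ) :=
    hf.1.comp_fst.mul hg.1.comp_snd
  rw [memLp_two_iff_integrable_sq hm]
  simp_rw [mul_pow]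
  exact hf.integrable_sq.mul_prod hg.integrable_sq

theorem integral_sq_kernel_apply_le {h : 𝓧 → 𝓧 → ℝ} {f : 𝓧 → ℝ} (hf : MemLp f 2 μ) {x : 𝓧}
    (hx : MemLp (h x) 2 μ) :
    (∫ y, h x y * f y ∂μ) ^ 2 ≤ (∫ y, h x y ^ 2 ∂μ) * ∫ y, f y ^ 2 ∂μ :=
  sq_integral_mul_le hx hf

theorem memLp_kernel_apply [SFinite μ] {h : 𝓧 → 𝓧 → ℝ}
    (hh : MemLp (fun z : 𝓧 × 𝓧 => h z.1 z.2) 2 (μ.prod μ)) {f : 𝓧 → ℝ} (hf : MemLp f 2 μ) :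
    MemLp (fun x => ∫ y, h x y * f y ∂μ) 2 μ := by
  have hm : AEStronglyMeasurable (fun x => ∫ y, h x y * f y ∂μ) μ :=
    (hh.1.mul hf.1.comp_snd).integral_prod_right' (μ := μ)
  rw [memLp_two_iff_integrable_sq hm]
  refine (hh.integrable_sq.integral_prod_left.mul_const (∫ y, f y ^ 2 ∂μ)).mono' (hm.pow 2) ?_
  filter_upwards [ae_memLp_section hh] with x hx
  rw [Real.norm_of_nonneg (sq_nonneg _)]
  exact integral_sq_kernel_apply_le hf hx

theorem norm_sum_smul_le {H ι : Type*} [NormedAddCommGroup H] [NormedSpace ℝ H] (s : Finset ι)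
    (a : ι → ℝ) (v : ι → H) :
    ‖∑ i ∈ s, a i • v i‖ ≤ √(∑ i ∈ s, |a i| ^ 2) * √(∑ i ∈ s, ‖v i‖ ^ 2) := by
  refine (norm_sum_le _ _).trans ?_
  simp_rw [norm_smul, Real.norm_eq_abs]
  exact Real.sum_mul_le_sqrt_mul_sqrt _ _ _

/-- A Hilbert–Schmidt operator is compact. -/
theorem isCompactOperator_of_summable_norm_sq {H : Type*} [NormedAddCommGroup H]
    [InnerProductSpace ℝ H] [CompleteSpace H] {w : Type*} (b : HilbertBasis w ℝ H) (T : H →L[ℝ] H)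
    (hsum : Summable fun i => ‖T (b i)‖ ^ 2) : IsCompactOperator T := by
  classical
  -- Finite-rank truncations along the basis converge in operator norm: Cauchy–Schwarz and Bessel
  -- bound the error by the tail of `∑ ‖T (b i)‖ ^ 2`.
  let F : Finset w → H →L[ℝ] H := fun s =>
    ∑ i ∈ s, (innerSL ℝ (b i)).smulRight (T (b i))
  have hFapp : ∀ s f, F s f = ∑ i ∈ s, ⟪b i, f⟫_ℝ • T (b i) := fun s f => by
    simp [F]
  have hFc : ∀ s, IsCompactOperator (F s) := fun s => by
    refine Finset.sum_induction _ (fun G : H →L[ℝ] H => IsCompactOperator G)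
      (fun G G' hG hG' => hG.add hG') isCompactOperator_zero fun i _ => ?_
    have h1 : IsCompactOperator (innerSL ℝ (b i)) :=
      isCompactOperator_of_locallyCompactSpace_dom (innerSL ℝ (b i))
    exact h1.clm_comp ((ContinuousLinearMap.id ℝ ℝ).smulRight (T (b i)))
  refine isCompactOperator_of_tendsto (F := F) (f := T) (l := atTop) ?_
    (Eventually.of_forall hFc)
  rw [Metric.tendsto_nhds]
  intro ε hε
  obtain ⟨s, hs⟩ := summable_iff_vanishing_norm.1 hsum ((ε / 2) ^ 2) (by positivity)
  filter_upwards [eventually_ge_atTop s] with u hu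
  rw [dist_eq_norm]
  refine lt_of_le_of_lt ?_ (half_lt_self hε)
  refine ContinuousLinearMap.opNorm_le_bound _ (by positivity) fun f => ?_
  have hT : HasSum (fun i => ⟪b i, f⟫_ℝ • T (b i)) (T f) := by
    have := (b.hasSum_repr f).mapL T
    simpa [b.repr_apply_apply] using this
  change ‖F u f - T f‖ ≤ _
  refine le_of_tendsto (tendsto_const_nhds.sub hT).norm ?_
  filter_upwards [eventually_ge_atTop u] with t ht
  rw [hFapp, ← norm_neg, neg_sub, ← Finset.sum_sdiff ht, add_sub_cancel_right]
  have h1 : ∑ i ∈ t \ u, ‖T (b i)‖ ^ 2 ≤ (ε / 2) ^ 2 := by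
    refine (le_abs_self _).trans (hs (t \ u) ?_).le
    exact Finset.disjoint_of_subset_right hu Finset.sdiff_disjoint
  have h2 : ∑ i ∈ t \ u, |⟪b i, f⟫_ℝ| ^ 2 ≤ ‖f‖ ^ 2 := b.orthonormal.sum_inner_products_le f
  calc _ ≤ √(∑ i ∈ t \ u, |⟪b i, f⟫_ℝ| ^ 2) * √(∑ i ∈ t \ u, ‖T (b i)‖ ^ 2) :=
        norm_sum_smul_le _ _ _
    _ ≤ √(‖f‖ ^ 2) * √((ε / 2) ^ 2) := by gcongr
    _ = ε / 2 * ‖f‖ := by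
        rw [Real.sqrt_sq (norm_nonneg _), Real.sqrt_sq (by positivity), mul_comm]

/-- The integral operator on `L²(μ)` of a square integrable kernel. -/
noncomputable def kernelOp [SFinite μ] {h : 𝓧 → 𝓧 → ℝ}
    (hh : MemLp (fun z : 𝓧 × 𝓧 => h z.1 z.2) 2 (μ.prod μ)) : Lp ℝ 2 μ →L[ℝ] Lp ℝ 2 μ :=
  LinearMap.mkContinuous
    { toFun := fun f => (memLp_kernel_apply hh (Lp.memLp f)).toLp _
      map_add' := fun f g => by
        rw [← MemLp.toLp_add]
        refine MemLp.toLp_congr _ _ ?_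
        filter_upwards [ae_memLp_section hh] with x hx
        have i1 : Integrable (fun y => h x y * f y) μ := hx.integrable_mul (Lp.memLp f)
        have i2 : Integrable (fun y => h x y * g y) μ := hx.integrable_mul (Lp.memLp g)
        rw [Pi.add_apply, ← integral_add i1 i2]
        refine integral_congr_ae ?_
        filter_upwards [Lp.coeFn_add f g] with y hy
        rw [hy, Pi.add_apply, mul_add]
      map_smul' := fun c f => by
        rw [RingHom.id_apply, ← MemLp.toLp_const_smul]
        refine MemLp.toLp_congr _ _ ?_
        refine Eventually.of_forall fun x => ?_
        rw [Pi.smul_apply, smul_eq_mul, ← integral_const_mul]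
        refine integral_congr_ae ?_
        filter_upwards [Lp.coeFn_smul c f] with y hy
        rw [hy, Pi.smul_apply, smul_eq_mul]
        ring }
    (√(∫ z : 𝓧 × 𝓧, h z.1 z.2 ^ 2 ∂(μ.prod μ))) (fun f => by
      have h0 : 0 ≤ ∫ z : 𝓧 × 𝓧, h z.1 z.2 ^ 2 ∂(μ.prod μ) := integral_nonneg fun z => sq_nonneg _
      refine le_of_sq_le_sq ?_ (by positivity)
      rw [mul_pow, Real.sq_sqrt h0]
      change ‖(memLp_kernel_apply hh (Lp.memLp f)).toLp _‖ ^ 2 ≤ _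
      rw [Lp_norm_sq_toLp, Lp_norm_sq, integral_prod _ hh.integrable_sq, ← integral_mul_const]
      refine integral_mono_ae (memLp_kernel_apply hh (Lp.memLp f)).integrable_sq
        (hh.integrable_sq.integral_prod_left.mul_const _) ?_
      filter_upwards [ae_memLp_section hh] with x hx
      exact integral_sq_kernel_apply_le (Lp.memLp f) hx)

variable [SFinite μ] {h : 𝓧 → 𝓧 → ℝ}

theorem kernelOp_coeFn (hh : MemLp (fun z : 𝓧 × 𝓧 => h z.1 z.2) 2 (μ.prod μ)) (f : Lp ℝ 2 μ) :
    kernelOp hh f =ᵐ[μ] fun x => ∫ y, h x y * f y ∂μ :=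
  (memLp_kernel_apply hh (Lp.memLp f)).coeFn_toLp

/-- The tensor product of two elements of `L²(μ)`. -/
noncomputable def tensorLp (f g : Lp ℝ 2 μ) : Lp ℝ 2 (μ.prod μ) :=
  (memLp_tensor (Lp.memLp f) (Lp.memLp g)).toLp _

/-- Fubini identifies the pairing of a kernel with a tensor product as a matrix coefficient of its
operator; facts about kernels and facts about operators are exchanged through this identity. -/
theorem inner_toLp_tensorLp (hh : MemLp (fun z : 𝓧 × 𝓧 => h z.1 z.2) 2 (μ.prod μ))
    (f g : Lp ℝ 2 μ) : ⟪hh.toLp _, tensorLp f g⟫_ℝ = ⟪f, kernelOp hh g⟫_ℝ := by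
  have hi : Integrable (fun z : 𝓧 × 𝓧 => h z.1 z.2 * (f z.1 * g z.2)) (μ.prod μ) :=
    hh.integrable_mul (memLp_tensor (Lp.memLp f) (Lp.memLp g))
  rw [tensorLp, Lp_inner_toLp, Lp_inner_eq, integral_prod _ hi]
  refine integral_congr_ae ?_
  filter_upwards [kernelOp_coeFn hh g] with x hx
  rw [hx, ← integral_const_mul]
  exact integral_congr_ae (Eventually.of_forall fun y => by simp only; ring)

theorem inner_tensorLp_tensorLp (f g f' g' : Lp ℝ 2 μ) :
    ⟪tensorLp f g, tensorLp f' g'⟫_ℝ = ⟪f, f'⟫_ℝ * ⟪g, g'⟫_ℝ := by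
  rw [tensorLp, tensorLp, Lp_inner_toLp, Lp_inner_eq, Lp_inner_eq, ← integral_prod_mul]
  exact integral_congr_ae (Eventually.of_forall fun y => by simp only; ring)

theorem kernelOp_isSymmetric (hh : MemLp (fun z : 𝓧 × 𝓧 => h z.1 z.2) 2 (μ.prod μ))
    (hsymm : ∀ x y, h x y = h y x) : (kernelOp hh : Lp ℝ 2 μ →ₗ[ℝ] Lp ℝ 2 μ).IsSymmetric := by
  intro f g
  change ⟪kernelOp hh f, g⟫_ℝ = ⟪f, kernelOp hh g⟫_ℝ
  rw [real_inner_comm, ← inner_toLp_tensorLp, ← inner_toLp_tensorLp, tensorLp, tensorLp,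
    Lp_inner_toLp, Lp_inner_toLp, ← integral_prod_swap]
  refine integral_congr_ae (Eventually.of_forall fun z => ?_)
  simp only [Prod.fst_swap, Prod.snd_swap]
  rw [hsymm z.2 z.1]
  ring

/-- The Hilbert–Schmidt bound. -/
theorem sum_norm_sq_kernelOp_le (hh : MemLp (fun z : 𝓧 × 𝓧 => h z.1 z.2) 2 (μ.prod μ))
    {ι : Type*} {e : ι → Lp ℝ 2 μ} (he : Orthonormal ℝ e) (s : Finset ι) :
    ∑ i ∈ s, ‖kernelOp hh (e i)‖ ^ 2 ≤ ∫ z : 𝓧 × 𝓧, h z.1 z.2 ^ 2 ∂(μ.prod μ) := by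
  have h1 : ∀ i, ‖kernelOp hh (e i)‖ ^ 2 = ∫ x, (∫ y, h x y * e i y ∂μ) ^ 2 ∂μ := fun i =>
    Lp_norm_sq_toLp (memLp_kernel_apply hh (Lp.memLp (e i)))
  simp_rw [h1]
  rw [← integral_finsetSum _ fun i _ => (memLp_kernel_apply hh (Lp.memLp (e i))).integrable_sq,
    integral_prod _ hh.integrable_sq]
  refine integral_mono_ae (integrable_finsetSum _ fun i _ =>
    (memLp_kernel_apply hh (Lp.memLp (e i))).integrable_sq) hh.integrable_sq.integral_prod_left ?_
  filter_upwards [ae_memLp_section hh] with x hx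
  -- For almost every `x` the values at `x` are the coefficients of the section `h x` in the
  -- orthonormal family, so Bessel's inequality holds pointwise and is then integrated.
  have h2 := he.sum_inner_products_le (hx.toLp _) (s := s)
  rw [Lp_norm_sq_toLp] at h2
  refine le_of_eq_of_le (Finset.sum_congr rfl fun i _ => ?_) h2
  rw [Real.norm_eq_abs, sq_abs, Lp_inner_eq]
  congr 1
  refine integral_congr_ae ?_
  filter_upwards [hx.coeFn_toLp] with y hy
  rw [hy, mul_comm]

theorem kernelOp_isCompactOperator (hh : MemLp (fun z : 𝓧 × 𝓧 => h z.1 z.2) 2 (μ.prod μ)) :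
    IsCompactOperator (kernelOp hh) := by
  obtain ⟨w, b, -⟩ := exists_hilbertBasis ℝ (Lp ℝ 2 μ)
  exact isCompactOperator_of_summable_norm_sq b _ <|
    summable_of_sum_le (fun i => sq_nonneg _) fun s => sum_norm_sq_kernelOp_le hh b.orthonormal s

/-- An element of `L²(μ ⊗ μ)` orthogonal to all tensor products vanishes. -/
theorem eq_zero_of_inner_tensorLp [IsFiniteMeasure μ] {r : Lp ℝ 2 (μ.prod μ)}
    (hr : ∀ f g, ⟪r, tensorLp f g⟫_ℝ = 0) : r = 0 := by
  have hri : Integrable r (μ.prod μ) := (Lp.memLp r).integrable (by norm_num)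
  have hrect : ∀ s t : Set 𝓧, MeasurableSet s → MeasurableSet t →
      ∫ z in s ×ˢ t, r z ∂(μ.prod μ) = 0 := fun s t hs ht => by
    have hs' : MemLp (s.indicator fun _ => (1 : ℝ)) 2 μ := (memLp_const 1).indicator hs
    have ht' : MemLp (t.indicator fun _ => (1 : ℝ)) 2 μ := (memLp_const 1).indicator ht
    have h1 := hr (hs'.toLp _) (ht'.toLp _)
    rw [tensorLp, Lp_inner_eq] at h1
    rw [← integral_indicator (hs.prod ht), ← h1]
    refine integral_congr_ae ?_
    filter_upwards [(memLp_tensor (Lp.memLp (hs'.toLp _)) (Lp.memLp (ht'.toLp _))).coeFn_toLp,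
      Measure.quasiMeasurePreserving_fst.ae hs'.coeFn_toLp,
      Measure.quasiMeasurePreserving_snd.ae ht'.coeFn_toLp] with z h2 h3 h4
    rw [h2, h3, h4]
    by_cases h5 : z.1 ∈ s <;> by_cases h6 : z.2 ∈ t <;>
      simp [Set.indicator, h5, h6]
  -- Rectangles form a generating π-system, and the sets on which the integral vanishes are closed
  -- under complements and disjoint unions.
  have hall : ∀ A : Set (𝓧 × 𝓧), MeasurableSet A → ∫ z in A, r z ∂(μ.prod μ) = 0 := by
    refine MeasurableSpace.induction_on_inter generateFrom_prod.symm isPiSystem_prod ?_ ?_ ?_ ?_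
    · simp
    · rintro _ ⟨s, hs, t, ht, rfl⟩
      exact hrect s t hs ht
    · intro A hA h0
      have h1 := integral_add_compl hA hri
      have h2 := hrect Set.univ Set.univ MeasurableSet.univ MeasurableSet.univ
      rw [Set.univ_prod_univ, setIntegral_univ] at h2
      linarith
    · intro A hd hm h0
      rw [integral_iUnion hm hd hri.integrableOn]
      simp [h0]
  rw [Lp.eq_zero_iff_ae_eq_zero]
  exact hri.ae_eq_zero_of_forall_setIntegral_eq_zero fun A hA _ => hall A hA

end HilbertSchmidt

/-! ### Eigenvalues and the eigenfunction expansion of a symmetric kernel -/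

section SpectralExpansion

section Abstract

variable {𝓧 : Type*} [MeasurableSpace 𝓧] {μ : Measure 𝓧} [IsFiniteMeasure μ] {h : 𝓧 → 𝓧 → ℝ}

theorem orthonormal_tensorLp {ι : Type*} {φ : ι → Lp ℝ 2 μ} (hφ : Orthonormal ℝ φ) :
    Orthonormal ℝ fun i => tensorLp (φ i) (φ i) := by
  classical
  rw [orthonormal_iff_ite] at hφ ⊢
  intro i j
  rw [inner_tensorLp_tensorLp, hφ i j]
  split_ifs <;> simp

theorem inner_tensorLp_toLp_of_eigenvector
    (hh : MemLp (fun z : 𝓧 × 𝓧 => h z.1 z.2) 2 (μ.prod μ)) {φ : Lp ℝ 2 μ} {c : ℝ}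
    (hφ : kernelOp hh φ = c • φ) (hn : ‖φ‖ = 1) : ⟪tensorLp φ φ, hh.toLp _⟫_ℝ = c := by
  rw [real_inner_comm, inner_toLp_tensorLp, hφ, real_inner_smul_right, real_inner_self_eq_norm_sq,
    hn]
  ring

/-- The eigenvalues are the coefficients of the kernel along the orthonormal tensors `φ i ⊗ φ i`, so
Bessel's inequality in `L²(μ ⊗ μ)` applies. -/
theorem summable_sq_eigenvalue (hh : MemLp (fun z : 𝓧 × 𝓧 => h z.1 z.2) 2 (μ.prod μ))
    {ι : Type*} {φ : ι → Lp ℝ 2 μ} {c : ι → ℝ} (hφ : Orthonormal ℝ φ)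
    (hT : ∀ i, kernelOp hh (φ i) = c i • φ i) : Summable fun i => c i ^ 2 := by
  have := (orthonormal_tensorLp hφ).inner_products_summable (hh.toLp _)
  simpa only [inner_tensorLp_toLp_of_eigenvector hh (hT _) (hφ.1 _), Real.norm_eq_abs, sq_abs]
    using this

theorem summable_subtype_ne_zero_iff {α : Type*} [AddCommMonoid α] [TopologicalSpace α]
    {c : ℕ → ℝ} {f : ℕ → α} (hf : ∀ j, c j = 0 → f j = 0) :
    Summable (fun j : {j // c j ≠ 0} => f j) ↔ Summable f := by
  refine (Subtype.val_injective (p := fun j => c j ≠ 0)).summable_iff fun j hj => hf j ?_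
  by_contra hne
  exact hj ⟨⟨j, hne⟩, rfl⟩

/-- The expansion of a symmetric square integrable kernel in eigenfunctions. -/
theorem hasSum_eigenvector_tensorLp (hh : MemLp (fun z : 𝓧 × 𝓧 => h z.1 z.2) 2 (μ.prod μ))
    (hsymm : ∀ x y, h x y = h y x) {c : ℕ → ℝ} {φ : ℕ → Lp ℝ 2 μ}
    (hT : ∀ j, kernelOp hh (φ j) = c j • φ j)
    (horth : Orthonormal ℝ fun j : {j // c j ≠ 0} => φ j) (hzero : ∀ j, c j = 0 → φ j = 0)
    (hspan : ∀ lam : ℝ, lam ≠ 0 →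
      Module.End.eigenspace (kernelOp hh : Lp ℝ 2 μ →ₗ[ℝ] Lp ℝ 2 μ) lam ≤
        Submodule.span ℝ (φ '' {j | c j = lam})) :
    Summable (fun j => c j ^ 2) ∧ HasSum (fun j => c j • tensorLp (φ j) (φ j)) (hh.toLp _) := by
  have hs0 : Summable fun j : {j // c j ≠ 0} => c j ^ 2 :=
    summable_sq_eigenvalue hh horth fun j => hT j
  have hs1 : Summable fun j : {j // c j ≠ 0} => c j • tensorLp (φ j) (φ j) := by
    have h1 := (orthonormal_tensorLp horth).orthogonalFamily.summable_iff_norm_sq_summable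
      fun j => c j
    simp only [Real.norm_eq_abs, sq_abs, LinearIsometry.toSpanSingleton_apply] at h1
    exact h1.2 hs0
  have hs2 : Summable fun j => c j • tensorLp (φ j) (φ j) :=
    (summable_subtype_ne_zero_iff (f := fun j => c j • tensorLp (φ j) (φ j))
      fun j hj => by simp only [hj, zero_smul]).1 hs1
  refine ⟨(summable_subtype_ne_zero_iff (f := fun j => c j ^ 2)
    fun j hj => by simp [hj]).1 hs0, ?_⟩
  obtain ⟨S, hS⟩ := hs2
  suffices hr : hh.toLp _ - S = 0 by
    rw [sub_eq_zero.1 hr]; exact hS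
  set r : Lp ℝ 2 (μ.prod μ) := hh.toLp _ - S with hrdef
  -- With `S` the sum of the series and `r = h - S`, this tests `S` against a tensor product. It
  -- remains to show that `r` is orthogonal to all tensor products.
  have hkey : ∀ f g, HasSum (fun j => c j * (⟪φ j, f⟫_ℝ * ⟪φ j, g⟫_ℝ))
      (⟪f, kernelOp hh g⟫_ℝ - ⟪r, tensorLp f g⟫_ℝ) := fun f g => by
    have h1 := hS.mapL (innerSL ℝ (tensorLp f g))
    have h2 : innerSL ℝ (tensorLp f g) S = ⟪f, kernelOp hh g⟫_ℝ - ⟪r, tensorLp f g⟫_ℝ := by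
      rw [innerSL_apply_apply, hrdef, inner_sub_left, inner_toLp_tensorLp, real_inner_comm]
      ring
    rw [h2] at h1
    refine h1.congr_fun fun j => ?_
    rw [innerSL_apply_apply, real_inner_smul_right, inner_tensorLp_tensorLp,
      real_inner_comm f, real_inner_comm g]
  let r' : 𝓧 → 𝓧 → ℝ := fun x y => r (x, y)
  have hrm : MemLp (fun z : 𝓧 × 𝓧 => r' z.1 z.2) 2 (μ.prod μ) := Lp.memLp r
  have hrr : ∀ f g, ⟪r, tensorLp f g⟫_ℝ = ⟪f, kernelOp (h := r') hrm g⟫_ℝ := fun f g => by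
    rw [← inner_toLp_tensorLp (h := r') hrm]
    congr 1
    exact (Lp.toLp_coeFn r (Lp.memLp r)).symm
  refine eq_zero_of_inner_tensorLp fun f g => ?_
  -- For fixed `f`, the vector `w` represents `g ↦ ⟪r, f ⊗ g⟫`. It is orthogonal to every `φ i` and
  -- to the kernel of the operator, hence to all eigenspaces, whose span is dense by the spectral
  -- theorem.
  set w := (kernelOp (h := r') hrm).adjoint f with hw
  have hwg : ∀ g, ⟪w, g⟫_ℝ = ⟪r, tensorLp f g⟫_ℝ := fun g => by
    rw [hrr, hw, ContinuousLinearMap.adjoint_inner_left]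
  have hwφ : ∀ i, ⟪w, φ i⟫_ℝ = 0 := fun i => by
    by_cases hi : c i = 0
    · rw [hzero i hi, inner_zero_right]
    have h1 := hkey f (φ i)
    have h2 : HasSum (fun j => c j * (⟪φ j, f⟫_ℝ * ⟪φ j, φ i⟫_ℝ))
        (c i * (⟪φ i, f⟫_ℝ * ⟪φ i, φ i⟫_ℝ)) := by
      refine hasSum_single i fun j hj => ?_
      by_cases hcj : c j = 0
      · rw [hcj, zero_mul]
      · have : ⟪φ j, φ i⟫_ℝ = 0 :=
          horth.2 (i := (⟨j, hcj⟩ : {j // c j ≠ 0})) (j := ⟨i, hi⟩) (by simpa using hj)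
        rw [this]; ring
    have h3 := h1.unique h2
    have h4 : ‖φ i‖ = 1 := horth.1 (⟨i, hi⟩ : {j // c j ≠ 0})
    rw [hT, real_inner_smul_right, real_inner_self_eq_norm_sq, h4, real_inner_comm] at h3
    rw [hwg]
    linarith
  have hwbot : w ∈ (⨆ lam, Module.End.eigenspace
      (kernelOp hh : Lp ℝ 2 μ →ₗ[ℝ] Lp ℝ 2 μ) lam)ᗮ := by
    have hle : (⨆ lam, Module.End.eigenspace (kernelOp hh : Lp ℝ 2 μ →ₗ[ℝ] Lp ℝ 2 μ) lam) ≤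
        (LinearMap.ker (innerSL ℝ w : Lp ℝ 2 μ →ₗ[ℝ] ℝ)) := by
      refine iSup_le fun lam => ?_
      by_cases hlam : lam = 0
      · intro g hg
        rw [Module.End.mem_eigenspace_iff, hlam, zero_smul] at hg
        have hg' : kernelOp hh g = 0 := hg
        have hφg : ∀ j, c j * (⟪φ j, f⟫_ℝ * ⟪φ j, g⟫_ℝ) = 0 := fun j => by
          have h1 : ⟪kernelOp hh (φ j), g⟫_ℝ = ⟪φ j, kernelOp hh g⟫_ℝ :=
            kernelOp_isSymmetric hh hsymm (φ j) g
          rw [hT, hg', inner_zero_right, real_inner_smul_left] at h1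
          linear_combination ⟪φ j, f⟫_ℝ * h1
        have h2 := hkey f g
        simp only [hφg] at h2
        have h3 := h2.unique hasSum_zero
        rw [hg', inner_zero_right] at h3
        change ⟪w, g⟫_ℝ = 0
        rw [hwg]
        linarith
      · refine (hspan lam hlam).trans (Submodule.span_le.2 ?_)
        rintro _ ⟨j, -, rfl⟩
        exact hwφ j
    rw [Submodule.mem_orthogonal']
    intro g hg
    exact hle hg
  rw [ContinuousLinearMap.orthogonalComplement_iSup_eigenspaces_eq_bot
    (kernelOp_isCompactOperator hh) (kernelOp_isSymmetric hh hsymm), Submodule.mem_bot] at hwbot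
  rw [← hwg, hwbot, inner_zero_left]

end Abstract

variable {d : ℕ} {μ : Measure (E d)} [IsFiniteMeasure μ] {h : E d → E d → ℝ}

theorem kernelEigenspace_eq (hh : MemLp (fun z : E d × E d => h z.1 z.2) 2 (μ.prod μ)) (lam : ℝ) :
    kernelEigenspace h μ lam =
      Module.End.eigenspace (kernelOp hh : Lp ℝ 2 μ →ₗ[ℝ] Lp ℝ 2 μ) lam := by
  ext f
  rw [Module.End.mem_eigenspace_iff]
  change (∀ᵐ x ∂μ, Integrable (fun y => h x y * f y) μ ∧ ∫ y, h x y * f y ∂μ = lam * f x) ↔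
    kernelOp hh f = lam • f
  rw [Lp.ext_iff]
  have h1 := kernelOp_coeFn hh f
  have h2 := Lp.coeFn_smul lam f
  constructor
  · intro h3
    filter_upwards [h1, h2, h3] with x h1 h2 h3
    rw [h1, h2, h3.2, Pi.smul_apply, smul_eq_mul]
  · intro h3
    filter_upwards [h1, h2, h3, ae_memLp_section hh] with x h1 h2 h3 h4
    refine ⟨h4.integrable_mul (Lp.memLp f), ?_⟩
    rw [← h1, h3, h2, Pi.smul_apply, smul_eq_mul]

/-- Compactness makes the eigenspaces of nonzero eigenvalues finite dimensional; an orthonormal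
basis of each is then viewed inside `L²(μ)`. -/
theorem exists_eigenbasis (hh : MemLp (fun z : E d × E d => h z.1 z.2) 2 (μ.prod μ)) (lam : ℝ)
    (hlam : lam ≠ 0) :
    FiniteDimensional ℝ (kernelEigenspace h μ lam) ∧
    ∃ b : Fin (Module.finrank ℝ (kernelEigenspace h μ lam)) → Lp ℝ 2 μ, Orthonormal ℝ b ∧
      (∀ i, kernelOp hh (b i) = lam • b i) ∧
      kernelEigenspace h μ lam ≤ Submodule.span ℝ (Set.range b) := by
  have hfin : FiniteDimensional ℝ (kernelEigenspace h μ lam) := by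
    rw [kernelEigenspace_eq hh]
    exact ContinuousLinearMap.finite_dimensional_eigenspace (kernelOp_isCompactOperator hh) lam hlam
  refine ⟨hfin, ?_⟩
  let b := stdOrthonormalBasis ℝ (kernelEigenspace h μ lam)
  refine ⟨fun i => b i, b.orthonormal.comp_linearIsometry (Submodule.subtypeₗᵢ _), fun i => ?_, ?_⟩
  · exact Module.End.mem_eigenspace_iff.1 ((kernelEigenspace_eq hh lam).le (b i).2)
  · have h1 : Set.range (fun i => (b i : Lp ℝ 2 μ)) =
        (kernelEigenspace h μ lam).subtype '' Set.range b := by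
      rw [← Set.range_comp]; rfl
    have h2 : Submodule.span ℝ (Set.range b) = ⊤ := by
      rw [← b.coe_toBasis, Module.Basis.span_eq]
    rw [h1, Submodule.span_image, h2, Submodule.map_top, Submodule.range_subtype]

theorem inner_eq_zero_of_ne_eigenvalue
    (hh : MemLp (fun z : E d × E d => h z.1 z.2) 2 (μ.prod μ)) (hsymm : ∀ x y, h x y = h y x)
    {f g : Lp ℝ 2 μ} {a b : ℝ} (hab : a ≠ b) (hf : kernelOp hh f = a • f)
    (hg : kernelOp hh g = b • g) : ⟪f, g⟫_ℝ = 0 := by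
  have h1 : ⟪kernelOp hh f, g⟫_ℝ = ⟪f, kernelOp hh g⟫_ℝ := kernelOp_isSymmetric hh hsymm f g
  rw [hf, hg, real_inner_smul_left, real_inner_smul_right] at h1
  have h2 : (a - b) * ⟪f, g⟫_ℝ = 0 := by linarith
  exact (mul_eq_zero.1 h2).resolve_left (sub_ne_zero.2 hab)

/-- The nonzero eigenvalues of the integral operator of a symmetric square integrable kernel can be
listed. -/
theorem exists_isEigenvalueSeq (hh : MemLp (fun z : E d × E d => h z.1 z.2) 2 (μ.prod μ))
    (hsymm : ∀ x y, h x y = h y x) : ∃ c, IsEigenvalueSeq h μ c := by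
  classical
  choose hfin b hb hbT hbs using exists_eigenbasis hh
  let Λ := Σ lam : {lam : ℝ // lam ≠ 0}, Fin (Module.finrank ℝ (kernelEigenspace h μ lam))
  let e : Λ → Lp ℝ 2 μ := fun i => b i.1 i.1.2 i.2
  have he : Orthonormal ℝ e := by
    refine ⟨fun i => (hb _ _).1 _, fun i j hij => ?_⟩
    obtain ⟨⟨a, ha⟩, i⟩ := i
    obtain ⟨⟨a', ha'⟩, j⟩ := j
    by_cases haa : a = a'
    · subst haa
      exact (hb a ha).2 fun hij' => hij (by subst hij'; rfl)
    · exact inner_eq_zero_of_ne_eigenvalue hh hsymm haa (hbT _ _ _) (hbT _ _ _)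
  -- The squared eigenvalues form a summable family with no zero term, which forces the index set to
  -- be countable.
  have hcount : Countable Λ := by
    have hs := (summable_sq_eigenvalue hh he (c := fun i => (i.1 : ℝ)) fun i => hbT _ _ _)
    have h1 := hs.countable_support
    have h2 : Function.support (fun i : Λ => (i.1 : ℝ) ^ 2) = Set.univ := by
      ext i
      simp [i.1.2]
    rw [h2] at h1
    exact Set.countable_univ_iff.1 h1
  obtain ⟨enc, henc⟩ := Countable.exists_injective_nat Λ
  -- Integers that encode no eigenvector receive the padding value `0`.
  let c : ℕ → ℝ := fun j => if hj : ∃ i, enc i = j then (hj.choose.1 : ℝ) else 0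
  have hc1 : ∀ i, c (enc i) = i.1 := fun i => by
    have hj : ∃ i', enc i' = enc i := ⟨i, rfl⟩
    simp only [c, dif_pos hj]
    rw [henc hj.choose_spec]
  have hc2 : ∀ j, c j ≠ 0 → ∃ i, enc i = j := fun j hj => by
    by_contra hne
    exact hj (dif_neg hne)
  refine ⟨c, fun lam hlam => ?_⟩
  have := hfin lam hlam
  rw [← Module.finrank_eq_rank, ← Cardinal.mk_fin]
  refine (Cardinal.mk_congr (Equiv.ofBijective (fun i => ⟨enc ⟨⟨lam, hlam⟩, i⟩, hc1 _⟩)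
    ⟨fun i j hij => ?_, fun ⟨j, hj⟩ => ?_⟩)).symm
  · have h1 := henc (Subtype.ext_iff.1 hij)
    simpa [Λ] using h1
  · obtain ⟨⟨⟨a, ha⟩, i⟩, rfl⟩ := hc2 j (by rw [hj]; exact hlam)
    have h1 := hc1 ⟨⟨a, ha⟩, i⟩
    rw [hj] at h1
    simp only at h1
    subst h1
    exact ⟨i, rfl⟩

/-- The eigenfunction expansion attached to a list of the nonzero eigenvalues. -/
theorem IsEigenvalueSeq.exists_expansion
    (hh : MemLp (fun z : E d × E d => h z.1 z.2) 2 (μ.prod μ)) (hsymm : ∀ x y, h x y = h y x)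
    {c : ℕ → ℝ} (hc : IsEigenvalueSeq h μ c) :
    ∃ φ : ℕ → Lp ℝ 2 μ, (∀ j, kernelOp hh (φ j) = c j • φ j) ∧
      (∀ i j, ⟪φ i, φ j⟫_ℝ = if i = j ∧ c i ≠ 0 then 1 else 0) ∧
      Summable (fun j => c j ^ 2) ∧ HasSum (fun j => c j • tensorLp (φ j) (φ j)) (hh.toLp _) := by
  classical
  choose hfin b hb hbT hbs using exists_eigenbasis hh
  -- The list repeats each nonzero eigenvalue as often as its multiplicity, so its occurrences can
  -- be matched bijectively with an orthonormal basis of the eigenspace. Padding entries get the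
  -- zero vector.
  have hε : ∀ lam : ℝ, lam ≠ 0 → Nonempty ({j : ℕ // c j = lam} ≃
      Fin (Module.finrank ℝ (kernelEigenspace h μ lam))) := fun lam hlam => by
    have := hfin lam hlam
    rw [← Cardinal.eq, hc lam hlam, Cardinal.mk_fin, Module.finrank_eq_rank]
  let ε := fun lam hlam => (hε lam hlam).some
  let φ : ℕ → Lp ℝ 2 μ := fun j =>
    if hj : c j = 0 then 0 else b (c j) hj (ε (c j) hj ⟨j, rfl⟩)
  have hφ0 : ∀ j, c j = 0 → φ j = 0 := fun j hj => dif_pos hj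
  have hφ : ∀ lam (hlam : lam ≠ 0) j (hj : c j = lam), φ j = b lam hlam (ε lam hlam ⟨j, hj⟩) :=
    fun lam hlam j hj => by
      subst hj
      exact dif_neg hlam
  have hT : ∀ j, kernelOp hh (φ j) = c j • φ j := fun j => by
    by_cases hj : c j = 0
    · rw [hφ0 j hj, map_zero, smul_zero]
    · rw [hφ _ hj j rfl]
      exact hbT _ _ _
  have horth : Orthonormal ℝ fun j : {j // c j ≠ 0} => φ j := by
    refine ⟨fun j => ?_, fun i j hij => ?_⟩
    · simp only [hφ _ j.2 j rfl]
      exact (hb _ _).1 _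
    · by_cases hcc : c i = c j
      · simp only [hφ _ j.2 i hcc, hφ _ j.2 j rfl]
        refine (hb _ _).2 fun h1 => hij ?_
        have := (ε _ j.2).injective h1
        exact Subtype.ext (Subtype.mk.inj this)
      · exact inner_eq_zero_of_ne_eigenvalue hh hsymm hcc (hT _) (hT _)
  have hspan : ∀ lam : ℝ, lam ≠ 0 →
      Module.End.eigenspace (kernelOp hh : Lp ℝ 2 μ →ₗ[ℝ] Lp ℝ 2 μ) lam ≤
        Submodule.span ℝ (φ '' {j | c j = lam}) := fun lam hlam => by
    rw [← kernelEigenspace_eq hh]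
    refine (hbs lam hlam).trans (Submodule.span_mono ?_)
    rintro _ ⟨i, rfl⟩
    refine ⟨((ε lam hlam).symm i : {j // c j = lam}), ((ε lam hlam).symm i).2, ?_⟩
    rw [hφ lam hlam _ ((ε lam hlam).symm i).2]
    simp
  refine ⟨φ, hT, fun i j => ?_, hasSum_eigenvector_tensorLp hh hsymm hT horth hφ0 hspan⟩
  by_cases hi : c i = 0
  · simp [hφ0 i hi, hi]
  by_cases hj : c j = 0
  · have : i ≠ j := fun h => hi (h ▸ hj)
    simp [hφ0 j hj, this]
  have h1 := (orthonormal_iff_ite.1 horth) ⟨i, hi⟩ ⟨j, hj⟩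
  simpa [hi] using h1

end SpectralExpansion

/-! ### Tools for convergence in distribution and almost sure convergence -/

section WeakConvergence

variable {Ω Ω' : Type*} [MeasurableSpace Ω] [MeasurableSpace Ω'] {P : Measure Ω}
  [IsProbabilityMeasure P] {P' : Measure Ω'} [IsProbabilityMeasure P']

/-- The function `x ↦ exp (i t x)` is `|t|`-Lipschitz, so closeness in mean controls characteristic
functions. -/
theorem norm_charFun_map_sub_le {A B : Ω → ℝ} (hA : AEMeasurable A P) (hB : AEMeasurable B P)
    (hAB : Integrable (fun ω => A ω - B ω) P) (t : ℝ) :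
    ‖charFun (P.map A) t - charFun (P.map B) t‖ ≤ |t| * ∫ ω, |A ω - B ω| ∂P := by
  have hch : ∀ {C : Ω → ℝ}, AEMeasurable C P →
      charFun (P.map C) t = ∫ ω, Complex.exp (t * C ω * Complex.I) ∂P := fun {C} hC => by
    rw [charFun_apply_real, integral_map hC (by fun_prop)]
  have hint : ∀ {C : Ω → ℝ}, AEMeasurable C P →
      Integrable (fun ω => Complex.exp (t * C ω * Complex.I)) P := fun {C} hC => by
    refine Integrable.of_bound (C := 1) ?_ (Eventually.of_forall fun ω => ?_)
    · exact (Complex.measurable_exp.comp_aemeasurable (by fun_prop)).aestronglyMeasurable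
    · have h1 : (t * C ω * Complex.I : ℂ) = ((t * C ω : ℝ) : ℂ) * Complex.I := by push_cast; ring
      rw [h1, Complex.norm_exp_ofReal_mul_I]
  rw [hch hA, hch hB, ← integral_sub (hint hA) (hint hB), ← integral_const_mul]
  refine norm_integral_le_of_norm_le (hAB.abs.const_mul _) (Eventually.of_forall fun ω => ?_)
  have h1 : Complex.exp (t * A ω * Complex.I) - Complex.exp (t * B ω * Complex.I) =
      Complex.exp ((t * B ω : ℝ) * Complex.I) *
        (Complex.exp (Complex.I * ((t * (A ω - B ω) : ℝ) : ℂ)) - 1) := by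
    rw [mul_sub, ← Complex.exp_add, mul_one]
    congr 2 <;> push_cast <;> ring
  rw [h1, norm_mul, Complex.norm_exp_ofReal_mul_I, one_mul]
  refine Real.norm_exp_I_mul_ofReal_sub_one_le.trans_eq ?_
  rw [Real.norm_eq_abs, abs_mul]

/-- Convergence in distribution of a sequence that is approximated in mean by sequences that
converge in distribution. -/
theorem tendstoInDistribution_of_approx {A : ℕ → Ω → ℝ} {A' : ℕ → ℕ → Ω → ℝ} {B : ℕ → Ω' → ℝ}
    {Y : Ω' → ℝ} {e : ℕ → ℝ} (hA : ∀ n, AEMeasurable (A n) P)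
    (hA' : ∀ K, TendstoInDistribution (A' K) atTop (B K) (fun _ => P) P')
    (hB : TendstoInDistribution B atTop Y (fun _ => P') P') (he : Tendsto e atTop (𝓝 0))
    (hle : ∀ K, ∀ᶠ n in atTop, Integrable (fun ω => A n ω - A' K n ω) P ∧
      ∫ ω, |A n ω - A' K n ω| ∂P ≤ e K) :
    TendstoInDistribution A atTop Y (fun _ => P) P' where
  forall_aemeasurable := hA
  aemeasurable_limit := hB.aemeasurable_limit
  tendsto := by
    refine ProbabilityMeasure.tendsto_iff_tendsto_charFun.2 fun t => ?_
    have h1 := fun K => ProbabilityMeasure.tendsto_iff_tendsto_charFun.1 (hA' K).tendsto t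
    have h2 := ProbabilityMeasure.tendsto_iff_tendsto_charFun.1 hB.tendsto t
    simp only [ProbabilityMeasure.coe_mk] at h1 h2 ⊢
    rw [Metric.tendsto_nhds]
    intro ε hε
    have h3 : Tendsto (fun K => |t| * e K) atTop (𝓝 0) := by simpa using he.const_mul |t|
    -- The truncation level `K` is fixed before `n`, which works since `e K` bounds the error for
    -- all large `n`.
    obtain ⟨K, hK1, hK2⟩ := ((Metric.tendsto_nhds.1 h2 (ε / 3) (by positivity)).and
      (h3.eventually_lt_const (show (0 : ℝ) < ε / 3 by positivity))).exists
    filter_upwards [hle K, Metric.tendsto_nhds.1 (h1 K) (ε / 3) (by positivity)] with n hn hn'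
    have h4 := norm_charFun_map_sub_le (hA n) ((hA' K).forall_aemeasurable n) hn.1 t
    rw [← dist_eq_norm] at h4
    have h5 : |t| * ∫ ω, |A n ω - A' K n ω| ∂P ≤ |t| * e K :=
      mul_le_mul_of_nonneg_left hn.2 (abs_nonneg t)
    have h6 := dist_triangle4 (charFun (P.map (A n)) t) (charFun (P.map (A' K n)) t)
      (charFun (P'.map (B K)) t) (charFun (P'.map Y) t)
    linarith

theorem charFun_map_inner {V α : Type*} [NormedAddCommGroup V] [InnerProductSpace ℝ V]
    [FiniteDimensional ℝ V] [MeasurableSpace V] [BorelSpace V] [MeasurableSpace α] {ν : Measure α}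
    {U : α → V} (hU : AEMeasurable U ν) (t : V) :
    charFun (ν.map fun a => ⟪U a, t⟫_ℝ) 1 = charFun (ν.map U) t := by
  have hm : Measurable fun v : V => ⟪v, t⟫_ℝ := (continuous_id.inner continuous_const).measurable
  have hUm : AEMeasurable (fun a => ⟪U a, t⟫_ℝ) ν := hm.comp_aemeasurable hU
  rw [charFun_apply_real, charFun_apply, integral_map hUm (by fun_prop), integral_map hU]
  · simp
  · exact (Complex.measurable_exp.comp ((Complex.measurable_ofReal.comp hm).mul_const
      Complex.I)).aestronglyMeasurable

/-- The Cramér–Wold device. -/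
theorem tendstoInDistribution_of_inner {V : Type*} [NormedAddCommGroup V] [InnerProductSpace ℝ V]
    [FiniteDimensional ℝ V] [MeasurableSpace V] [BorelSpace V] {W : ℕ → Ω → V} {Y : Ω' → V}
    (hW : ∀ n, AEMeasurable (W n) P) (hY : AEMeasurable Y P')
    (h : ∀ t : V, TendstoInDistribution (fun n ω => ⟪W n ω, t⟫_ℝ) atTop (fun ω => ⟪Y ω, t⟫_ℝ)
      (fun _ => P) P') :
    TendstoInDistribution W atTop Y (fun _ => P) P' where
  forall_aemeasurable := hW
  aemeasurable_limit := hY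
  tendsto := by
    refine ProbabilityMeasure.tendsto_iff_tendsto_charFun.2 fun t => ?_
    have h1 := ProbabilityMeasure.tendsto_iff_tendsto_charFun.1 (h t).tendsto 1
    simp only [ProbabilityMeasure.coe_mk] at h1 ⊢
    rw [← charFun_map_inner hY]
    exact h1.congr fun n => charFun_map_inner (hW n) t

theorem hasLaw_sum_gaussianReal {Z : ℕ → Ω' → ℝ} (hZ : ∀ j, HasLaw (Z j) (gaussianReal 0 1) P')
    (hind : iIndepFun Z P') (s : Finset ℕ) (b : ℕ → ℝ) :
    HasLaw (fun ω => ∑ j ∈ s, b j * Z j ω) (gaussianReal 0 (∑ j ∈ s, b j ^ 2).toNNReal) P' where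
  aemeasurable := Finset.aemeasurable_fun_sum _ fun j _ => (hZ j).aemeasurable.const_mul _
  map_eq := by
    have hm : ∀ j, AEMeasurable (fun ω => b j * Z j ω) P' := fun j =>
      (hZ j).aemeasurable.const_mul _
    have : IsProbabilityMeasure (P'.map fun ω => ∑ j ∈ s, b j * Z j ω) :=
      Measure.isProbabilityMeasure_map (Finset.aemeasurable_fun_sum _ fun j _ => hm j)
    refine Measure.ext_of_charFun (funext fun t => ?_)
    have hind' : iIndepFun (fun j ω => b j * Z j ω) P' :=
      hind.comp (fun j x => b j * x) fun j => by fun_prop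
    have h1 := (hind'.restrict s).charFun_map_fun_finsetSum_eq_prod (fun j _ => hm j)
    rw [h1, Finset.prod_apply, charFun_gaussianReal,
      Real.coe_toNNReal _ (Finset.sum_nonneg fun j _ => sq_nonneg _)]
    have h2 : ∀ j, charFun (P'.map fun ω => b j * Z j ω) t =
        Complex.exp (-(((b j ^ 2 : ℝ) : ℂ) * t ^ 2 / 2)) := fun j => by
      rw [charFun_map_mul_comp (hZ j).aemeasurable, (hZ j).map_eq, charFun_gaussianReal]
      congr 1
      push_cast
      ring
    simp_rw [h2]
    rw [← Complex.exp_sum]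
    congr 1
    push_cast
    rw [Finset.sum_neg_distrib, ← Finset.sum_div, ← Finset.sum_mul]
    ring

/-- Almost sure convergence of a series of independent centred variables with summable
variances. -/
theorem exists_ae_tendsto_sum {ξ : ℕ → Ω → ℝ} (hξ : ∀ j, MemLp (ξ j) 2 P) (hind : iIndepFun ξ P)
    (h0 : ∀ j, ∫ ω, ξ j ω ∂P = 0) (hsum : Summable fun j => ∫ ω, ξ j ω ^ 2 ∂P) :
    ∃ Y : Ω → ℝ, AEMeasurable Y P ∧
      ∀ᵐ ω ∂P, Tendsto (fun m : ℕ => ∑ j ∈ Finset.range m, ξ j ω) atTop (𝓝 (Y ω)) := by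
  -- The natural filtration requires strongly measurable variables, so representatives are used
  -- throughout.
  let ζ : ℕ → Ω → ℝ := fun j => (hξ j).1.mk (ξ j)
  have hζm : ∀ j, StronglyMeasurable (ζ j) := fun j => (hξ j).1.stronglyMeasurable_mk
  have hξζ : ∀ j, ξ j =ᵐ[P] ζ j := fun j => (hξ j).1.ae_eq_mk
  have hζ : ∀ j, MemLp (ζ j) 2 P := fun j => (hξ j).ae_eq (hξζ j)
  have hindζ : iIndepFun ζ P := hind.congr hξζ
  have hζ0 : ∀ j, ∫ ω, ζ j ω ∂P = 0 := fun j => by rw [← h0 j]; exact integral_congr_ae (hξζ j).symm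
  have hζsq : ∀ j, Var[ζ j; P] = ∫ ω, ξ j ω ^ 2 ∂P := fun j => by
    rw [variance_of_integral_eq_zero (hζ j).1.aemeasurable (hζ0 j)]
    exact integral_congr_ae ((hξζ j).mono fun ω hω => by simp [hω])
  -- The sum runs through index `m` inclusive, which makes `M m` adapted to the natural filtration
  -- at time `m`. This martingale is bounded in `L²`, hence in `L¹`, and converges almost surely.
  let M : ℕ → Ω → ℝ := fun m ω => ∑ j ∈ Finset.range (m + 1), ζ j ω
  have hML : ∀ m, MemLp (M m) 2 P := fun m => memLp_finsetSum _ fun j _ => hζ j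
  have hmart : Martingale M (Filtration.natural ζ hζm) P := by
    refine martingale_of_condExp_sub_eq_zero_nat (fun m => ?_)
      (fun m => (hML m).integrable (by norm_num)) fun m => ?_
    · refine Finset.stronglyMeasurable_fun_sum _ fun j hj => ?_
      exact (Filtration.stronglyAdapted_natural hζm j).mono
        ((Filtration.natural ζ hζm).mono (by simpa [Nat.lt_succ_iff] using hj))
    · have h1 : M (m + 1) - M m = ζ (m + 1) := by
        ext ω
        simp only [M, Pi.sub_apply]
        rw [Finset.sum_range_succ _ (m + 1)]
        ring
      rw [h1]
      refine (condExp_indep_eq (hζm (m + 1)).measurable.comap_le (Filtration.le _ _)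
        (comap_measurable _).stronglyMeasurable
        (hindζ.indep_comap_natural_of_lt hζm (Nat.lt_succ_self m))).trans ?_
      rw [hζ0]
      rfl
  have hvar : ∀ m, ∫ ω, M m ω ^ 2 ∂P ≤ ∑' j, ∫ ω, ξ j ω ^ 2 ∂P := fun m => by
    have h1 : Var[∑ j ∈ Finset.range (m + 1), ζ j; P] =
        ∑ j ∈ Finset.range (m + 1), Var[ζ j; P] :=
      IndepFun.variance_sum (fun j _ => hζ j) fun i _ j _ hij => hindζ.indepFun hij
    have h2 : (∑ j ∈ Finset.range (m + 1), ζ j) = M m := by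
      ext ω
      simp [M]
    have h3 : ∫ ω, M m ω ∂P = 0 := by
      simp only [M]
      rw [integral_finsetSum _ fun j _ => (hζ j).integrable (by norm_num)]
      simp [hζ0]
    rw [h2, variance_of_integral_eq_zero (hML m).1.aemeasurable h3] at h1
    rw [h1]
    simp_rw [hζsq]
    exact hsum.sum_le_tsum _ fun j _ => integral_nonneg fun ω => sq_nonneg _
  have hbdd : ∀ m, eLpNorm (M m) 1 P ≤
      ((∑' j, ∫ ω, ξ j ω ^ 2 ∂P) ^ (2 : ℝ)⁻¹).toNNReal := fun m => by
    refine (eLpNorm_le_eLpNorm_of_exponent_le one_le_two (hML m).1).trans ?_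
    rw [(hML m).eLpNorm_eq_integral_rpow_norm two_ne_zero (by simp)]
    refine ENNReal.ofReal_le_ofReal ?_
    simp only [ENNReal.toReal_ofNat, Real.rpow_two, Real.norm_eq_abs, sq_abs]
    exact Real.rpow_le_rpow (integral_nonneg fun ω => sq_nonneg _) (hvar m) (by norm_num)
  obtain ⟨Y, hY, hlim⟩ := measurable_limit_of_tendsto_metrizable_ae
    (fun m => (hML m).1.aemeasurable) (hmart.submartingale.exists_ae_tendsto_of_bdd hbdd)
  refine ⟨Y, hY.aemeasurable, ?_⟩
  filter_upwards [hlim, ae_all_iff.2 hξζ] with ω hω hω'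
  rw [← tendsto_add_atTop_iff_nat 1]
  refine hω.congr fun m => ?_
  exact Finset.sum_congr rfl fun j _ => (hω' j).symm

end WeakConvergence

/-! ### Degenerate kernels of finite rank -/

section DegenerateLimit

variable {𝓧 Ω Ω' : Type*} [MeasurableSpace 𝓧] [MeasurableSpace Ω] [MeasurableSpace Ω']
  {μ : Measure 𝓧} [IsProbabilityMeasure μ] {P : Measure Ω} [IsProbabilityMeasure P]
  {P' : Measure Ω'} [IsProbabilityMeasure P'] {X : ℕ → Ω → 𝓧} {Z : ℕ → Ω' → ℝ}

/-- The multivariate central limit theorem for finitely many uncorrelated functions, each of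
variance zero or one. -/
theorem tendstoInDistribution_vector (hX : ∀ i, HasLaw (X i) μ P) (hind : iIndepFun X P)
    (hZ : ∀ j, HasLaw (Z j) (gaussianReal 0 1) P') (hZind : iIndepFun Z P')
    {f : ℕ → 𝓧 → ℝ} (hf : ∀ j, MemLp (f j) 2 μ) (hf0 : ∀ j, ∫ x, f j x ∂μ = 0) {a : ℕ → ℝ}
    (ha : ∀ j, a j ^ 2 = a j)
    (horth : ∀ i j, ∫ x, f i x * f j x ∂μ = if i = j then a i else 0) (K : ℕ) :
    TendstoInDistribution
      (fun (n : ℕ) ω => (WithLp.toLp 2 fun l : Fin K =>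
        (√(n : ℝ))⁻¹ * ∑ i ∈ Finset.range n, f l (X i ω) : EuclideanSpace ℝ (Fin K)))
      atTop (fun ω' => (WithLp.toLp 2 fun l : Fin K => a l * Z l ω' : EuclideanSpace ℝ (Fin K)))
      (fun _ => P) P' := by
  have hfX : ∀ j i, AEMeasurable (fun ω => f j (X i ω)) P := fun j i =>
    ((hX i).memLp_comp (hf j)).1.aemeasurable
  have htoLp : Measurable (WithLp.toLp 2 : (Fin K → ℝ) → EuclideanSpace ℝ (Fin K)) :=
    (PiLp.continuous_toLp 2 _).measurable
  refine tendstoInDistribution_of_inner (fun n => htoLp.comp_aemeasurable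
    (aemeasurable_pi_lambda _ fun l =>
      (Finset.aemeasurable_fun_sum _ fun i _ => hfX l i).const_mul _))
    (htoLp.comp_aemeasurable (aemeasurable_pi_lambda _ fun l =>
      (hZ l).aemeasurable.const_mul _)) fun t => ?_
  -- By Cramér–Wold it suffices to treat one linear combination. Its variance is `∑ (t l * a l) ^ 2`
  -- by orthogonality, which is the variance of the matching combination of the `Z l`.
  let g : 𝓧 → ℝ := fun x => ∑ l : Fin K, t l * f l x
  have hg : MemLp g 2 μ := memLp_finsetSum _ fun l _ => (hf l).const_mul _
  have hg0 : ∫ x, g x ∂μ = 0 := by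
    simp only [g]
    rw [integral_finsetSum _ fun (l : Fin K) _ =>
      ((hf (l : ℕ)).integrable (by norm_num)).const_mul (t l)]
    simp [integral_const_mul, hf0]
  have hgvar : Var[g; μ] = ∑ l : Fin K, (t l * a l) ^ 2 := by
    rw [variance_of_integral_eq_zero hg.1.aemeasurable hg0]
    have h1 : ∀ x, g x ^ 2 = ∑ l : Fin K, ∑ m : Fin K, t l * t m * (f l x * f m x) := fun x => by
      simp only [g]
      rw [sq, Finset.sum_mul_sum]
      exact Finset.sum_congr rfl fun l _ => Finset.sum_congr rfl fun m _ => by ring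
    have h2 : ∀ l m : Fin K, Integrable (fun x => t l * t m * (f l x * f m x)) μ := fun l m =>
      ((hf l).integrable_mul (hf m)).const_mul _
    simp_rw [h1]
    rw [integral_finsetSum _ fun l _ => integrable_finsetSum _ fun m _ => h2 l m]
    refine Finset.sum_congr rfl fun l _ => ?_
    rw [integral_finsetSum _ fun m _ => h2 l m]
    simp_rw [integral_const_mul, horth]
    rw [Finset.sum_eq_single l]
    · rw [if_pos rfl, mul_pow, ha]; ring
    · intro m _ hm
      rw [if_neg (fun h => hm (Fin.ext h.symm)), mul_zero]
    · simp
  have hsumfin : ∀ u : ℕ → ℝ, ∑ l : Fin K, u l = ∑ l ∈ Finset.range K, u l := fun u =>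
    Fin.sum_univ_eq_sum_range u K
  let t' : ℕ → ℝ := fun l => if hl : l < K then t ⟨l, hl⟩ else 0
  have ht' : ∀ l : Fin K, t' l = t l := fun l => by simp [t']
  have hlaw := hasLaw_sum_gaussianReal hZ hZind (Finset.range K) fun l => t' l * a l
  rw [← hsumfin fun l => (t' l * a l) ^ 2] at hlaw
  simp only [ht'] at hlaw
  rw [← hgvar] at hlaw
  have hclt := tendstoInDistribution_sum_comp hX hind hg hlaw
  rw [hg0] at hclt
  convert hclt using 3 with n ω ω'
  · rw [PiLp.inner_apply]
    simp only [g, mul_zero, sub_zero, RCLike.inner_apply, conj_trivial]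
    rw [Finset.sum_comm, Finset.mul_sum]
    refine Finset.sum_congr rfl fun l _ => ?_
    rw [← Finset.mul_sum]
    ring
  · rw [PiLp.inner_apply, ← hsumfin fun l => t' l * a l * Z l ω']
    refine Finset.sum_congr rfl fun l _ => ?_
    simp only [RCLike.inner_apply, conj_trivial, ht']
    ring

theorem sum_sum_erase_mul (n : ℕ) (u : ℕ → ℝ) :
    ∑ i ∈ Finset.range n, ∑ j ∈ (Finset.range n).erase i, u i * u j =
      (∑ i ∈ Finset.range n, u i) ^ 2 - ∑ i ∈ Finset.range n, u i ^ 2 := by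
  have h1 : ∀ i ∈ Finset.range n, ∑ j ∈ (Finset.range n).erase i, u i * u j =
      u i * (∑ j ∈ Finset.range n, u j) - u i ^ 2 := fun i hi => by
    rw [← Finset.mul_sum, Finset.sum_erase_eq_sub hi]
    ring
  rw [Finset.sum_congr rfl h1, Finset.sum_sub_distrib, ← Finset.sum_mul]
  ring

/-- The limit of the U-statistic of a degenerate kernel of finite rank. -/
theorem tendstoInDistribution_finiteRank (hX : ∀ i, HasLaw (X i) μ P) (hind : iIndepFun X P)
    (hZ : ∀ j, HasLaw (Z j) (gaussianReal 0 1) P') (hZind : iIndepFun Z P')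
    {f : ℕ → 𝓧 → ℝ} (hf : ∀ j, MemLp (f j) 2 μ) (hf0 : ∀ j, ∫ x, f j x ∂μ = 0) {a c : ℕ → ℝ}
    (ha : ∀ j, a j ^ 2 = a j) (hca : ∀ j, c j * a j = c j)
    (horth : ∀ i j, ∫ x, f i x * f j x ∂μ = if i = j then a i else 0) (K : ℕ) :
    TendstoInDistribution
      (fun (n : ℕ) ω => (n : ℝ) * ((((n : ℝ) - 1) * n)⁻¹ *
        ∑ i ∈ Finset.range n, ∑ j ∈ (Finset.range n).erase i,
          ∑ l ∈ Finset.range K, c l * (f l (X i ω) * f l (X j ω))))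
      atTop (fun ω' => ∑ l ∈ Finset.range K, c l * (Z l ω' ^ 2 - 1)) (fun _ => P) P' := by
  have hfX : ∀ j i, AEMeasurable (fun ω => f j (X i ω)) P := fun j i =>
    ((hX i).memLp_comp (hf j)).1.aemeasurable
  -- The statistic equals `s n * (∑ c l * W l ^ 2 - ∑ c l * V l n)`, where `W l` is the normalized
  -- sum of `f l` and `V l n` the empirical mean of `f l ^ 2`, which accounts for the missing
  -- diagonal. Here `s n → 1` and `V l n → a l`, so Slutsky's theorem applies.
  let s : ℕ → ℝ := fun n => (n : ℝ) * (((n : ℝ) - 1) * n)⁻¹ * n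
  let V : ℕ → ℕ → Ω → ℝ := fun l n ω => (∑ i ∈ Finset.range n, f l (X i ω) ^ 2) / n
  have hs : Tendsto s atTop (𝓝 1) := by
    have h1 : Tendsto (fun n : ℕ => (1 - ((n : ℝ))⁻¹)⁻¹) atTop (𝓝 1) := by
      have := ((tendsto_inv_atTop_zero.comp
        (tendsto_natCast_atTop_atTop (R := ℝ))).const_sub 1).inv₀ (by norm_num)
      simpa using this
    refine h1.congr' ?_
    filter_upwards [eventually_ge_atTop 2] with n hn
    have hn2 : (2 : ℝ) ≤ n := by exact_mod_cast hn
    have hn1 : (n : ℝ) - 1 ≠ 0 := by linarith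
    have hn0 : (n : ℝ) ≠ 0 := by linarith
    simp only [s]
    have h2 : 1 - (n : ℝ)⁻¹ = ((n : ℝ) - 1) / n := by field_simp
    rw [h2]
    field_simp
  have hV : ∀ l, ∀ᵐ ω ∂P, Tendsto (fun n => V l n ω) atTop (𝓝 (a l)) := fun l => by
    have hm : ∀ i, AEMeasurable (fun x => f l x ^ 2) (P.map (X i)) := fun i => by
      rw [(hX i).map_eq]; exact (hf l).1.aemeasurable.pow_const 2
    have h1 := strong_law_ae_real (μ := P) (fun i ω => f l (X i ω) ^ 2)
      ((hX 0).memLp_comp (hf l)).integrable_sq (fun i j hij => ?_) (fun i => ?_)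
    · have h2 : ∫ ω, f l (X 0 ω) ^ 2 ∂P = a l := by
        rw [(hX 0).integral_fun_comp (f := fun x => f l x ^ 2) ((hf l).1.pow 2)]
        have := horth l l
        rw [if_pos rfl] at this
        simp_rw [sq]
        exact this
      rw [h2] at h1
      exact h1
    · exact (hind.comp₀ (fun _ x => f l x ^ 2) (fun i => (hX i).aemeasurable) hm).indepFun hij
    · exact ((hX i).identDistrib (hX 0)).comp_of_aemeasurable (hm i)
  let Y : ℕ → Ω → ℝ × ℝ := fun n ω => (s n, ∑ l ∈ Finset.range K, c l * V l n ω)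
  have hYm : ∀ n, AEMeasurable (Y n) P := fun n =>
    aemeasurable_const.prodMk (Finset.aemeasurable_fun_sum _ fun l _ =>
      ((Finset.aemeasurable_fun_sum _ fun i _ => (hfX l i).pow_const 2).div_const _).const_mul _)
  have hY : TendstoInMeasure P Y atTop fun _ => ((1 : ℝ), ∑ l ∈ Finset.range K, c l) := by
    refine tendstoInMeasure_of_tendsto_ae (fun n => (hYm n).aestronglyMeasurable) ?_
    filter_upwards [ae_all_iff.2 hV] with ω hω
    refine hs.prodMk_nhds (tendsto_finsetSum _ fun l _ => ?_)
    have := (hω l).const_mul (c l)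
    rwa [hca] at this
  have hW := (tendstoInDistribution_vector hX hind hZ hZind hf hf0 ha horth K).continuous_comp
    (g := fun v : EuclideanSpace ℝ (Fin K) => ∑ l : Fin K, c l * v l ^ 2) (by fun_prop)
  have hfin := hW.continuous_comp_prodMk_of_tendstoInMeasure_const
    (g := fun z : ℝ × (ℝ × ℝ) => z.2.1 * (z.1 - z.2.2)) (by fun_prop) hY hYm
  convert hfin using 3 with n ω ω'
  · simp only [Function.comp_apply, Y, V, s]
    have hswap : ∑ i ∈ Finset.range n, ∑ j ∈ (Finset.range n).erase i,
        ∑ l ∈ Finset.range K, c l * (f l (X i ω) * f l (X j ω)) =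
        ∑ l ∈ Finset.range K, c l * ((∑ i ∈ Finset.range n, f l (X i ω)) ^ 2 -
          ∑ i ∈ Finset.range n, f l (X i ω) ^ 2) := by
      simp_rw [← sum_sum_erase_mul, Finset.mul_sum]
      rw [Finset.sum_comm]
      refine (Finset.sum_congr rfl fun i _ => Finset.sum_comm).trans ?_
      rw [Finset.sum_comm]
    rw [hswap, Fin.sum_univ_eq_sum_range
      (fun l => c l * ((√(n : ℝ))⁻¹ * ∑ i ∈ Finset.range n, f l (X i ω)) ^ 2) K,
      ← Finset.sum_sub_distrib, Finset.mul_sum, Finset.mul_sum, Finset.mul_sum]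
    refine Finset.sum_congr rfl fun l _ => ?_
    rcases Nat.eq_zero_or_pos n with rfl | hn
    · simp
    have hn0 : (0 : ℝ) < n := by exact_mod_cast hn
    rw [mul_pow, inv_pow, Real.sq_sqrt hn0.le]
    field_simp
  · simp only [Function.comp_apply]
    rw [Fin.sum_univ_eq_sum_range (fun l => c l * (a l * Z l ω') ^ 2) K, ← Finset.sum_sub_distrib,
      one_mul]
    refine Finset.sum_congr rfl fun l _ => ?_
    rw [mul_pow, ha]
    linear_combination -(Z l ω') ^ 2 * hca l

end DegenerateLimit

/-! ### Gaussian series and the limit for general degenerate kernels -/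

section GaussianChaos

theorem memLp_sq_sub_one_gaussianReal :
    MemLp (fun x : ℝ => x ^ 2 - 1) 2 (gaussianReal 0 1) := by
  have h1 : MemLp (fun x : ℝ => x ^ 2) 2 (gaussianReal 0 1) := by
    rw [memLp_two_iff_integrable_sq (by fun_prop)]
    have h2 := (memLp_id_gaussianReal (μ := 0) (v := 1) 4).integrable_norm_pow (by norm_num)
    refine h2.congr (Eventually.of_forall fun x => ?_)
    simp only [id, Real.norm_eq_abs]
    rw [← sq_abs x]; ring
  exact h1.sub (memLp_const 1)

theorem integral_sq_sub_one_gaussianReal : ∫ x : ℝ, (x ^ 2 - 1) ∂(gaussianReal 0 1) = 0 := by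
  have h2 : MemLp (id : ℝ → ℝ) 2 (gaussianReal 0 1) := memLp_id_gaussianReal 2
  have h1 := variance_of_integral_eq_zero (μ := gaussianReal 0 1) (X := id) aemeasurable_id
    (by simp)
  rw [variance_id_gaussianReal] at h1
  have h3 : Integrable (fun x : ℝ => x ^ 2) (gaussianReal 0 1) := h2.integrable_sq
  rw [integral_sub h3 (integrable_const _)]
  simp only [id] at h1
  simp [← h1]

variable {Ω Ω' : Type*} [MeasurableSpace Ω] [MeasurableSpace Ω']
  {P : Measure Ω} [IsProbabilityMeasure P] {P' : Measure Ω'} [IsProbabilityMeasure P']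
  {Z : ℕ → Ω' → ℝ}

/-- The terms are independent and centred, and their second moments are a fixed multiple of `c j ^
2`. -/
theorem exists_ae_tendsto_sum_sq_gaussian (hZ : ∀ j, HasLaw (Z j) (gaussianReal 0 1) P')
    (hZind : iIndepFun Z P') {c : ℕ → ℝ} (hc : Summable fun j => c j ^ 2) :
    ∃ Y : Ω' → ℝ, AEMeasurable Y P' ∧ ∀ᵐ ω ∂P',
      Tendsto (fun m : ℕ => ∑ j ∈ Finset.range m, c j * (Z j ω ^ 2 - 1)) atTop (𝓝 (Y ω)) := by
  refine exists_ae_tendsto_sum (ξ := fun j ω => c j * (Z j ω ^ 2 - 1))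
    (fun j => ((hZ j).memLp_comp memLp_sq_sub_one_gaussianReal).const_mul _)
    (hZind.comp (fun j x => c j * (x ^ 2 - 1)) fun j => by fun_prop) (fun j => ?_) ?_
  · rw [integral_const_mul,
      (hZ j).integral_fun_comp (f := fun x => x ^ 2 - 1) memLp_sq_sub_one_gaussianReal.1,
      integral_sq_sub_one_gaussianReal, mul_zero]
  · have h1 : ∀ j, ∫ ω, (c j * (Z j ω ^ 2 - 1)) ^ 2 ∂P' =
        c j ^ 2 * ∫ x : ℝ, (x ^ 2 - 1) ^ 2 ∂(gaussianReal 0 1) := fun j => by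
      simp_rw [mul_pow]
      rw [integral_const_mul, (hZ j).integral_fun_comp (f := fun x => (x ^ 2 - 1) ^ 2)
        (memLp_sq_sub_one_gaussianReal.1.pow 2)]
    simp_rw [h1]
    exact hc.mul_right _

variable {d : ℕ} {μ : Measure (E d)} [IsProbabilityMeasure μ] {X : ℕ → Ω → E d}

/-- A U-statistic evaluates an actual function of two variables, whereas the expansion lives among
`L²` classes; this identifies the class of the truncated kernel's remainder. -/
theorem exists_toLp_sub_sum_tensor {h : E d → E d → ℝ}
    (hh : MemLp (fun z : E d × E d => h z.1 z.2) 2 (μ.prod μ)) (φ : ℕ → Lp ℝ 2 μ) (c : ℕ → ℝ)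
    (K : ℕ) : ∃ hm : MemLp (fun z : E d × E d =>
        h z.1 z.2 - ∑ l ∈ Finset.range K, c l * (φ l z.1 * φ l z.2)) 2 (μ.prod μ),
      hm.toLp _ = hh.toLp _ - ∑ l ∈ Finset.range K, c l • tensorLp (φ l) (φ l) := by
  induction K with
  | zero => simpa using hh
  | succ K ih =>
    obtain ⟨hm, heq⟩ := ih
    have ht := (memLp_tensor (Lp.memLp (φ K)) (Lp.memLp (φ K))).const_smul (c K)
    have hfun : (fun z : E d × E d =>
        h z.1 z.2 - ∑ l ∈ Finset.range (K + 1), c l * (φ l z.1 * φ l z.2)) =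
        (fun z : E d × E d => h z.1 z.2 - ∑ l ∈ Finset.range K, c l * (φ l z.1 * φ l z.2)) -
          c K • fun z : E d × E d => φ K z.1 * φ K z.2 := by
      ext z
      simp only [Finset.sum_range_succ, Pi.sub_apply, Pi.smul_apply, smul_eq_mul]
      ring
    rw [hfun]
    refine ⟨hm.sub ht, ?_⟩
    rw [MemLp.toLp_sub hm ht, heq, MemLp.toLp_const_smul, Finset.sum_range_succ, sub_sub]
    rfl

/-- Degeneracy says that the constant `1` lies in the kernel of the operator, and by symmetry it is
orthogonal to eigenvectors of nonzero eigenvalue. -/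
theorem integral_eigenfunction_eq_zero {h : E d → E d → ℝ}
    (hh : MemLp (fun z : E d × E d => h z.1 z.2) 2 (μ.prod μ)) (hsymm : ∀ x y, h x y = h y x)
    (hdeg : ∀ᵐ x ∂μ, ∫ y, h x y ∂μ = 0) {φ : Lp ℝ 2 μ} {c : ℝ} (hφ : kernelOp hh φ = c • φ)
    (hc : c ≠ 0) : ∫ x, φ x ∂μ = 0 := by
  have h1m : MemLp (fun _ : E d => (1 : ℝ)) 2 μ := memLp_const 1
  have hT1 : kernelOp hh (h1m.toLp _) = 0 := by
    rw [Lp.eq_zero_iff_ae_eq_zero]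
    filter_upwards [kernelOp_coeFn hh (h1m.toLp _), hdeg] with x hx hx'
    rw [hx, Pi.zero_apply, ← hx']
    refine integral_congr_ae ?_
    filter_upwards [h1m.coeFn_toLp] with y hy
    rw [hy, mul_one]
  have h2 : ⟪kernelOp hh φ, h1m.toLp _⟫_ℝ = ⟪φ, kernelOp hh (h1m.toLp _)⟫_ℝ :=
    kernelOp_isSymmetric hh hsymm φ _
  rw [hT1, inner_zero_right, hφ, real_inner_smul_left, Lp_inner_eq] at h2
  have h3 : ∫ x, φ x * (h1m.toLp _ : Lp ℝ 2 μ) x ∂μ = ∫ x, φ x ∂μ := by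
    refine integral_congr_ae ?_
    filter_upwards [h1m.coeFn_toLp] with y hy
    rw [hy, mul_one]
  rw [h3] at h2
  exact (mul_eq_zero.1 h2).resolve_left hc

/-- The limit in distribution of the U-statistic of a degenerate kernel. -/
theorem tendstoInDistribution_degenerate (hX : ∀ i, HasLaw (X i) μ P) (hind : iIndepFun X P)
    (hZ : ∀ j, HasLaw (Z j) (gaussianReal 0 1) P') (hZind : iIndepFun Z P') {h : E d → E d → ℝ}
    (hh : MemLp (fun z : E d × E d => h z.1 z.2) 2 (μ.prod μ)) (hsymm : ∀ x y, h x y = h y x)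
    (hdeg : ∀ᵐ x ∂μ, ∫ y, h x y ∂μ = 0) {c : ℕ → ℝ} (hc : IsEigenvalueSeq h μ c) :
    ∃ Y : Ω' → ℝ, (∀ᵐ ω' ∂P', Tendsto (fun m : ℕ => ∑ j ∈ Finset.range m,
        c j * ((Z j ω') ^ 2 - 1)) atTop (𝓝 (Y ω'))) ∧
      TendstoInDistribution (fun (n : ℕ) ω => (n : ℝ) * ((((n : ℝ) - 1) * n)⁻¹ *
        ∑ i ∈ Finset.range n, ∑ j ∈ (Finset.range n).erase i, h (X i ω) (X j ω)))
        atTop Y (fun _ => P) P' := by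
  obtain ⟨φ, hT, horth, hcs, hexp⟩ := hc.exists_expansion hh hsymm
  obtain ⟨Y, hYm, hY⟩ := exists_ae_tendsto_sum_sq_gaussian hZ hZind hcs
  refine ⟨Y, hY, ?_⟩
  -- The squared norm of `φ j`: one for a genuine eigenvector and zero for padding.
  let a : ℕ → ℝ := fun j => if c j ≠ 0 then 1 else 0
  have ha : ∀ j, a j ^ 2 = a j := fun j => by simp only [a]; split_ifs <;> norm_num
  have hca : ∀ j, c j * a j = c j := fun j => by
    by_cases hj : c j = 0 <;> simp [a, hj]
  have hφ0 : ∀ j, ∫ x, φ j x ∂μ = 0 := fun j => by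
    by_cases hj : c j = 0
    · have h1 := horth j j
      simp only [hj, ne_eq, not_true_eq_false, and_false, if_false] at h1
      rw [inner_self_eq_zero] at h1
      rw [h1, integral_congr_ae (Lp.coeFn_zero ℝ 2 μ)]
      simp
    · exact integral_eigenfunction_eq_zero hh hsymm hdeg (hT j) hj
  have horth' : ∀ i j, ∫ x, φ i x * φ j x ∂μ = if i = j then a i else 0 := fun i j => by
    rw [← Lp_inner_eq, horth]
    by_cases hij : i = j <;> simp [a, hij]
  have hfin := fun K => tendstoInDistribution_finiteRank hX hind hZ hZind
    (f := fun j => φ j) (fun j => Lp.memLp (φ j)) hφ0 ha hca horth' K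
  have hB : TendstoInDistribution
      (fun (K : ℕ) ω' => ∑ l ∈ Finset.range K, c l * (Z l ω' ^ 2 - 1)) atTop Y
      (fun _ => P') P' :=
    tendstoInDistribution_of_ae_tendsto (fun K => Finset.aemeasurable_fun_sum _ fun l _ =>
      (((hZ l).aemeasurable.pow_const 2).sub_const 1).const_mul _) hYm hY
  let ε : ℕ → ℝ := fun K => ‖hh.toLp _ - ∑ l ∈ Finset.range K, c l • tensorLp (φ l) (φ l)‖ ^ 2
  have hε : Tendsto ε atTop (𝓝 0) := by
    have := (hexp.tendsto_sum_nat.const_sub (hh.toLp _)).norm.pow 2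
    simpa using this
  have hSm : ∀ n : ℕ, AEMeasurable (fun ω => (n : ℝ) * ((((n : ℝ) - 1) * n)⁻¹ *
      ∑ i ∈ Finset.range n, ∑ j ∈ (Finset.range n).erase i, h (X i ω) (X j ω))) P := fun n =>
    ((Finset.aemeasurable_fun_sum _ fun i _ => Finset.aemeasurable_fun_sum _ fun j hj =>
      ((hasLaw_prodMk hX hind (Finset.ne_of_mem_erase hj).symm).memLp_comp
        hh).1.aemeasurable).const_mul _).const_mul _
  -- The remainder after `K` terms is again degenerate, so its statistic has second moment at most
  -- `2 (n / (n - 1))² ε K ≤ 8 ε K` for `n ≥ 2`.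
  refine tendstoInDistribution_of_approx (e := fun K => √(8 * ε K)) hSm hfin hB
    (by simpa using (hε.const_mul 8).sqrt) fun K => ?_
  obtain ⟨hm, hmeq⟩ := exists_toLp_sub_sum_tensor hh φ c K
  let r : E d → E d → ℝ := fun x y => h x y - ∑ l ∈ Finset.range K, c l * (φ l x * φ l y)
  have hrsymm : ∀ x y, r x y = r y x := fun x y => by
    simp only [r, hsymm x y]
    congr 1
    exact Finset.sum_congr rfl fun l _ => by ring
  have hrdeg : ∀ᵐ x ∂μ, ∫ y, r x y ∂μ = 0 := by
    filter_upwards [hdeg, ae_memLp_section hh] with x hx hx'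
    have hi : ∀ l, Integrable (fun y => c l * (φ l x * φ l y)) μ := fun l =>
      (((Lp.memLp (φ l)).integrable (by norm_num)).const_mul _).const_mul _
    simp only [r]
    rw [integral_sub (hx'.integrable (by norm_num)) (integrable_finsetSum _ fun l _ => hi l), hx,
      integral_finsetSum _ fun l _ => hi l]
    simp [integral_const_mul, hφ0]
  have hrε : ∫ z : E d × E d, r z.1 z.2 ^ 2 ∂(μ.prod μ) = ε K := by
    simp only [ε]
    rw [← hmeq, Lp_norm_sq_toLp]
  filter_upwards [eventually_ge_atTop 2] with n hn
  obtain ⟨hmem, hle⟩ := integral_sq_degenerate_sum_le hX hind (r := r) hm hrsymm hrdeg n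
  have hn2 : (2 : ℝ) ≤ n := by exact_mod_cast hn
  have hn1 : (0 : ℝ) < (n : ℝ) - 1 := by linarith
  have hn0 : (0 : ℝ) < n := by linarith
  have hD : ∀ ω, (n : ℝ) * ((((n : ℝ) - 1) * n)⁻¹ *
      ∑ i ∈ Finset.range n, ∑ j ∈ (Finset.range n).erase i, h (X i ω) (X j ω)) -
      (n : ℝ) * ((((n : ℝ) - 1) * n)⁻¹ *
        ∑ i ∈ Finset.range n, ∑ j ∈ (Finset.range n).erase i,
          ∑ l ∈ Finset.range K, c l * (φ l (X i ω) * φ l (X j ω))) =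
      ((n : ℝ) - 1)⁻¹ *
        ∑ i ∈ Finset.range n, ∑ j ∈ (Finset.range n).erase i, r (X i ω) (X j ω) := fun ω => by
    simp only [r, Finset.sum_sub_distrib]
    field_simp
  simp_rw [hD]
  have hDm := hmem.const_mul ((n : ℝ) - 1)⁻¹
  refine ⟨hDm.integrable (by norm_num), Real.le_sqrt_of_sq_le ?_⟩
  refine (sq_integral_le hDm.abs).trans ?_
  simp_rw [Pi.abs_apply, sq_abs, mul_pow]
  rw [integral_const_mul, ← hrε]
  have hr0 : 0 ≤ ∫ z : E d × E d, r z.1 z.2 ^ 2 ∂(μ.prod μ) := integral_nonneg fun z => sq_nonneg _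
  calc _ ≤ ((n : ℝ) - 1)⁻¹ ^ 2 * (2 * n ^ 2 * ∫ z : E d × E d, r z.1 z.2 ^ 2 ∂(μ.prod μ)) := by
        gcongr
    _ = 2 * (n / ((n : ℝ) - 1)) ^ 2 * ∫ z : E d × E d, r z.1 z.2 ^ 2 ∂(μ.prod μ) := by
        field_simp
    _ ≤ 2 * 2 ^ 2 * ∫ z : E d × E d, r z.1 z.2 ^ 2 ∂(μ.prod μ) := by
        gcongr
        rw [div_le_iff₀ hn1]
        linarith
    _ = _ := by norm_num

end GaussianChaos

/-! ### Weak means of Hilbert-space valued random vectors -/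

section WeakMean

variable {𝓧 : Type*} [MeasurableSpace 𝓧] {μ : Measure 𝓧} {K : Type*} [NormedAddCommGroup K]
  [InnerProductSpace ℝ K] [CompleteSpace K]

/-- A bounded random vector satisfies `E⟪V, u⟫² ≤ ‖E⟪V, V'⟫²‖^{1/2} ‖u‖²`. -/
theorem integral_inner_sq_le_of_bounded [IsFiniteMeasure μ] {V : 𝓧 → K}
    (hV : StronglyMeasurable V) {R : ℝ} (hR : ∀ x, ‖V x‖ ≤ R) (u : K) :
    ∫ x, ⟪V x, u⟫_ℝ ^ 2 ∂μ ≤ √(∫ z, ⟪V z.1, V z.2⟫_ℝ ^ 2 ∂(μ.prod μ)) * ‖u‖ ^ 2 := by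
  set a : 𝓧 → ℝ := fun x => ⟪V x, u⟫_ℝ with ha
  have ham : StronglyMeasurable a := hV.inner stronglyMeasurable_const
  have hR' : ∀ x, ‖a x‖ ≤ R * ‖u‖ := fun x =>
    (norm_inner_le_norm _ _).trans (mul_le_mul_of_nonneg_right (hR x) (norm_nonneg _))
  have ha2 : MemLp a 2 μ := MemLp.of_bound ham.aestronglyMeasurable _ (.of_forall hR')
  have hh2 : MemLp (fun z : 𝓧 × 𝓧 => ⟪V z.1, V z.2⟫_ℝ) 2 (μ.prod μ) := by
    refine MemLp.of_bound ((hV.comp_measurable measurable_fst).inner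
      (hV.comp_measurable measurable_snd)).aestronglyMeasurable (R * R) (.of_forall fun z => ?_)
    refine (norm_inner_le_norm _ _).trans ?_
    exact mul_le_mul (hR _) (hR _) (norm_nonneg _) ((norm_nonneg _).trans (hR z.1))
  have hi : Integrable (fun x => a x • V x) μ := by
    refine Integrable.of_bound (ham.smul hV).aestronglyMeasurable (R * ‖u‖ * R)
      (.of_forall fun x => ?_)
    rw [norm_smul]
    exact mul_le_mul (hR' x) (hR x) (norm_nonneg _) ((norm_nonneg _).trans (hR' x))
  -- With `A = E a²` one has `A = ⟪c, u⟫`, while `‖c‖² = E[a a' ⟪V, V'⟫] ≤ A √B` by Cauchy–Schwarz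
  -- on the product. Hence `A² ≤ A √B ‖u‖²`, and boundedness of `V` guarantees that the finite
  -- factor `A` can be cancelled.
  set c : K := ∫ x, a x • V x ∂μ with hc
  have hcv : ∀ v, ⟪c, v⟫_ℝ = ∫ x, a x * ⟪V x, v⟫_ℝ ∂μ := fun v => by
    rw [hc, real_inner_comm, ← integral_inner hi]
    refine integral_congr_ae (.of_forall fun x => ?_)
    simp only [inner_smul_right, real_inner_comm]
  set A := ∫ x, a x ^ 2 ∂μ with hA
  set B := ∫ z, ⟪V z.1, V z.2⟫_ℝ ^ 2 ∂(μ.prod μ) with hB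
  have hA0 : 0 ≤ A := integral_nonneg fun x => sq_nonneg _
  have hB0 : 0 ≤ B := integral_nonneg fun x => sq_nonneg _
  have hcu : A = ⟪c, u⟫_ℝ := by
    rw [hcv]
    exact integral_congr_ae (.of_forall fun x => by simp only [ha]; ring)
  have hcc : ‖c‖ ^ 2 = ∫ z : 𝓧 × 𝓧, (a z.1 * a z.2) * ⟪V z.1, V z.2⟫_ℝ ∂(μ.prod μ) := by
    rw [← real_inner_self_eq_norm_sq, hcv]
    refine Eq.trans ?_ (integral_prod _ ((memLp_tensor ha2 ha2).integrable_mul hh2)).symm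
    refine integral_congr_ae (.of_forall fun x => ?_)
    simp only [Pi.mul_apply]
    rw [real_inner_comm, hcv, ← integral_const_mul]
    refine integral_congr_ae (.of_forall fun y => ?_)
    simp only [real_inner_comm]
    ring
  have hcc' : (‖c‖ ^ 2) ^ 2 ≤ A ^ 2 * B := by
    rw [hcc]
    refine (sq_integral_mul_le (memLp_tensor ha2 ha2) hh2).trans (le_of_eq ?_)
    congr 1
    rw [sq A, hA, ← integral_prod_mul]
    exact integral_congr_ae (.of_forall fun z => by simp only; ring)
  have hc1 : ‖c‖ ^ 2 ≤ A * √B := by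
    refine le_of_sq_le_sq ?_ (by positivity)
    rwa [mul_pow, Real.sq_sqrt hB0]
  have hA2 : A ^ 2 ≤ A * √B * ‖u‖ ^ 2 := by
    calc A ^ 2 ≤ (‖c‖ * ‖u‖) ^ 2 := by
          gcongr
          rw [hcu]
          exact real_inner_le_norm _ _
      _ = ‖c‖ ^ 2 * ‖u‖ ^ 2 := mul_pow _ _ _
      _ ≤ _ := by gcongr
  rcases hA0.eq_or_lt with h0 | h0
  · rw [← h0]; positivity
  · nlinarith

/-- A random vector `V` whose Gram function `⟪V, V'⟫` is square integrable has square integrable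
coordinates. -/
theorem memLp_inner_of_memLp_gram [IsFiniteMeasure μ] {V : 𝓧 → K} (hV : StronglyMeasurable V)
    (hh : MemLp (fun z : 𝓧 × 𝓧 => ⟪V z.1, V z.2⟫_ℝ) 2 (μ.prod μ)) (u : K) :
    MemLp (fun x => ⟪V x, u⟫_ℝ) 2 μ ∧
      ∫ x, ⟪V x, u⟫_ℝ ^ 2 ∂μ ≤ √(∫ z, ⟪V z.1, V z.2⟫_ℝ ^ 2 ∂(μ.prod μ)) * ‖u‖ ^ 2 := by
  set C := √(∫ z, ⟪V z.1, V z.2⟫_ℝ ^ 2 ∂(μ.prod μ)) * ‖u‖ ^ 2 with hC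
  have hC0 : 0 ≤ C := by positivity
  -- Truncating where `‖V‖` exceeds `n` only decreases the squared Gram function, so the bounded
  -- case gives an estimate independent of `n`, and Fatou's lemma passes to the limit.
  let W : ℕ → 𝓧 → K := fun n => {x | ‖V x‖ ≤ n}.indicator V
  have hWm : ∀ n, StronglyMeasurable (W n) := fun n =>
    hV.indicator (hV.norm.measurable measurableSet_Iic)
  have hWb : ∀ n x, ‖W n x‖ ≤ n := fun n x => by
    by_cases hx : ‖V x‖ ≤ n
    · simp [W, hx]
    · simp [W, hx]
  have hWle : ∀ n x y, ⟪W n x, W n y⟫_ℝ ^ 2 ≤ ⟪V x, V y⟫_ℝ ^ 2 := fun n x y => by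
    by_cases hx : ‖V x‖ ≤ n <;> by_cases hy : ‖V y‖ ≤ n <;> simp [W, hx, hy, sq_nonneg]
  have hWC : ∀ n, ∫⁻ x, ENNReal.ofReal (⟪W n x, u⟫_ℝ ^ 2) ∂μ ≤ ENNReal.ofReal C := fun n => by
    have hm : StronglyMeasurable fun x => ⟪W n x, u⟫_ℝ := (hWm n).inner stronglyMeasurable_const
    rw [← ofReal_integral_eq_lintegral_ofReal _ (.of_forall fun x => sq_nonneg _)]
    · refine ENNReal.ofReal_le_ofReal ((integral_inner_sq_le_of_bounded (hWm n) (hWb n) u).trans ?_)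
      refine mul_le_mul_of_nonneg_right (Real.sqrt_le_sqrt ?_) (sq_nonneg _)
      exact integral_mono_of_nonneg (.of_forall fun z => sq_nonneg _) hh.integrable_sq
        (.of_forall fun z => hWle n _ _)
    · refine (MemLp.of_bound hm.aestronglyMeasurable (n * ‖u‖) (.of_forall fun x => ?_)
        : MemLp _ 2 μ).integrable_sq
      exact (norm_inner_le_norm _ _).trans (mul_le_mul_of_nonneg_right (hWb n x) (norm_nonneg _))
  have hlim : ∀ x, liminf (fun n => ENNReal.ofReal (⟪W n x, u⟫_ℝ ^ 2)) atTop =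
      ENNReal.ofReal (⟪V x, u⟫_ℝ ^ 2) := fun x => by
    refine (tendsto_const_nhds.congr' ?_).liminf_eq
    obtain ⟨N, hN⟩ := exists_nat_ge ‖V x‖
    filter_upwards [eventually_ge_atTop N] with n hn
    have : ‖V x‖ ≤ n := hN.trans (by exact_mod_cast hn)
    simp [W, this]
  have hm : StronglyMeasurable fun x => ⟪V x, u⟫_ℝ := hV.inner stronglyMeasurable_const
  have hfin : ∫⁻ x, ENNReal.ofReal (⟪V x, u⟫_ℝ ^ 2) ∂μ ≤ ENNReal.ofReal C := by
    simp_rw [← hlim]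
    refine (lintegral_liminf_le fun n => ?_).trans ?_
    · exact (((hWm n).inner stronglyMeasurable_const).measurable.pow_const 2).ennreal_ofReal
    · exact liminf_le_of_le (by isBoundedDefault) fun b hb =>
        (hb.exists.choose_spec).trans (hWC _)
  have hsq : Integrable (fun x => ⟪V x, u⟫_ℝ ^ 2) μ := by
    refine ⟨(hm.measurable.pow_const 2).aestronglyMeasurable, ?_⟩
    rw [hasFiniteIntegral_iff_ofReal (.of_forall fun x => sq_nonneg _)]
    exact hfin.trans_lt ENNReal.ofReal_lt_top
  refine ⟨(memLp_two_iff_integrable_sq hm.aestronglyMeasurable).2 hsq, ?_⟩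
  rw [← ENNReal.ofReal_le_ofReal_iff hC0,
    ofReal_integral_eq_lintegral_ofReal hsq (.of_forall fun x => sq_nonneg _)]
  exact hfin

/-- The weak mean of a random vector whose Gram function is square integrable. -/
theorem exists_weak_mean [IsProbabilityMeasure μ] {V : 𝓧 → K} (hV : StronglyMeasurable V)
    (hh : MemLp (fun z : 𝓧 × 𝓧 => ⟪V z.1, V z.2⟫_ℝ) 2 (μ.prod μ)) :
    ∃ F : K, ∀ u, ∫ x, ⟪V x, u⟫_ℝ ∂μ = ⟪F, u⟫_ℝ := by
  have hi : ∀ u, Integrable (fun x => ⟪V x, u⟫_ℝ) μ := fun u =>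
    (memLp_inner_of_memLp_gram hV hh u).1.integrable (by norm_num)
  -- `V` need not be Bochner integrable; its mean is defined coordinatewise and represented by
  -- Riesz.
  let L : K →ₗ[ℝ] ℝ :=
    { toFun := fun u => ∫ x, ⟪V x, u⟫_ℝ ∂μ
      map_add' := fun u v => by
        simp_rw [inner_add_right]
        exact integral_add (hi u) (hi v)
      map_smul' := fun c u => by
        simp_rw [inner_smul_right]
        exact integral_const_mul _ _ }
  let C := √(∫ z, ⟪V z.1, V z.2⟫_ℝ ^ 2 ∂(μ.prod μ))
  have hL : ∀ u, ‖L u‖ ≤ √C * ‖u‖ := fun u => by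
    obtain ⟨h1, h2⟩ := memLp_inner_of_memLp_gram hV hh u
    refine abs_le_of_sq_le_sq' ?_ (by positivity) |> abs_le.2
    rw [mul_pow, Real.sq_sqrt (Real.sqrt_nonneg _)]
    exact (sq_integral_le h1).trans h2
  refine ⟨(InnerProductSpace.toDual ℝ K).symm (L.mkContinuous _ hL), fun u => ?_⟩
  rw [InnerProductSpace.toDual_symm_apply]
  rfl

end WeakMean

/-! ### The Stein feature and Stein's identity -/

section Stein

variable {d : ℕ} {p q ρ : E d → ℝ}

theorem IsPosDensity.integrable (hq : IsPosDensity q) : Integrable q := by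
  by_contra h
  have := hq.integral_eq_one
  rw [integral_undef h] at this
  exact zero_ne_one this

theorem IsPosDensity.isProbabilityMeasure (hq : IsPosDensity q) :
    IsProbabilityMeasure (law q) := by
  refine ⟨?_⟩
  rw [law, withDensity_apply _ MeasurableSet.univ, Measure.restrict_univ,
    ← ofReal_integral_eq_lintegral_ofReal hq.integrable (.of_forall fun x => (hq.pos x).le),
    hq.integral_eq_one, ENNReal.ofReal_one]

theorem IsPosDensity.absolutelyContinuous (hq : IsPosDensity q) :
    (volume : Measure (E d)) ≪ law q :=
  withDensity_absolutelyContinuous' hq.measurable.ennreal_ofReal.aemeasurable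
    (.of_forall fun x => by simpa using hq.pos x)

theorem IsPosDensity.integrable_law_iff (hq : IsPosDensity q) {f : E d → ℝ} :
    Integrable f (law q) ↔ Integrable fun x => q x * f x := by
  rw [law, integrable_withDensity_iff_integrable_smul' hq.measurable.ennreal_ofReal
    (.of_forall fun x => ENNReal.ofReal_lt_top)]
  simp only [ENNReal.toReal_ofReal (hq.pos _).le, smul_eq_mul]

theorem IsPosDensity.integral_law (hq : IsPosDensity q) (f : E d → ℝ) :
    ∫ x, f x ∂(law q) = ∫ x, q x * f x := by
  rw [law, integral_withDensity_eq_integral_toReal_smul hq.measurable.ennreal_ofReal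
    (.of_forall fun x => ENNReal.ofReal_lt_top)]
  simp only [ENNReal.toReal_ofReal (hq.pos _).le, smul_eq_mul]

theorem inner_gradient_eq (f : E d → ℝ) (x v : E d) : ⟪gradient f x, v⟫_ℝ = fderiv ℝ f x v := by
  rw [gradient, InnerProductSpace.toDual_symm_apply]

theorem gradient_coord (f : E d → ℝ) (x : E d) (i : Fin d) :
    gradient f x i = fderiv ℝ f x (EuclideanSpace.single i 1) := by
  rw [← inner_gradient_eq, EuclideanSpace.inner_single_right]
  simp

theorem measurable_score (f : E d → ℝ) : Measurable (score f) :=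
  (InnerProductSpace.toDual ℝ (E d)).symm.continuous.measurable.comp (measurable_fderiv ℝ _)

theorem mul_inner_score (hρ : ∀ x, 0 < ρ x) (hd : Differentiable ℝ ρ) (x v : E d) :
    ρ x * ⟪score ρ x, v⟫_ℝ = fderiv ℝ ρ x v := by
  rw [score, inner_gradient_eq, ((hd x).hasFDerivAt.log (hρ x).ne').fderiv]
  simp [(hρ x).ne']

variable {H : Type*} [NormedAddCommGroup H] [InnerProductSpace ℝ H]

theorem fderiv_inner_left {Φ : E d → H} (hd : Differentiable ℝ Φ) (u : H) (x v : E d) :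
    fderiv ℝ (fun z => ⟪u, Φ z⟫_ℝ) x v = ⟪u, fderiv ℝ Φ x v⟫_ℝ := by
  have := ((innerSL ℝ u).hasFDerivAt (x := Φ x)).comp x (hd x).hasFDerivAt
  exact congrArg (· v) this.fderiv

/-- The Hilbert-space valued Stein feature `s_ρ(x) Φ(x) + ∇Φ(x)`. -/
noncomputable def steinFeature (ρ : E d → ℝ) (Φ : E d → H) (x : E d) :
    PiLp 2 (fun _ : Fin d => H) :=
  WithLp.toLp 2 fun i => score ρ x i • Φ x + fderiv ℝ Φ x (EuclideanSpace.single i 1)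

/-- Derivatives pass through the inner product, and the four terms of the Stein kernel are those of
`⟪s Φ + ∇Φ, s' Φ' + ∇Φ'⟫`, summed over coordinates. -/
theorem steinKernel_eq_inner {k : E d → E d → ℝ} {Φ : E d → H} (hd : Differentiable ℝ Φ)
    (hΦ : ∀ x y, k x y = ⟪Φ x, Φ y⟫_ℝ) (x y : E d) :
    steinKernel ρ k x y = ⟪steinFeature ρ Φ x, steinFeature ρ Φ y⟫_ℝ := by
  have h1 : ∀ x y i, gradient (fun y' => k x y') y i =
      ⟪Φ x, fderiv ℝ Φ y (EuclideanSpace.single i 1)⟫_ℝ := fun x y i => by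
    simp only [gradient_coord, hΦ, fderiv_inner_left hd]
  have h2 : ∀ i, gradient (fun x' => k x' y) x i =
      ⟪fderiv ℝ Φ x (EuclideanSpace.single i 1), Φ y⟫_ℝ := fun i => by
    have : (fun x' => k x' y) = fun x' => ⟪Φ y, Φ x'⟫_ℝ := by
      ext x'
      rw [hΦ, real_inner_comm]
    rw [this, gradient_coord, fderiv_inner_left hd, real_inner_comm]
  have h3 : divergence (fun x' => gradient (fun y' => k x' y') y) x =
      ∑ i, ⟪fderiv ℝ Φ x (EuclideanSpace.single i 1),
        fderiv ℝ Φ y (EuclideanSpace.single i 1)⟫_ℝ := by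
    refine Finset.sum_congr rfl fun i _ => ?_
    simp only [h1]
    simp_rw [real_inner_comm (fderiv ℝ Φ y (EuclideanSpace.single i 1))]
    rw [fderiv_inner_left hd, real_inner_comm]
  rw [steinKernel, h3]
  simp only [PiLp.inner_apply, RCLike.inner_apply, conj_trivial, h1, h2]
  rw [hΦ x y, Finset.mul_sum, ← Finset.sum_add_distrib, ← Finset.sum_add_distrib,
    ← Finset.sum_add_distrib]
  refine Finset.sum_congr rfl fun i _ => ?_
  simp only [steinFeature, inner_add_left, inner_add_right, real_inner_smul_left,
    real_inner_smul_right]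
  ring

theorem weightedSteinKernel_eq_inner {k : E d → E d → ℝ} {Φ : E d → H} (hd : Differentiable ℝ Φ)
    (hΦ : ∀ x y, k x y = ⟪Φ x, Φ y⟫_ℝ) (x y : E d) :
    weightedSteinKernel p ρ k x y =
      ⟪weight p ρ x • steinFeature ρ Φ x, weight p ρ y • steinFeature ρ Φ y⟫_ℝ := by
  rw [weightedSteinKernel, steinKernel_eq_inner hd hΦ, real_inner_smul_left,
    real_inner_smul_right]
  ring

/-- `H` is not assumed separable, so strong measurability is obtained from a pointwise limit of
continuous difference quotients. -/
theorem stronglyMeasurable_fderiv_apply {Φ : E d → H} (hd : Differentiable ℝ Φ) (v : E d) :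
    StronglyMeasurable fun x => fderiv ℝ Φ x v := by
  refine stronglyMeasurable_of_tendsto (u := atTop)
    (f := fun (n : ℕ) x => (n : ℝ) • (Φ (x + (n : ℝ)⁻¹ • v) - Φ x)) (fun n => ?_) ?_
  · have hc := hd.continuous
    exact Continuous.stronglyMeasurable (by fun_prop)
  · rw [tendsto_pi_nhds]
    intro x
    refine (hd x).hasFDerivAt.lim v ?_
    simpa using tendsto_natCast_atTop_atTop

theorem stronglyMeasurable_steinFeature {Φ : E d → H} (hd : Differentiable ℝ Φ) :
    StronglyMeasurable (steinFeature ρ Φ) := by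
  have he : steinFeature ρ Φ = fun x => WithLp.toLp 2 (∑ i, Pi.single (M := fun _ : Fin d => H) i
      (score ρ x i • Φ x + fderiv ℝ Φ x (EuclideanSpace.single i 1))) := by
    ext x i
    simp [steinFeature]
  rw [he]
  refine (PiLp.continuous_toLp 2 (fun _ : Fin d => H)).comp_stronglyMeasurable
    (Finset.stronglyMeasurable_fun_sum _ fun i _ => ?_)
  have hs : Measurable fun x => score ρ x i :=
    (EuclideanSpace.proj (𝕜 := ℝ) i).continuous.measurable.comp (measurable_score ρ)
  exact (continuous_single (A := fun _ : Fin d => H) i).comp_stronglyMeasurable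
    ((hs.stronglyMeasurable.smul hd.continuous.stronglyMeasurable).add
      (stronglyMeasurable_fderiv_apply hd _))

/-- The product rule, since `ρ s_ρ = ∇ρ`. -/
theorem mul_inner_steinFeature (hρ : ∀ x, 0 < ρ x) (hρd : Differentiable ℝ ρ) {Φ : E d → H}
    (hd : Differentiable ℝ Φ) (F : PiLp 2 (fun _ : Fin d => H)) (x : E d) :
    ρ x * ⟪steinFeature ρ Φ x, F⟫_ℝ =
      divergence (fun z => ρ z • (WithLp.toLp 2 fun i => ⟪F i, Φ z⟫_ℝ : E d)) x := by
  have hG : Differentiable ℝ fun z => (WithLp.toLp 2 fun i => ⟪F i, Φ z⟫_ℝ : E d) := by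
    refine (PiLp.continuousLinearEquiv 2 ℝ (fun _ : Fin d => ℝ)).symm.differentiable.comp ?_
    exact differentiable_pi.2 fun i => (innerSL ℝ (F i)).differentiable.comp hd
  rw [divergence_smul hρd hG, ← mul_inner_score hρ hρd, ← mul_add]
  congr 1
  simp only [divergence, PiLp.inner_apply, steinFeature, fderiv_inner_left hd]
  rw [← Finset.sum_add_distrib]
  refine Finset.sum_congr rfl fun i _ => ?_
  rw [inner_add_left, real_inner_smul_left, real_inner_comm (F i), real_inner_comm (F i)]
  simp only [RCLike.inner_apply, conj_trivial]
  ring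

/-- Stein's identity: as `p w = ρ`, the integrand against Lebesgue measure is a divergence. The
moment hypothesis makes the field integrable and `hF` makes its divergence integrable, so nothing
escapes to infinity. -/
theorem integral_inner_steinFeature_eq_zero (hp : IsPosDensity p) (hρ : ∀ x, 0 < ρ x)
    (hρd : Differentiable ℝ ρ) {Φ : E d → H} (hd : Differentiable ℝ Φ)
    (hΦp : Integrable (fun x => weight p ρ x * ‖Φ x‖) (law p)) (F : PiLp 2 (fun _ : Fin d => H))
    (hF : Integrable (fun x => ⟪weight p ρ x • steinFeature ρ Φ x, F⟫_ℝ) (law p)) :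
    ∫ x, ⟪weight p ρ x • steinFeature ρ Φ x, F⟫_ℝ ∂(law p) = 0 := by
  have he : ∀ x, p x * ⟪weight p ρ x • steinFeature ρ Φ x, F⟫_ℝ =
      divergence (fun z => ρ z • (WithLp.toLp 2 fun i => ⟪F i, Φ z⟫_ℝ : E d)) x := fun x => by
    rw [← mul_inner_steinFeature hρ hρd hd, real_inner_smul_left, ← mul_assoc, weight,
      mul_div_cancel₀ _ (hp.pos x).ne']
  rw [hp.integrable_law_iff] at hF hΦp
  rw [hp.integral_law]
  simp_rw [he] at hF ⊢
  have hG : Differentiable ℝ fun z => (WithLp.toLp 2 fun i => ⟪F i, Φ z⟫_ℝ : E d) := by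
    refine (PiLp.continuousLinearEquiv 2 ℝ (fun _ : Fin d => ℝ)).symm.differentiable.comp ?_
    exact differentiable_pi.2 fun i => (innerSL ℝ (F i)).differentiable.comp hd
  refine integral_divergence_eq_zero (hρd.smul hG) ?_ hF
  refine (PiLp.continuousLinearEquiv 2 ℝ (fun _ : Fin d => ℝ)).symm.toContinuousLinearMap
    |>.integrable_comp (φ := fun z i => ρ z * ⟪F i, Φ z⟫_ℝ) ?_
  refine Integrable.of_eval fun i => ?_
  refine (hΦp.const_mul ‖F i‖).mono' ?_ (.of_forall fun x => ?_)
  · exact (hρd.continuous.mul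
      ((innerSL ℝ (F i)).continuous.comp hd.continuous)).aestronglyMeasurable
  · rw [← mul_assoc (p x), weight, mul_div_cancel₀ _ (hp.pos x).ne', norm_mul,
      Real.norm_of_nonneg (hρ x).le]
    calc ρ x * ‖⟪F i, Φ x⟫_ℝ‖ ≤ ρ x * (‖F i‖ * ‖Φ x‖) := by
          gcongr
          · exact (hρ x).le
          · exact norm_inner_le_norm _ _
      _ = _ := by ring

end Stein

/-! ### From vanishing variance to equality of densities -/

section Degeneracy

variable {d : ℕ} {p q ρ : E d → ℝ} {k : E d → E d → ℝ} {H : Type*} [NormedAddCommGroup H]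
  [InnerProductSpace ℝ H] {Φ : E d → H}

theorem measurable_weight (hp : Measurable p) (hρ : Measurable ρ) : Measurable (weight p ρ) :=
  hρ.div hp

theorem differentiable_weight (hp : ∀ x, 0 < p x) (hpd : Differentiable ℝ p)
    (hρd : Differentiable ℝ ρ) : Differentiable ℝ (weight p ρ) := by
  have : weight p ρ = fun x => ρ x * (p x)⁻¹ := funext fun x => div_eq_mul_inv _ _
  rw [this]
  exact hρd.mul (hpd.inv fun x => (hp x).ne')

/-- The weak mean linearizes the projection of the kernel: averaging over `y` replaces the second
feature by `F`, for every `x` and not just almost every one. -/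
theorem exists_stein_weak_mean [CompleteSpace H] (hq : IsPosDensity q) (hp : Measurable p)
    (hρ : Measurable ρ) (hd : Differentiable ℝ Φ) (hΦ : ∀ x y, k x y = ⟪Φ x, Φ y⟫_ℝ)
    (hmom : MemLp (fun z : E d × E d => weightedSteinKernel p ρ k z.1 z.2) 2
      ((law q).prod (law q))) :
    ∃ F : PiLp 2 (fun _ : Fin d => H),
      (∀ u, MemLp (fun x => ⟪weight p ρ x • steinFeature ρ Φ x, u⟫_ℝ) 2 (law q) ∧
        ∫ x, ⟪weight p ρ x • steinFeature ρ Φ x, u⟫_ℝ ∂(law q) = ⟪F, u⟫_ℝ) ∧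
      ∀ x, ∫ y, weightedSteinKernel p ρ k x y ∂(law q) =
        ⟪weight p ρ x • steinFeature ρ Φ x, F⟫_ℝ := by
  have := hq.isProbabilityMeasure
  have hV : StronglyMeasurable fun x => weight p ρ x • steinFeature ρ Φ x :=
    (measurable_weight hp hρ).stronglyMeasurable.smul (stronglyMeasurable_steinFeature hd)
  simp_rw [weightedSteinKernel_eq_inner hd hΦ] at hmom ⊢
  obtain ⟨F, hF⟩ := exists_weak_mean hV hmom
  refine ⟨F, fun u => ⟨(memLp_inner_of_memLp_gram hV hmom u).1, hF u⟩, fun x => ?_⟩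
  rw [real_inner_comm, ← hF]
  simp_rw [real_inner_comm]

/-- The constant is computed twice: under `q` it is `‖F‖²`, under `p` it is zero by Stein's
identity. Integrability under `p` is automatic for a constant, and null sets transfer because both
densities are positive. -/
theorem weak_mean_eq_zero (hq : IsPosDensity q) (hp : IsPosDensity p) (hρ : ∀ x, 0 < ρ x)
    (hρd : Differentiable ℝ ρ) (hd : Differentiable ℝ Φ)
    (hΦp : Integrable (fun x => weight p ρ x * ‖Φ x‖) (law p))
    {F : PiLp 2 (fun _ : Fin d => H)}
    (hF : ∫ x, ⟪weight p ρ x • steinFeature ρ Φ x, F⟫_ℝ ∂(law q) = ⟪F, F⟫_ℝ) {c : ℝ}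
    (hc : ∀ᵐ x ∂(law q), ⟪weight p ρ x • steinFeature ρ Φ x, F⟫_ℝ = c) : F = 0 := by
  have := hq.isProbabilityMeasure
  have := hp.isProbabilityMeasure
  have hcp : ∀ᵐ x ∂(law p), ⟪weight p ρ x • steinFeature ρ Φ x, F⟫_ℝ = c :=
    ((withDensity_absolutelyContinuous _ _).trans hq.absolutelyContinuous).ae_le hc
  have h0 := integral_inner_steinFeature_eq_zero hp hρ hρd hd hΦp F
    ((integrable_const c).congr (hcp.mono fun x hx => hx.symm))
  rw [integral_congr_ae hcp, integral_const, probReal_univ, one_smul] at h0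
  rw [integral_congr_ae hc, integral_const, probReal_univ, one_smul, h0] at hF
  exact inner_self_eq_zero.1 hF.symm

/-- The logarithmic gradient of `q ρ / p` is `s_q + s_ρ - s_p`; it is read off by differentiating
the identity `p (q w) = q ρ`. -/
theorem fderiv_density_ratio (hq : ∀ x, 0 < q x) (hp : ∀ x, 0 < p x) (hρ : ∀ x, 0 < ρ x)
    (hqd : Differentiable ℝ q) (hpd : Differentiable ℝ p) (hρd : Differentiable ℝ ρ) (x v : E d) :
    fderiv ℝ (fun z => q z * weight p ρ z) x v =
      q x * weight p ρ x * (⟪score ρ x, v⟫_ℝ + ⟪score q x - score p x, v⟫_ℝ) := by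
  have hm : Differentiable ℝ fun z => q z * weight p ρ z :=
    hqd.mul (differentiable_weight hp hpd hρd)
  have he : (fun z => p z * (q z * weight p ρ z)) = fun z => q z * ρ z := by
    ext z
    rw [weight]
    field_simp [(hp z).ne']
  have h1 := congrArg (· v) ((hpd x).hasFDerivAt.mul (hm x).hasFDerivAt).fderiv
  have h2 := congrArg (· v) ((hqd x).hasFDerivAt.mul (hρd x).hasFDerivAt).fderiv
  simp only [Pi.mul_def, he] at h1
  simp only [Pi.mul_def] at h2
  rw [h2] at h1
  simp only [add_apply, smul_apply, smul_eq_mul,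
    ← mul_inner_score hq hqd, ← mul_inner_score hp hpd, ← mul_inner_score hρ hρd] at h1
  have hp0 := (hp x).ne'
  rw [← mul_right_inj' hp0, inner_sub_left]
  have hw : p x * weight p ρ x = ρ x := mul_div_cancel₀ _ hp0
  linear_combination -h1 - (q x * ⟪score ρ x, v⟫_ℝ + q x * ⟪score q x, v⟫_ℝ) * hw

/-- If the weak mean of the Stein feature vanishes, then so does the kernel mean embedding of
every coordinate of the score gap. -/
theorem integral_mul_scoreGap_eq_zero (hq : IsPosDensity q) (hp : IsPosDensity p)
    (hρ : ∀ x, 0 < ρ x) (hqd : Differentiable ℝ q) (hpd : Differentiable ℝ p)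
    (hρd : Differentiable ℝ ρ) (hd : Differentiable ℝ Φ)
    (hΦq : Integrable (fun x => weight p ρ x * ‖Φ x‖) (law q))
    (hint : ∀ u, Integrable (fun x => ⟪weight p ρ x • steinFeature ρ Φ x, u⟫_ℝ) (law q))
    (hzero : ∀ u, ∫ x, ⟪weight p ρ x • steinFeature ρ Φ x, u⟫_ℝ ∂(law q) = 0)
    (a : H) (i : Fin d) (hg : Integrable fun y => ⟪a, Φ y⟫_ℝ * scoreGap q p ρ y i) :
    ∫ y, ⟪a, Φ y⟫_ℝ * scoreGap q p ρ y i = 0 := by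
  set u : PiLp 2 (fun _ : Fin d => H) := WithLp.toLp 2 (Pi.single i a) with hu
  have hm : Differentiable ℝ fun z => q z * weight p ρ z :=
    hqd.mul (differentiable_weight hp.pos hpd hρd)
  have hf : Differentiable ℝ fun z => ⟪a, Φ z⟫_ℝ := (innerSL ℝ a).differentiable.comp hd
  have hcoord : ∀ v : E d, ⟪v, EuclideanSpace.single i 1⟫_ℝ = v i := fun v => by
    rw [EuclideanSpace.inner_single_right]
    simp
  have hui : ∀ y, ⟪steinFeature ρ Φ y, u⟫_ℝ = score ρ y i * ⟪a, Φ y⟫_ℝ +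
      ⟪a, fderiv ℝ Φ y (EuclideanSpace.single i 1)⟫_ℝ := fun y => by
    rw [PiLp.inner_apply, Finset.sum_eq_single i]
    · simp only [hu, steinFeature, Pi.single_eq_same, real_inner_comm a, inner_add_right,
        real_inner_smul_right]
    · intro j _ hj
      simp [hu, hj]
    · simp
  -- Along coordinate `i`, the derivative of `q w ⟪a, Φ⟫` is the `q`-weighted Stein feature tested
  -- against `u` plus the score gap term. Its total integral is zero, and so is that of the first
  -- summand.
  have hder : ∀ y, fderiv ℝ (fun z => q z * weight p ρ z * ⟪a, Φ z⟫_ℝ) y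
      (EuclideanSpace.single i 1) = q y * ⟪weight p ρ y • steinFeature ρ Φ y, u⟫_ℝ +
        ⟪a, Φ y⟫_ℝ * scoreGap q p ρ y i := fun y => by
    have h1 := congrArg (· (EuclideanSpace.single i (1 : ℝ)))
      ((hm y).hasFDerivAt.mul (hf y).hasFDerivAt).fderiv
    simp only [Pi.mul_def] at h1
    rw [h1]
    simp only [add_apply, smul_apply, smul_eq_mul]
    rw [fderiv_inner_left hd, fderiv_density_ratio hq.pos hp.pos hρ hqd hpd hρd,
      real_inner_smul_left, hui, hcoord, hcoord]
    simp only [scoreGap, PiLp.smul_apply, PiLp.sub_apply, smul_eq_mul]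
    ring
  have hi := hq.integrable_law_iff.1 (hint u)
  have h0 := hzero u
  rw [hq.integral_law] at h0
  have hfi : Integrable fun z => q z * weight p ρ z * ⟪a, Φ z⟫_ℝ := by
    refine ((hq.integrable_law_iff.1 hΦq).const_mul ‖a‖).mono'
      (hm.continuous.mul hf.continuous).aestronglyMeasurable (.of_forall fun z => ?_)
    have hw : 0 < q z * weight p ρ z := mul_pos (hq.pos z) (div_pos (hρ z) (hp.pos z))
    rw [norm_mul, Real.norm_of_nonneg hw.le]
    calc _ ≤ q z * weight p ρ z * (‖a‖ * ‖Φ z‖) := by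
          gcongr
          exact norm_inner_le_norm _ _
      _ = _ := by ring
  have key := integral_fderiv_apply_eq_zero (hm.mul hf) hfi (EuclideanSpace.single i 1) (by
    simp only [Pi.mul_def, hder]
    exact hi.add hg)
  simp only [Pi.mul_def, hder] at key
  rwa [integral_add hi hg, h0, zero_add] at key

/-- Equal scores make `log q - log p` constant, and both densities have total mass one. -/
theorem eq_of_ae_score_eq (hq : IsPosDensity q) (hp : IsPosDensity p) (hqd : Differentiable ℝ q)
    (hpd : Differentiable ℝ p) (h : ∀ᵐ x, score q x = score p x) : q = p := by
  have hlq : Differentiable ℝ fun x => Real.log (q x) := hqd.log fun x => (hq.pos x).ne'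
  have hlp : Differentiable ℝ fun x => Real.log (p x) := hpd.log fun x => (hp.pos x).ne'
  have hc := eq_of_ae_fderiv_eq_zero (hlq.sub hlp) (by
    filter_upwards [h] with x hx
    rw [fderiv_sub (hlq x) (hlp x), sub_eq_zero]
    ext v
    rw [← inner_gradient_eq, ← inner_gradient_eq]
    exact congrArg (⟪·, v⟫_ℝ) hx)
  have hqp : ∀ x, q x = q 0 / p 0 * p x := fun x => by
    have h1 := hc x 0
    simp only [Pi.sub_apply] at h1
    rw [← Real.log_div (hq.pos _).ne' (hp.pos _).ne', ← Real.log_div (hq.pos _).ne' (hp.pos _).ne']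
      at h1
    rw [← Real.log_injOn_pos (div_pos (hq.pos x) (hp.pos x)) (div_pos (hq.pos 0) (hp.pos 0)) h1,
      div_mul_cancel₀ _ (hp.pos x).ne']
  have h1 := hq.integral_eq_one
  rw [integral_congr_ae (.of_forall hqp), integral_const_mul, hp.integral_eq_one, mul_one] at h1
  ext x
  rw [hqp, h1, one_mul]

/-- A nonzero coordinate would have positive energy, but by Fubini its energy is an integral of
vanishing inner integrals. Absolute convergence makes the inner integral legitimate for almost every
`x` with `g x ≠ 0`; where `g x = 0` the outer factor vanishes. -/
theorem scoreGap_ae_eq_zero (hk : Continuous (Function.uncurry k))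
    (hispd : IsIntegrallyStrictlyPosDef k) (hg : MemLp (scoreGap q p ρ) 2 volume)
    (hgi : Integrable (fun z : E d × E d =>
      ‖scoreGap q p ρ z.1‖ * |k z.1 z.2| * ‖scoreGap q p ρ z.2‖) (volume.prod volume))
    (h : ∀ x i, Integrable (fun y => k x y * scoreGap q p ρ y i) →
      ∫ y, k x y * scoreGap q p ρ y i = 0) : ∀ᵐ x, scoreGap q p ρ x = 0 := by
  set g := scoreGap q p ρ with hgdef
  have hgc : ∀ i, MemLp (fun x => g x i) 2 volume := fun i =>
    (EuclideanSpace.proj (𝕜 := ℝ) (ι := Fin d) i).comp_memLp' hg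
  have hle : ∀ x i, |g x i| ≤ ‖g x‖ := fun x i => PiLp.norm_apply_le (g x) i
  suffices ∀ i, ∀ᵐ x, g x i = 0 by
    filter_upwards [ae_all_iff.2 this] with x hx
    ext i
    exact hx i
  intro i
  have hii : Integrable (fun z : E d × E d => g z.1 i * k z.1 z.2 * g z.2 i)
      (volume.prod volume) := by
    refine hgi.mono' (((hgc i).1.comp_fst.mul hk.aestronglyMeasurable).mul (hgc i).1.comp_snd)
      (.of_forall fun z => ?_)
    rw [norm_mul, norm_mul]
    exact mul_le_mul (mul_le_mul_of_nonneg_right (hle _ _) (abs_nonneg _)) (hle _ _)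
      (abs_nonneg _) (by positivity)
  by_contra hne
  refine (hispd (fun x => g x i) (hgc i) hne hii).ne' ?_
  rw [integral_prod _ hii]
  refine integral_eq_zero_of_ae ?_
  filter_upwards [hgi.prod_right_ae] with x hx
  simp only [Pi.zero_apply, mul_assoc] at hx ⊢
  rw [integral_const_mul]
  by_cases hx0 : g x = 0
  · simp [hx0]
  rw [h x i ?_, mul_zero]
  have hx1 := hx.const_mul ‖g x‖⁻¹
  refine hx1.mono' ((hk.comp (Continuous.prodMk_right x)).aestronglyMeasurable.mul (hgc i).1)
    (.of_forall fun y => ?_)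
  rw [inv_mul_cancel_left₀ (norm_ne_zero_iff.2 hx0), norm_mul]
  exact mul_le_mul_of_nonneg_left (hle _ _) (abs_nonneg _)

end Degeneracy

end GFKSD

/-! ### The limit theorems for the gradient-free kernel Stein discrepancy -/

theorem mainTheorem8 {d : ℕ} (q p ρ : GFKSD.E d → ℝ) (k : GFKSD.E d → GFKSD.E d → ℝ)
    (hq : GFKSD.IsPosDensity q) (hp : GFKSD.IsPosDensity p) (hρ : GFKSD.IsPosDensity ρ)
    (hρ_diff : Differentiable ℝ ρ)
    (hk : GFKSD.IsPosDefKernel k) (hk_smooth : ContDiff ℝ 2 (Function.uncurry k))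
    -- second moment of the weighted Stein kernel under `q ⊗ q`
    (hmom : MemLp (fun z : GFKSD.E d × GFKSD.E d => GFKSD.weightedSteinKernel p ρ k z.1 z.2) 2
      ((GFKSD.law q).prod (GFKSD.law q)))
    -- `E_q[w(x) √k(x,x)] < ∞` and `E_p[w(x) √k(x,x)] < ∞`
    (hkq : Integrable (fun x => GFKSD.weight p ρ x * √(k x x)) (GFKSD.law q))
    (hkp : Integrable (fun x => GFKSD.weight p ρ x * √(k x x)) (GFKSD.law p))
    -- an i.i.d. sample from `q`
    {Ω : Type*} [MeasurableSpace Ω] (P : Measure Ω) [IsProbabilityMeasure P]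
    (X : ℕ → Ω → GFKSD.E d) (hX_law : ∀ i, HasLaw (X i) (GFKSD.law q) P)
    (hX_indep : iIndepFun X P)
    -- i.i.d. standard Gaussian variables
    {Ω' : Type*} [MeasurableSpace Ω'] (P' : Measure Ω') [IsProbabilityMeasure P']
    (Z : ℕ → Ω' → ℝ) (hZ_law : ∀ j, HasLaw (Z j) (gaussianReal 0 1) P')
    (hZ_indep : iIndepFun Z P') :
    (q ≠ p →
      TendstoInDistribution
        (fun (n : ℕ) ω => √(n : ℝ) *
          (GFKSD.uStat p ρ k n (fun i => X i ω) - GFKSD.gfKSD q p ρ k))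
        atTop (id : ℝ → ℝ) (fun _ => P)
        (gaussianReal 0 (4 * GFKSD.sigmaSq q p ρ k).toNNReal) ∧
      (Differentiable ℝ q → Differentiable ℝ p → GFKSD.IsIntegrallyStrictlyPosDef k →
        MemLp (GFKSD.scoreGap q p ρ) 2 volume →
        Integrable (fun z : GFKSD.E d × GFKSD.E d =>
          ‖GFKSD.scoreGap q p ρ z.1‖ * |k z.1 z.2| * ‖GFKSD.scoreGap q p ρ z.2‖)
          (volume.prod volume) →
        GFKSD.sigmaSq q p ρ k ≠ 0)) ∧
    (q = p →
      GFKSD.sigmaSq q p ρ k = 0 ∧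
      (∃ c : ℕ → ℝ,
        GFKSD.IsEigenvalueSeq (GFKSD.weightedSteinKernel p ρ k) (GFKSD.law p) c) ∧
      ∀ c : ℕ → ℝ,
        GFKSD.IsEigenvalueSeq (GFKSD.weightedSteinKernel p ρ k) (GFKSD.law p) c →
        ∃ Y : Ω' → ℝ,
          (∀ᵐ ω' ∂P', Tendsto (fun m : ℕ => ∑ j ∈ Finset.range m, c j * ((Z j ω') ^ 2 - 1))
            atTop (𝓝 (Y ω'))) ∧
          TendstoInDistribution
            (fun (n : ℕ) ω => (n : ℝ) * GFKSD.uStat p ρ k n (fun i => X i ω))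
            atTop Y (fun _ => P) P') := by
  obtain ⟨H, _, _, _, Φ, hΦ⟩ := GFKSD.exists_featureMap k hk
  have hd : Differentiable ℝ Φ := GFKSD.differentiable_featureMap hk_smooth hΦ
  have hprob := hq.isProbabilityMeasure
  have hsqrt : ∀ x, √(k x x) = ‖Φ x‖ := fun x => by
    rw [hΦ, real_inner_self_eq_norm_sq, Real.sqrt_sq (norm_nonneg _)]
  simp_rw [hsqrt] at hkq hkp
  have hsymm : ∀ x y, GFKSD.weightedSteinKernel p ρ k x y =
      GFKSD.weightedSteinKernel p ρ k y x := fun x y => by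
    rw [GFKSD.weightedSteinKernel_eq_inner hd hΦ, GFKSD.weightedSteinKernel_eq_inner hd hΦ,
      real_inner_comm]
  obtain ⟨F, hF, hH⟩ := GFKSD.exists_stein_weak_mean hq hp.measurable hρ.measurable hd hΦ hmom
  refine ⟨fun hne => ⟨GFKSD.tendstoInDistribution_uStatistic hX_law hX_indep hmom hsymm,
    fun hqd hpd hispd hg hgi hσ => hne ?_⟩, ?_⟩
  · rw [GFKSD.sigmaSq] at hσ
    simp_rw [hH] at hσ
    -- Zero variance makes `⟪V, F⟫` almost everywhere equal to its mean, which is the constancy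
    -- needed here.
    have hF0 := GFKSD.weak_mean_eq_zero hq hp hρ.pos hρ_diff hd hkp (hF F).2
      (ae_eq_integral_of_variance_eq_zero (hF F).1 hσ)
    have hgap := GFKSD.scoreGap_ae_eq_zero hk_smooth.continuous hispd hg hgi fun x i hi => by
      simp_rw [hΦ] at hi ⊢
      exact GFKSD.integral_mul_scoreGap_eq_zero hq hp hρ.pos hqd hpd hρ_diff hd hkq
        (fun u => (hF u).1.integrable (by norm_num))
        (fun u => by rw [(hF u).2, hF0, inner_zero_left]) (Φ x) i hi
    refine GFKSD.eq_of_ae_score_eq hq hp hqd hpd ?_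
    filter_upwards [hgap] with x hx
    have hm : GFKSD.weight p ρ x * q x ≠ 0 :=
      (mul_pos (div_pos (hρ.pos x) (hp.pos x)) (hq.pos x)).ne'
    exact sub_eq_zero.1 ((smul_eq_zero.1 hx).resolve_left hm)
  · rintro rfl
    -- With equal densities, the mean of `⟪V, F⟫` is both `‖F‖²` and zero by Stein's identity, so
    -- the kernel is degenerate at every point.
    have hF0 : F = 0 := by
      have h0 := GFKSD.integral_inner_steinFeature_eq_zero hp hρ.pos hρ_diff hd hkp F
        ((hF F).1.integrable (by norm_num))
      rw [(hF F).2] at h0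
      exact inner_self_eq_zero.1 h0
    have hdeg : ∀ x, ∫ y, GFKSD.weightedSteinKernel q ρ k x y ∂(GFKSD.law q) = 0 := fun x => by
      rw [hH, hF0, inner_zero_right]
    refine ⟨?_, GFKSD.exists_isEigenvalueSeq hmom hsymm, fun c hc =>
      GFKSD.tendstoInDistribution_degenerate hX_law hX_indep hZ_law hZ_indep hmom hsymm
        (.of_forall hdeg) hc⟩
    rw [GFKSD.sigmaSq]
    simp_rw [hdeg]
    exact variance_zero _
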